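/- Let $k$ be a commutative ring and $A$ a $k$-algebra, with commuting algebra automorphisms $U,D$ of $A$ and an invertible solution $\rho=\sum e\otimes e'\in A\otimes_k A$ of the algebraic Yang–Baxter equation $\rho_{12}\rho_{13}\rho_{23}=\rho_{23}\rho_{13}\rho_{12}$; write $\rho^{-1}=\sum E\otimes E'$. The tuple $(A,\rho,D,U)$ is an *oriented quantum algebra* if moreover $(U\otimes U)\rho=\rho$, $(D\otimes D)\rho=\rho$, and $(1\otimes U)\rho$ and $(D\otimes 1)\rho^{-1}$ are inverse to each other in the algebra $A\otimes A^{op}$. The *oriented tangle category* $\mathrm{Tang}$ has as objects the finite lists of signs $\pm$ and as morphisms the oriented tangle diagrams, composed by stacking and juxtaposition from oriented cups, caps and crossings in all orientations, modulo regular isotopy: planar deformations (including cancellation of adjacent maxima and minima), all oriented Reidemeister moves II and III, and all switchback moves (passing a string over or under across a maximum or a minimum). Reidemeister move I is not included. The category $\mathrm{Cat}(A)$ depends on $A,U,D$ only. It has the same objects, and its morphisms are the $k$-linear combinations of oriented flat tangles decorated by beads from $A$, with composition and juxtaposition bilinear, modulo the flat versions of the above moves and the following rules. Beads are additive and $k$-linear;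 a bead $1$ may be omitted; beads on one string are multiplied in the order in which they are met along its orientation; beads slide freely through flat crossings. A bead $a$ on the right leg of a cap equals the bead $U(a)$ on its left leg if the left leg is rising, and $D(a)$ if it is falling. A bead $a$ on the left leg of a cup equals the bead $U(a)$ on its right leg if the right leg is rising, and $D(a)$ if it is falling. Let $F$ replace every crossing of a tangle diagram by the flat crossing decorated as follows, and leave cups and caps unchanged. Call $p$ the string from bottom left to top right and $q$ the string from bottom right to top left; the bead listed first is on $p$, the second on $q$. * $p,q$ both upward or both downward: $e\otimes e'$ if $p$ is over, $E'\otimes E$ if $q$ is over. * $p$ upward, $q$ downward: $U(E)\otimes E'$ if $p$ is over, $U(e')\otimes e$ if $q$ is over. * $p$ downward, $q$ upward: $D(E)\otimes E'$ if $p$ is over, $D(e')\otimes e$ if $q$ is over. Then: 1. If $(A,\rho,D,U)$ is an oriented quantum algebra, then $F$ is well defined: there is exactly one functor $\mathrm{Tang}\to\mathrm{Cat}(A)$ that is the identity on objects and is given on tangles by this decoration of diagrams. 2. Conversely, if the decoration defines such a functor, then $(A,\rho,D,U)$ is an oriented quantum algebra. More precisely: * the decoration is invariant under all switchback moves if and only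 if $(U\otimes U)\rho=\rho$ and $(D\otimes D)\rho=\rho$; * the decoration is invariant under the reverse (antiparallel) Reidemeister II moves in which the downward string passes over the upward one if and only if $(1\otimes U)\rho$ and $(D\otimes 1)\rho^{-1}$ are inverse to each other in $A\otimes A^{op}$; * if $(U\otimes U)\rho=\rho$ and $(D\otimes D)\rho=\rho$, then the same condition is equivalent to invariance under all reverse Reidemeister II moves. -/

import Mathlib

open CategoryTheory
open scoped TensorProduct

/-! ## Oriented tangles up to regular isotopy -/

/-- The two signs: an upward (`+`) or a downward (`-`) oriented strand. -/
inductive Dir : Type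
  | up : Dir
  | down : Dir

/-- Oriented tangle diagrams, arranged with respect to the vertical direction. `TangleDiagram a b`
has the sign list `a` at the bottom and the sign list `b` at the top. `comp S T` is `S` placed below
`T`, and `tensor S T` is `S` placed to the left of `T`. -/
inductive TangleDiagram : List Dir → List Dir → Type
  | id (a : List Dir) : TangleDiagram a a
  | comp {a b c : List Dir} (S : TangleDiagram a b) (T : TangleDiagram b c) : TangleDiagram a c
  | tensor {a b c d : List Dir} (S : TangleDiagram a b) (T : TangleDiagram c d) :
      TangleDiagram (a ++ c) (b ++ d)
  /-- a minimum; its two legs, from left to right, have opposite signs `s` and `t` -/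
  | cup {s t : Dir} (h : s ≠ t) : TangleDiagram [] [s, t]
  /-- a maximum; its two legs, from left to right, have opposite signs `s` and `t` -/
  | cap {s t : Dir} (h : s ≠ t) : TangleDiagram [s, t] []
  /-- a crossing of the strand from bottom left to top right, of sign `s`, with the strand from
  bottom right to top left, of sign `t`; the former is the overcrossing strand iff `o = true` -/
  | crossing (s t : Dir) (o : Bool) : TangleDiagram [s, t] [t, s]

namespace TangleDiagram

/-- Rewrite the sign lists of a diagram along equalities. -/
def cast {a a' b b' : List Dir} (ha : a = a') (hb : b = b') (T : TangleDiagram a b) :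
    TangleDiagram a' b' :=
  ha ▸ hb ▸ T

/-- The switchback moves: a string of sign `u` passes across a maximum or across a minimum. It is
below the other string, or above it, before and after the move. -/
inductive Switchback : ∀ {a b : List Dir}, TangleDiagram a b → TangleDiagram a b → Prop
  | cap {s t : Dir} (h : s ≠ t) (u : Dir) (o : Bool) :
      Switchback (a := [s, u, t]) (b := [u])
        (comp (b := [u, s, t])
          (tensor (crossing s u o) (id [t])) (tensor (id [u]) (cap h)))
        (comp (b := [s, t, u])
          (tensor (id [s]) (crossing u t (!o))) (tensor (cap h) (id [u])))
  | cup {s t : Dir} (h : s ≠ t) (u : Dir) (o : Bool) :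
      Switchback (a := [u]) (b := [s, u, t])
        (comp (b := [u, s, t])
          (tensor (id [u]) (cup h)) (tensor (crossing u s o) (id [t])))
        (comp (b := [s, t, u])
          (tensor (cup h) (id [u])) (tensor (id [s]) (crossing t u (!o))))

/-- The second Reidemeister moves. -/
inductive ReidemeisterTwo : ∀ {a b : List Dir}, TangleDiagram a b → TangleDiagram a b → Prop
  | mk (s t : Dir) (o : Bool) :
      ReidemeisterTwo (comp (crossing s t o) (crossing t s (!o))) (id [s, t])

/-- The reverse second Reidemeister moves (antiparallel strings) in which the overcrossing string
has sign `r`. -/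
inductive ReverseTwo (r : Dir) :
    ∀ {a b : List Dir}, TangleDiagram a b → TangleDiagram a b → Prop
  | left {t : Dir} (h : r ≠ t) :
      ReverseTwo r (comp (crossing r t true) (crossing t r false)) (id [r, t])
  | right {t : Dir} (h : t ≠ r) :
      ReverseTwo r (comp (crossing t r false) (crossing r t true)) (id [t, r])

/-- The third Reidemeister moves. The strings are numbered from left to right at the bottom, and
`oij = true` iff the `i`-th string passes over the `j`-th; the condition `h` excludes the two
patterns in which none of the three strings is on top. -/
inductive ReidemeisterThree : ∀ {a b : List Dir}, TangleDiagram a b → TangleDiagram a b → Prop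
  | mk (s t u : Dir) (o12 o13 o23 : Bool) (h : o12 = o23 → o13 = o12) :
      ReidemeisterThree (a := [s, t, u]) (b := [u, t, s])
        (comp (b := [t, s, u]) (tensor (crossing s t o12) (id [u]))
          (comp (b := [t, u, s]) (tensor (id [t]) (crossing s u o13))
            (tensor (crossing t u o23) (id [s]))))
        (comp (b := [s, u, t]) (tensor (id [s]) (crossing t u o23))
          (comp (b := [u, s, t]) (tensor (crossing s u o13) (id [t]))
            (tensor (id [u]) (crossing s t o12))))

/-- Cancellation of an adjacent maximum and minimum. -/
inductive Zigzag : ∀ {a b : List Dir}, TangleDiagram a b → TangleDiagram a b → Prop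
  | left {s t : Dir} (h : s ≠ t) :
      Zigzag (a := [s]) (b := [s])
        (comp (b := [s, t, s]) (tensor (cup h) (id [s])) (tensor (id [s]) (cap h.symm)))
        (id [s])
  | right {s t : Dir} (h : s ≠ t) :
      Zigzag (a := [s]) (b := [s])
        (comp (b := [s, t, s]) (tensor (id [s]) (cup h.symm)) (tensor (cap h) (id [s])))
        (id [s])

/-- Regular isotopy of tangle diagrams. The constructors from `id_comp` to `interchange` express that
diagrams which are stacked and juxtaposed from the same elementary tangles up to a planar
deformation that preserves the maxima, minima and crossings are the same. There is no first
Reidemeister move. -/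
inductive RegularIsotopy : ∀ {a b : List Dir}, TangleDiagram a b → TangleDiagram a b → Prop
  | refl {a b} (S : TangleDiagram a b) : RegularIsotopy S S
  | symm {a b} {S T : TangleDiagram a b} : RegularIsotopy S T → RegularIsotopy T S
  | trans {a b} {S T R : TangleDiagram a b} :
      RegularIsotopy S T → RegularIsotopy T R → RegularIsotopy S R
  | comp_congr {a b c} {S S' : TangleDiagram a b} {T T' : TangleDiagram b c} :
      RegularIsotopy S S' → RegularIsotopy T T' → RegularIsotopy (comp S T) (comp S' T')
  | tensor_congr {a b c d} {S S' : TangleDiagram a b} {T T' : TangleDiagram c d} :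
      RegularIsotopy S S' → RegularIsotopy T T' → RegularIsotopy (tensor S T) (tensor S' T')
  | id_comp {a b} (S : TangleDiagram a b) : RegularIsotopy (comp (id a) S) S
  | comp_id {a b} (S : TangleDiagram a b) : RegularIsotopy (comp S (id b)) S
  | assoc {a b c d} (S : TangleDiagram a b) (T : TangleDiagram b c) (R : TangleDiagram c d) :
      RegularIsotopy (comp (comp S T) R) (comp S (comp T R))
  | tensor_id (a b : List Dir) : RegularIsotopy (tensor (id a) (id b)) (id (a ++ b))
  | nil_tensor {a b} (S : TangleDiagram a b) : RegularIsotopy (tensor (id []) S) S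
  | tensor_nil {a b} (S : TangleDiagram a b) :
      RegularIsotopy (cast (List.append_nil a) (List.append_nil b) (tensor S (id []))) S
  | tensor_assoc {a a' b b' c c'} (S : TangleDiagram a a') (T : TangleDiagram b b')
      (R : TangleDiagram c c') :
      RegularIsotopy
        (cast (List.append_assoc a b c) (List.append_assoc a' b' c') (tensor (tensor S T) R))
        (tensor S (tensor T R))
  | interchange {a b c a' b' c'} (S : TangleDiagram a b) (T : TangleDiagram b c)
      (S' : TangleDiagram a' b') (T' : TangleDiagram b' c') :
      RegularIsotopy (tensor (comp S T) (comp S' T')) (comp (tensor S S') (tensor T T'))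
  | zigzag {a b} {S T : TangleDiagram a b} : Zigzag S T → RegularIsotopy S T
  | two {a b} {S T : TangleDiagram a b} : ReidemeisterTwo S T → RegularIsotopy S T
  | three {a b} {S T : TangleDiagram a b} : ReidemeisterThree S T → RegularIsotopy S T
  | switchback {a b} {S T : TangleDiagram a b} : Switchback S T → RegularIsotopy S T

end TangleDiagram

/-- The oriented tangle category: objects are lists of signs, morphisms are oriented tangle diagrams
modulo regular isotopy. -/
def Tang : Type := List Dir

/-- The hom sets of the tangle category. -/
def TangHom (a b : List Dir) : Type :=
  Quot (TangleDiagram.RegularIsotopy (a := a) (b := b))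

instance : Category Tang where
  Hom a b := TangHom a b
  id a := Quot.mk _ (TangleDiagram.id a)
  comp f g := Quot.map₂ TangleDiagram.comp (fun S _ _ h => .comp_congr (.refl S) h)
    (fun _ _ T h => .comp_congr h (.refl T)) f g
  id_comp := by rintro _ _ ⟨S⟩; exact Quot.sound (.id_comp S)
  comp_id := by rintro _ _ ⟨S⟩; exact Quot.sound (.comp_id S)
  assoc := by rintro _ _ _ _ ⟨S⟩ ⟨T⟩ ⟨R⟩; exact Quot.sound (.assoc S T R)

/-- The object of the tangle category given by a list of signs. -/
def Tang.of (a : List Dir) : Tang := a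

/-- The morphism of the tangle category represented by a tangle diagram. -/
def Tang.mk {a b : List Dir} (T : TangleDiagram a b) : Tang.of a ⟶ Tang.of b :=
  Quot.mk _ T

/-! ## The category of an algebra with two automorphisms -/

/-- `turn U D s` is `U` for the sign `+` and `D` for the sign `-`. -/
def turn {k A : Type*} [CommRing k] [Ring A] [Algebra k A] (U D : A ≃ₐ[k] A) : Dir → (A ≃ₐ[k] A)
  | .up => U
  | .down => D

/-- Formal `k`-linear combinations, composites and juxtapositions of the oriented flat elementary
tangles (cups, caps, flat crossings) and of vertical strings decorated by a bead from `A`. -/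
inductive BeadDiagram (k : Type*) (A : Type*) : List Dir → List Dir → Type _
  | id (a : List Dir) : BeadDiagram k A a a
  | comp {a b c : List Dir} (f : BeadDiagram k A a b) (g : BeadDiagram k A b c) :
      BeadDiagram k A a c
  | tensor {a b c d : List Dir} (f : BeadDiagram k A a b) (g : BeadDiagram k A c d) :
      BeadDiagram k A (a ++ c) (b ++ d)
  | cup {s t : Dir} (h : s ≠ t) : BeadDiagram k A [] [s, t]
  | cap {s t : Dir} (h : s ≠ t) : BeadDiagram k A [s, t] []
  /-- the flat crossing of the string from bottom left to top right, of sign `s`, with the string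
  from bottom right to top left, of sign `t` -/
  | crossing (s t : Dir) : BeadDiagram k A [s, t] [t, s]
  /-- a vertical string of sign `s` with a bead `x` on it -/
  | bead (s : Dir) (x : A) : BeadDiagram k A [s] [s]
  | zero (a b : List Dir) : BeadDiagram k A a b
  | add {a b : List Dir} (f g : BeadDiagram k A a b) : BeadDiagram k A a b
  | smul {a b : List Dir} (c : k) (f : BeadDiagram k A a b) : BeadDiagram k A a b

namespace BeadDiagram

/-- Rewrite the sign lists of a decorated flat diagram along equalities. -/
def cast {k A : Type*} {a a' b b' : List Dir} (ha : a = a') (hb : b = b')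
    (f : BeadDiagram k A a b) : BeadDiagram k A a' b' :=
  ha ▸ hb ▸ f

/-- The topological moves of flat tangles: as for tangles, without over and under information. -/
inductive FlatMove (k A : Type*) :
    ∀ {a b : List Dir}, BeadDiagram k A a b → BeadDiagram k A a b → Prop
  | zigzag_left {s t : Dir} (h : s ≠ t) :
      FlatMove k A (a := [s]) (b := [s])
        (comp (b := [s, t, s]) (tensor (cup h) (id [s])) (tensor (id [s]) (cap h.symm)))
        (id [s])
  | zigzag_right {s t : Dir} (h : s ≠ t) :
      FlatMove k A (a := [s]) (b := [s])
        (comp (b := [s, t, s]) (tensor (id [s]) (cup h.symm)) (tensor (cap h) (id [s])))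
        (id [s])
  | two (s t : Dir) : FlatMove k A (comp (crossing s t) (crossing t s)) (id [s, t])
  | three (s t u : Dir) :
      FlatMove k A (a := [s, t, u]) (b := [u, t, s])
        (comp (b := [t, s, u]) (tensor (crossing s t) (id [u]))
          (comp (b := [t, u, s]) (tensor (id [t]) (crossing s u))
            (tensor (crossing t u) (id [s]))))
        (comp (b := [s, u, t]) (tensor (id [s]) (crossing t u))
          (comp (b := [u, s, t]) (tensor (crossing s u) (id [t]))
            (tensor (id [u]) (crossing s t))))
  | switchback_cap {s t : Dir} (h : s ≠ t) (u : Dir) :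
      FlatMove k A (a := [s, u, t]) (b := [u])
        (comp (b := [u, s, t]) (tensor (crossing s u) (id [t])) (tensor (id [u]) (cap h)))
        (comp (b := [s, t, u]) (tensor (id [s]) (crossing u t)) (tensor (cap h) (id [u])))
  | switchback_cup {s t : Dir} (h : s ≠ t) (u : Dir) :
      FlatMove k A (a := [u]) (b := [s, u, t])
        (comp (b := [u, s, t]) (tensor (id [u]) (cup h)) (tensor (crossing u s) (id [t])))
        (comp (b := [s, t, u]) (tensor (cup h) (id [u])) (tensor (id [s]) (crossing t u)))

/-- The rules for beads. Beads on one string are multiplied in the order in which they are met along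
the orientation of the string. Beads slide freely through flat crossings. A bead `x` on the right
leg of a cap is the bead `U x` on the left leg if the left leg is rising, and `D x` if it is
falling. A bead `x` on the left leg of a cup is the bead `U x` on the right leg if the right leg is
rising, and `D x` if it is falling. -/
inductive BeadMove {k A : Type*} [CommRing k] [Ring A] [Algebra k A] (U D : A ≃ₐ[k] A) :
    ∀ {a b : List Dir}, BeadDiagram k A a b → BeadDiagram k A a b → Prop
  | one (s : Dir) : BeadMove U D (bead s 1) (id [s])
  | mul_up (x y : A) :
      BeadMove U D (comp (bead .up x) (bead .up y)) (bead .up (x * y))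
  | mul_down (x y : A) :
      BeadMove U D (comp (bead .down x) (bead .down y)) (bead .down (y * x))
  | add (s : Dir) (x y : A) : BeadMove U D (bead s (x + y)) (.add (bead s x) (bead s y))
  | smul (s : Dir) (c : k) (x : A) : BeadMove U D (bead s (c • x)) (.smul c (bead s x))
  | slide_left (s t : Dir) (x : A) :
      BeadMove U D (a := [s, t]) (b := [t, s])
        (comp (b := [s, t]) (tensor (bead s x) (id [t])) (crossing s t))
        (comp (b := [t, s]) (crossing s t) (tensor (id [t]) (bead s x)))
  | slide_right (s t : Dir) (x : A) :
      BeadMove U D (a := [s, t]) (b := [t, s])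
        (comp (b := [s, t]) (tensor (id [s]) (bead t x)) (crossing s t))
        (comp (b := [t, s]) (crossing s t) (tensor (bead t x) (id [s])))
  | cap {s t : Dir} (h : s ≠ t) (x : A) :
      BeadMove U D (a := [s, t]) (b := [])
        (comp (b := [s, t]) (tensor (id [s]) (bead t x)) (cap h))
        (comp (b := [s, t]) (tensor (bead s (turn U D s x)) (id [t])) (cap h))
  | cup {s t : Dir} (h : s ≠ t) (x : A) :
      BeadMove U D (a := []) (b := [s, t])
        (comp (b := [s, t]) (cup h) (tensor (bead s x) (id [t])))
        (comp (b := [s, t]) (cup h) (tensor (id [s]) (bead t (turn U D t x))))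

/-- Equality of morphisms in the category of the algebra: the smallest congruence which makes the
decorated flat diagrams a `k`-linear strict tensor category and contains the moves of flat tangles
and the rules for beads. -/
inductive Equivalent {k A : Type*} [CommRing k] [Ring A] [Algebra k A] (U D : A ≃ₐ[k] A) :
    ∀ {a b : List Dir}, BeadDiagram k A a b → BeadDiagram k A a b → Prop
  | refl {a b} (f : BeadDiagram k A a b) : Equivalent U D f f
  | symm {a b} {f g : BeadDiagram k A a b} : Equivalent U D f g → Equivalent U D g f
  | trans {a b} {f g h : BeadDiagram k A a b} :
      Equivalent U D f g → Equivalent U D g h → Equivalent U D f h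
  | comp_congr {a b c} {f f' : BeadDiagram k A a b} {g g' : BeadDiagram k A b c} :
      Equivalent U D f f' → Equivalent U D g g' → Equivalent U D (comp f g) (comp f' g')
  | tensor_congr {a b c d} {f f' : BeadDiagram k A a b} {g g' : BeadDiagram k A c d} :
      Equivalent U D f f' → Equivalent U D g g' → Equivalent U D (tensor f g) (tensor f' g')
  | add_congr {a b} {f f' g g' : BeadDiagram k A a b} :
      Equivalent U D f f' → Equivalent U D g g' → Equivalent U D (add f g) (add f' g')
  | smul_congr {a b} (c : k) {f f' : BeadDiagram k A a b} :
      Equivalent U D f f' → Equivalent U D (smul c f) (smul c f')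
  | id_comp {a b} (f : BeadDiagram k A a b) : Equivalent U D (comp (id a) f) f
  | comp_id {a b} (f : BeadDiagram k A a b) : Equivalent U D (comp f (id b)) f
  | assoc {a b c d} (f : BeadDiagram k A a b) (g : BeadDiagram k A b c) (h : BeadDiagram k A c d) :
      Equivalent U D (comp (comp f g) h) (comp f (comp g h))
  | tensor_id (a b : List Dir) : Equivalent U D (tensor (id a) (id b)) (id (a ++ b))
  | nil_tensor {a b} (f : BeadDiagram k A a b) : Equivalent U D (tensor (id []) f) f
  | tensor_nil {a b} (f : BeadDiagram k A a b) :
      Equivalent U D (cast (List.append_nil a) (List.append_nil b) (tensor f (id []))) f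
  | tensor_assoc {a a' b b' c c'} (f : BeadDiagram k A a a') (g : BeadDiagram k A b b')
      (h : BeadDiagram k A c c') :
      Equivalent U D
        (cast (List.append_assoc a b c) (List.append_assoc a' b' c') (tensor (tensor f g) h))
        (tensor f (tensor g h))
  | interchange {a b c a' b' c'} (f : BeadDiagram k A a b) (g : BeadDiagram k A b c)
      (f' : BeadDiagram k A a' b') (g' : BeadDiagram k A b' c') :
      Equivalent U D (tensor (comp f g) (comp f' g')) (comp (tensor f f') (tensor g g'))
  | add_assoc {a b} (f g h : BeadDiagram k A a b) :
      Equivalent U D (add (add f g) h) (add f (add g h))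
  | add_comm {a b} (f g : BeadDiagram k A a b) : Equivalent U D (add f g) (add g f)
  | zero_add {a b} (f : BeadDiagram k A a b) : Equivalent U D (add (zero a b) f) f
  | smul_add {a b} (c : k) (f g : BeadDiagram k A a b) :
      Equivalent U D (smul c (add f g)) (add (smul c f) (smul c g))
  | add_smul {a b} (c d : k) (f : BeadDiagram k A a b) :
      Equivalent U D (smul (c + d) f) (add (smul c f) (smul d f))
  | mul_smul {a b} (c d : k) (f : BeadDiagram k A a b) :
      Equivalent U D (smul (c * d) f) (smul c (smul d f))
  | one_smul {a b} (f : BeadDiagram k A a b) : Equivalent U D (smul 1 f) f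
  | zero_smul {a b} (f : BeadDiagram k A a b) : Equivalent U D (smul 0 f) (zero a b)
  | add_comp {a b c} (f f' : BeadDiagram k A a b) (g : BeadDiagram k A b c) :
      Equivalent U D (comp (add f f') g) (add (comp f g) (comp f' g))
  | comp_add {a b c} (f : BeadDiagram k A a b) (g g' : BeadDiagram k A b c) :
      Equivalent U D (comp f (add g g')) (add (comp f g) (comp f g'))
  | smul_comp {a b c} (r : k) (f : BeadDiagram k A a b) (g : BeadDiagram k A b c) :
      Equivalent U D (comp (smul r f) g) (smul r (comp f g))
  | comp_smul {a b c} (r : k) (f : BeadDiagram k A a b) (g : BeadDiagram k A b c) :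
      Equivalent U D (comp f (smul r g)) (smul r (comp f g))
  | add_tensor {a b c d} (f f' : BeadDiagram k A a b) (g : BeadDiagram k A c d) :
      Equivalent U D (tensor (add f f') g) (add (tensor f g) (tensor f' g))
  | tensor_add {a b c d} (f : BeadDiagram k A a b) (g g' : BeadDiagram k A c d) :
      Equivalent U D (tensor f (add g g')) (add (tensor f g) (tensor f g'))
  | smul_tensor {a b c d} (r : k) (f : BeadDiagram k A a b) (g : BeadDiagram k A c d) :
      Equivalent U D (tensor (smul r f) g) (smul r (tensor f g))
  | tensor_smul {a b c d} (r : k) (f : BeadDiagram k A a b) (g : BeadDiagram k A c d) :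
      Equivalent U D (tensor f (smul r g)) (smul r (tensor f g))
  | flat {a b} {f g : BeadDiagram k A a b} : FlatMove k A f g → Equivalent U D f g
  | bead {a b} {f g : BeadDiagram k A a b} : BeadMove U D f g → Equivalent U D f g

end BeadDiagram

/-- The category of the algebra `A` with the automorphisms `U` and `D`: objects are lists of signs,
morphisms are `k`-linear combinations of flat tangles decorated by elements of `A`. -/
def BeadCat {k A : Type*} [CommRing k] [Ring A] [Algebra k A] (_U _D : A ≃ₐ[k] A) : Type :=
  List Dir

/-- The hom sets of the category of an algebra. -/
def BeadHom {k A : Type*} [CommRing k] [Ring A] [Algebra k A] (U D : A ≃ₐ[k] A)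
    (a b : List Dir) : Type _ :=
  Quot (BeadDiagram.Equivalent U D (a := a) (b := b))

namespace BeadHom

variable {k A : Type*} [CommRing k] [Ring A] [Algebra k A] {U D : A ≃ₐ[k] A}

/-- Composition of decorated flat tangles: the first one is placed below the second one. -/
def comp {a b c : List Dir} (f : BeadHom U D a b) (g : BeadHom U D b c) : BeadHom U D a c :=
  Quot.map₂ BeadDiagram.comp (fun f _ _ h => .comp_congr (.refl f) h)
    (fun _ _ g h => .comp_congr h (.refl g)) f g

/-- Juxtaposition of decorated flat tangles. -/
def tensor {a b c d : List Dir} (f : BeadHom U D a b) (g : BeadHom U D c d) :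
    BeadHom U D (a ++ c) (b ++ d) :=
  Quot.map₂ BeadDiagram.tensor (fun f _ _ h => .tensor_congr (.refl f) h)
    (fun _ _ g h => .tensor_congr h (.refl g)) f g

instance {a b : List Dir} : Zero (BeadHom U D a b) := ⟨Quot.mk _ (.zero a b)⟩

instance {a b : List Dir} : Add (BeadHom U D a b) :=
  ⟨fun f g => Quot.map₂ BeadDiagram.add (fun f _ _ h => .add_congr (.refl f) h)
    (fun _ _ g h => .add_congr h (.refl g)) f g⟩

instance {a b : List Dir} : SMul k (BeadHom U D a b) :=
  ⟨fun c f => Quot.map (BeadDiagram.smul c) (fun _ _ h => .smul_congr c h) f⟩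

instance {a b : List Dir} : Neg (BeadHom U D a b) := ⟨fun f => (-1 : k) • f⟩

protected theorem add_comm {a b : List Dir} (f g : BeadHom U D a b) : f + g = g + f := by
  obtain ⟨f⟩ := f; obtain ⟨g⟩ := g; exact Quot.sound (.add_comm f g)

protected theorem zero_add {a b : List Dir} (f : BeadHom U D a b) : 0 + f = f := by
  obtain ⟨f⟩ := f; exact Quot.sound (.zero_add f)

protected theorem zero_smul {a b : List Dir} (f : BeadHom U D a b) : (0 : k) • f = 0 := by
  obtain ⟨f⟩ := f; exact Quot.sound (.zero_smul f)

protected theorem one_smul {a b : List Dir} (f : BeadHom U D a b) : (1 : k) • f = f := by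
  obtain ⟨f⟩ := f; exact Quot.sound (.one_smul f)

protected theorem add_smul {a b : List Dir} (c d : k) (f : BeadHom U D a b) :
    (c + d) • f = c • f + d • f := by
  obtain ⟨f⟩ := f; exact Quot.sound (.add_smul c d f)

protected theorem mul_smul {a b : List Dir} (c d : k) (f : BeadHom U D a b) :
    (c * d) • f = c • (d • f) := by
  obtain ⟨f⟩ := f; exact Quot.sound (.mul_smul c d f)

instance {a b : List Dir} : AddCommGroup (BeadHom U D a b) where
  add_assoc := by rintro ⟨f⟩ ⟨g⟩ ⟨h⟩; exact Quot.sound (.add_assoc f g h)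
  zero_add := BeadHom.zero_add
  add_zero f := by rw [BeadHom.add_comm, BeadHom.zero_add]
  add_comm := BeadHom.add_comm
  neg_add_cancel f := by
    calc -f + f = (-1 : k) • f + (1 : k) • f := by rw [BeadHom.one_smul]; rfl
      _ = 0 := by rw [← BeadHom.add_smul, neg_add_cancel, BeadHom.zero_smul]
  nsmul := nsmulRec
  zsmul := zsmulRec

instance {a b : List Dir} : Module k (BeadHom U D a b) where
  one_smul := BeadHom.one_smul
  mul_smul := BeadHom.mul_smul
  smul_zero c := by
    rw [← BeadHom.zero_smul (0 : BeadHom U D a b), ← BeadHom.mul_smul, mul_zero]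
  smul_add := by rintro c ⟨f⟩ ⟨g⟩; exact Quot.sound (.smul_add c f g)
  add_smul := BeadHom.add_smul
  zero_smul := BeadHom.zero_smul

end BeadHom

instance {k A : Type*} [CommRing k] [Ring A] [Algebra k A] (U D : A ≃ₐ[k] A) :
    Category (BeadCat U D) where
  Hom a b := BeadHom U D a b
  id a := Quot.mk _ (BeadDiagram.id a)
  comp f g := BeadHom.comp f g
  id_comp := by rintro _ _ ⟨f⟩; exact Quot.sound (.id_comp f)
  comp_id := by rintro _ _ ⟨f⟩; exact Quot.sound (.comp_id f)
  assoc := by rintro _ _ _ _ ⟨f⟩ ⟨g⟩ ⟨h⟩; exact Quot.sound (.assoc f g h)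

/-- The object of the category of an algebra given by a list of signs. -/
def BeadCat.of {k A : Type*} [CommRing k] [Ring A] [Algebra k A] (U D : A ≃ₐ[k] A)
    (a : List Dir) : BeadCat U D := a

/-! ## Oriented quantum algebras and the decoration of tangles -/

section Decoration

variable {k A : Type*} [CommRing k] [Ring A] [Algebra k A]

/-- The algebraic Yang-Baxter equation `ρ₁₂ ρ₁₃ ρ₂₃ = ρ₂₃ ρ₁₃ ρ₁₂` in `A ⊗ A ⊗ A`. -/
def YangBaxter (ρ : A ⊗[k] A) : Prop :=
  let ρ₁₂ : A ⊗[k] (A ⊗[k] A) := Algebra.TensorProduct.map (AlgHom.id k A)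
    (Algebra.TensorProduct.includeLeft : A →ₐ[k] A ⊗[k] A) ρ
  let ρ₁₃ : A ⊗[k] (A ⊗[k] A) := Algebra.TensorProduct.map (AlgHom.id k A)
    (Algebra.TensorProduct.includeRight : A →ₐ[k] A ⊗[k] A) ρ
  let ρ₂₃ : A ⊗[k] (A ⊗[k] A) := (1 : A) ⊗ₜ[k] ρ
  ρ₁₂ * ρ₁₃ * ρ₂₃ = ρ₂₃ * ρ₁₃ * ρ₁₂

/-- `(T ⊗ T) ρ = ρ`. -/
def FixedBy (T : A ≃ₐ[k] A) (ρ : A ⊗[k] A) : Prop :=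
  Algebra.TensorProduct.map T.toAlgHom T.toAlgHom ρ = ρ

/-- `(S ⊗ T) σ`, regarded as an element of the algebra `A ⊗ Aᵒᵖ`. -/
noncomputable def toTensorOp (S T : A ≃ₐ[k] A) (σ : A ⊗[k] A) : A ⊗[k] Aᵐᵒᵖ :=
  TensorProduct.map S.toLinearMap
    ((MulOpposite.opLinearEquiv k : A ≃ₗ[k] Aᵐᵒᵖ).toLinearMap ∘ₗ T.toLinearMap) σ

/-- `(1 ⊗ U) ρ` and `(D ⊗ 1) ρ⁻¹` are inverse to each other in the algebra `A ⊗ Aᵒᵖ`. -/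
def InverseInTensorOp (ρ : (A ⊗[k] A)ˣ) (D U : A ≃ₐ[k] A) : Prop :=
  toTensorOp AlgEquiv.refl U (ρ : A ⊗[k] A) *
      toTensorOp D AlgEquiv.refl ((ρ⁻¹ : (A ⊗[k] A)ˣ) : A ⊗[k] A) = 1 ∧
    toTensorOp D AlgEquiv.refl ((ρ⁻¹ : (A ⊗[k] A)ˣ) : A ⊗[k] A) *
      toTensorOp AlgEquiv.refl U (ρ : A ⊗[k] A) = 1

/-- `(A, ρ, D, U)` is an oriented quantum algebra over `k`. -/
structure IsOrientedQuantumAlgebra (ρ : (A ⊗[k] A)ˣ) (D U : A ≃ₐ[k] A) : Prop where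
  yangBaxter : YangBaxter (ρ : A ⊗[k] A)
  commute : ∀ x : A, D (U x) = U (D x)
  fixedByU : FixedBy U (ρ : A ⊗[k] A)
  fixedByD : FixedBy D (ρ : A ⊗[k] A)
  inverse : InverseInTensorOp ρ D U

/-- Two parallel strings of signs `s` and `t` with a bead on each, extended linearly from `x ⊗ y`
(the bead `x` on the left, the bead `y` on the right) to all elements of `A ⊗ A`. -/
noncomputable def beads (U D : A ≃ₐ[k] A) (s t : Dir) :
    A ⊗[k] A →ₗ[k] BeadHom U D [s, t] [s, t] :=
  TensorProduct.lift (LinearMap.mk₂ k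
    (fun x y => (BeadHom.tensor (U := U) (D := D) (Quot.mk _ (.bead s x)) (Quot.mk _ (.bead t y)) :
      BeadHom U D ([s] ++ [t]) ([s] ++ [t])))
    (fun x x' y => Quot.sound (.trans
      (.tensor_congr (.bead (.add s x x')) (.refl (.bead t y))) (.add_tensor _ _ _)))
    (fun c x y => Quot.sound (.trans
      (.tensor_congr (.bead (.smul s c x)) (.refl (.bead t y))) (.smul_tensor _ _ _)))
    (fun x y y' => Quot.sound (.trans
      (.tensor_congr (.refl (.bead s x)) (.bead (.add t y y'))) (.tensor_add _ _ _)))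
    (fun c x y => Quot.sound (.trans
      (.tensor_congr (.refl (.bead s x)) (.bead (.smul t c y))) (.tensor_smul _ _ _))))

/-- The element of `A ⊗ A` that decorates a crossing. Its first factor belongs to the string from
bottom left to top right (of sign `s`), its second factor to the string from bottom right to top
left (of sign `t`); the former is the overcrossing string iff the last argument is `true`. With
`ρ = ∑ e ⊗ e'` and `ρ⁻¹ = ∑ E ⊗ E'`, the overcrossing string receives the left signifier `e` or
`E`, and for horizontally oriented crossings the bead on the string from bottom left to top right is
moreover changed by `U` (crossings pointing to the right) or `D` (pointing to the left). -/
noncomputable def crossingLabel (ρ : (A ⊗[k] A)ˣ) (U D : A ≃ₐ[k] A) :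
    Dir → Dir → Bool → A ⊗[k] A
  -- `e ⊗ e'`
  | .up, .up, true => (ρ : A ⊗[k] A)
  -- `E' ⊗ E`
  | .up, .up, false => TensorProduct.comm k A A ((ρ⁻¹ : (A ⊗[k] A)ˣ) : A ⊗[k] A)
  -- `e ⊗ e'`
  | .down, .down, true => (ρ : A ⊗[k] A)
  -- `E' ⊗ E`
  | .down, .down, false => TensorProduct.comm k A A ((ρ⁻¹ : (A ⊗[k] A)ˣ) : A ⊗[k] A)
  -- `U E ⊗ E'`
  | .up, .down, true =>
      TensorProduct.map U.toLinearMap LinearMap.id ((ρ⁻¹ : (A ⊗[k] A)ˣ) : A ⊗[k] A)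
  -- `U e' ⊗ e`
  | .up, .down, false =>
      TensorProduct.map U.toLinearMap LinearMap.id (TensorProduct.comm k A A (ρ : A ⊗[k] A))
  -- `D E ⊗ E'`
  | .down, .up, true =>
      TensorProduct.map D.toLinearMap LinearMap.id ((ρ⁻¹ : (A ⊗[k] A)ˣ) : A ⊗[k] A)
  -- `D e' ⊗ e`
  | .down, .up, false =>
      TensorProduct.map D.toLinearMap LinearMap.id (TensorProduct.comm k A A (ρ : A ⊗[k] A))

/-- The value of `F` on tangle diagrams: every crossing is replaced by the flat crossing, decorated
by the corresponding Yang-Baxter element. (The two beads are placed at the lower ends of the two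
strings of the crossing; they may be moved through the flat crossing.) -/
noncomputable def decorate (ρ : (A ⊗[k] A)ˣ) (U D : A ≃ₐ[k] A) :
    ∀ {a b : List Dir}, TangleDiagram a b → BeadHom U D a b
  | _, _, .id a => Quot.mk _ (.id a)
  | _, _, .comp S T => (decorate ρ U D S).comp (decorate ρ U D T)
  | _, _, .tensor S T => (decorate ρ U D S).tensor (decorate ρ U D T)
  | _, _, .cup h => Quot.mk _ (.cup h)
  | _, _, .cap h => Quot.mk _ (.cap h)
  | _, _, .crossing s t o =>
      (beads U D s t (crossingLabel ρ U D s t o)).comp (Quot.mk _ (.crossing s t))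

/-- The morphism of the category of the algebra represented by a decorated tangle diagram. -/
noncomputable def decorateHom (ρ : (A ⊗[k] A)ˣ) (U D : A ≃ₐ[k] A) {a b : List Dir}
    (T : TangleDiagram a b) : BeadCat.of U D a ⟶ BeadCat.of U D b :=
  decorate ρ U D T

/-- `F` is the functor from the tangle category to the category of the algebra that is the identity
on lists of signs and is given on tangles by decorating diagrams that represent them. -/
def IsDecorationFunctor (ρ : (A ⊗[k] A)ˣ) (U D : A ≃ₐ[k] A) (F : Tang ⥤ BeadCat U D) : Prop :=
  ∃ hobj : ∀ a : List Dir, F.obj (Tang.of a) = BeadCat.of U D a,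
    ∀ (a b : List Dir) (T : TangleDiagram a b),
      F.map (Tang.mk T) = eqToHom (hobj a) ≫ decorateHom ρ U D T ≫ eqToHom (hobj b).symm

end Decoration

/-! Sufficiency rests on sliding beads. Beads pass freely through flat crossings, and around extrema
at the price of `U` or `D`, so in both sides of a move all beads can be collected on the same side
of the flat part. The flat parts then agree by the corresponding flat move, and what remains is an
identity between products of beads on parallel strings. The endomorphisms of a sign list form a
ring. Beads on one string give a homomorphism from `A` to it if the string rises and an
antihomomorphism if it falls (`IsStrand`), and beads on different strings commute. Two strings of
the same sign therefore see the multiplication of `A ⊗ A`, and two strings of opposite signs that of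
`A ⊗ Aᵒᵖ`, up to reversing all products. In this way parallel moves II become `ρ ρ⁻¹ = 1`,
antiparallel ones become the inverse condition in `A ⊗ Aᵒᵖ`, and switchbacks compare the label of a
crossing with that of its rotated form (`crossingLabel_switchback`).

For moves III the heights of the strings are first normalised. All crossing elements are units, so
each of the six height patterns is one Yang-Baxter identity, for the strings ordered from top to
bottom, with some factors moved to the other side (`pair_crossingLabel_three`). The orientations
come next. Each string carries two of the three factors, so reversing it exchanges these two. The
resulting identities are again rearrangements of the equation for `ρ`; when only the middle string
is antiparallel, the inverse condition is used as well (`pair_crossingLabel_yangBaxter`).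

Necessity requires that the category presented by generators and relations has not collapsed. A
model shows this. A configuration is a list of ends of named strings, with a `k`-linear operator on
`A` for each string. The operators are composed along the orientation: a bead acts by right
multiplication, a turn by `U`, `D` or an inverse, and closed strings are sent to zero. Decorated
flat tangles act on functions of configurations by pullback. On functions that ignore the names and
are linear in each label, this action respects every relation (`act_equivalent`). The interchange
law is the hard case: it requires that elementary pieces at disjoint places can be attached in
either order (`act_comm`).

Applying the final labels to `1` recovers the beads, so no information is lost on two antiparallel
strings (`beads_down_up_injective`, `beads_up_down_injective`), nor on two parallel strings below a
maximum. A switchback with an equally oriented string can then be read as `(T ⊗ T) ρ = ρ`, with `T`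
equal to `U` or `D`. The two reverse moves II with a falling overstring give the two products in the
inverse condition. -/

/-! ## Configurations of strands -/

/-- The upper ends of a decorated flat tangle: the list of their signs and of the names of the
strings they belong to, together with a linear operator on `A` for each name, which records the
beads met along the string and the turns of the string. -/
abbrev StrandState (k A : Type*) [CommRing k] [Ring A] [Algebra k A] : Type _ :=
  List (Dir × ℕ) × (ℕ → Module.End k A)

namespace StrandState

section

variable {k A N : Type*} [CommRing k] [Ring A] [Algebra k A] [AddCommGroup N] [Module k N]

/-- Pull back functions along a partial map. -/
def pull (F : StrandState k A → Option (StrandState k A)) :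
    (StrandState k A → N) →ₗ[k] (StrandState k A → N) where
  toFun φ st := (F st).elim 0 φ
  map_add' φ ψ := by ext st; cases h : F st <;> simp [h]
  map_smul' c φ := by ext st; cases h : F st <;> simp [h]

theorem pull_some {F : StrandState k A → Option (StrandState k A)} {st st' : StrandState k A}
    (h : F st = some st') (φ : StrandState k A → N) : pull F φ st = φ st' := by
  simp [pull, h]

theorem pull_none {F : StrandState k A → Option (StrandState k A)} {st : StrandState k A}
    (h : F st = none) (φ : StrandState k A → N) : pull F φ st = 0 := by
  simp [pull, h]

/-- Rename the strings. -/
def reindex (f : ℕ → ℕ) (p : List (Dir × ℕ)) : List (Dir × ℕ) := p.map (Prod.map id f)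

@[simp] theorem reindex_nil (f : ℕ → ℕ) : reindex f [] = [] := rfl

@[simp] theorem reindex_cons (f : ℕ → ℕ) (s : Dir) (n : ℕ) (p : List (Dir × ℕ)) :
    reindex f ((s, n) :: p) = (s, f n) :: reindex f p := rfl

@[simp] theorem reindex_append (f : ℕ → ℕ) (p q : List (Dir × ℕ)) :
    reindex f (p ++ q) = reindex f p ++ reindex f q := List.map_append

@[simp] theorem length_reindex (f : ℕ → ℕ) (p : List (Dir × ℕ)) :
    (reindex f p).length = p.length := List.length_map _

@[simp] theorem reindex_reindex (f g : ℕ → ℕ) (p : List (Dir × ℕ)) :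
    reindex f (reindex g p) = reindex (f ∘ g) p := by
  simp [reindex, Function.comp_def, Prod.map]

@[simp] theorem map_fst_reindex (f : ℕ → ℕ) (p : List (Dir × ℕ)) :
    (reindex f p).map Prod.fst = p.map Prod.fst := by
  simp [reindex, Function.comp_def]

theorem mem_reindex {f : ℕ → ℕ} {p : List (Dir × ℕ)} {s : Dir} {m : ℕ} :
    (s, m) ∈ reindex f p ↔ ∃ n, (s, n) ∈ p ∧ f n = m := by
  simp [reindex]

theorem reindex_congr {f g : ℕ → ℕ} {p : List (Dir × ℕ)} (h : ∀ s n, (s, n) ∈ p → f n = g n) :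
    reindex f p = reindex g p := by
  apply List.map_congr_left
  rintro ⟨s, n⟩ hn
  simp [h s n hn]

/-- Exchange of two neighbouring ends. -/
def stepCross (o : ℕ) (st : StrandState k A) : Option (StrandState k A) :=
  match st.1.drop o with
  | x :: y :: r => some (st.1.take o ++ y :: x :: r, st.2)
  | _ => none

/-- A new bead at an end of sign `s`. -/
def beadAct (s : Dir) (x : A) : Module.End k A →ₗ[k] Module.End k A :=
  match s with
  | .up => LinearMap.mulLeft k (LinearMap.mulRight k x)
  | .down => LinearMap.mulRight k (LinearMap.mulRight k x)

/-- A new bead at the end at position `o`. -/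
def stepBead (s : Dir) (x : A) (o : ℕ) (st : StrandState k A) : Option (StrandState k A) :=
  match st.1.drop o with
  | (_, n) :: _ => some (st.1, Function.update st.2 n (beadAct s x (st.2 n)))
  | _ => none

/-- A new string, both of whose ends are upper ends. -/
def stepCup (s t : Dir) (c : Module.End k A) (o : ℕ) (st : StrandState k A) :
    Option (StrandState k A) :=
  some (reindex Nat.succ (st.1.take o) ++ (s, 0) :: (t, 0) :: reindex Nat.succ (st.1.drop o),
    fun n => Nat.casesOn n c st.2)

/-- The name of the `n`-th string after the string `j` has been appended to the string `i`. -/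
def joinName (i j n : ℕ) : ℕ := if n = j then i else n

/-- The labels of the strings after the string `j` has been appended to the string `i`. -/
def joinLabel (i j : ℕ) (d : Module.End k A) (lam : ℕ → Module.End k A) (n : ℕ) :
    Module.End k A :=
  if n = i then lam j * d * lam i else if n = j then 1 else lam n

/-- Closing two neighbouring ends by a cap whose left leg has sign `s`; closed strings are
killed. -/
def stepCap (s : Dir) (d : Module.End k A) (o : ℕ) (st : StrandState k A) :
    Option (StrandState k A) :=
  match st.1.drop o, s with
  | (_, x) :: (_, y) :: r, .up => if x = y then none else
      some (reindex (joinName x y) (st.1.take o ++ r), joinLabel x y d st.2)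
  | (_, y) :: (_, x) :: r, .down => if x = y then none else
      some (reindex (joinName x y) (st.1.take o ++ r), joinLabel x y d st.2)
  | _, _ => none

variable {o : ℕ} {p q : List (Dir × ℕ)} {lam : ℕ → Module.End k A}

theorem stepCross_eq (h : p.length = o) (x y : Dir × ℕ) :
    stepCross o (p ++ x :: y :: q, lam) = some (p ++ y :: x :: q, lam) := by
  subst h; simp [stepCross]

theorem stepBead_eq (h : p.length = o) (s s' : Dir) (x : A) (n : ℕ) :
    stepBead s x o (p ++ (s', n) :: q, lam) =
      some (p ++ (s', n) :: q, Function.update lam n (beadAct s x (lam n))) := by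
  subst h; simp [stepBead]

theorem stepCup_eq (h : p.length = o) (s t : Dir) (c : Module.End k A) :
    stepCup s t c o (p ++ q, lam) =
      some (reindex Nat.succ p ++ (s, 0) :: (t, 0) :: reindex Nat.succ q,
        fun n => Nat.casesOn n c lam) := by
  subst h; simp [stepCup]

theorem stepCap_up_eq (h : p.length = o) (s t : Dir) (x y : ℕ) (d : Module.End k A) :
    stepCap .up d o (p ++ (s, x) :: (t, y) :: q, lam) =
      if x = y then none else
        some (reindex (joinName x y) p ++ reindex (joinName x y) q, joinLabel x y d lam) := by
  subst h; simp [stepCap]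

theorem stepCap_down_eq (h : p.length = o) (s t : Dir) (x y : ℕ) (d : Module.End k A) :
    stepCap .down d o (p ++ (s, y) :: (t, x) :: q, lam) =
      if x = y then none else
        some (reindex (joinName x y) p ++ reindex (joinName x y) q, joinLabel x y d lam) := by
  subst h; simp [stepCap]

/-! ### Admissible configurations -/

/-- The signs of the ends are given by `L`, every string has at most one end of either sign, and
every string has an end of sign `+`. -/
structure Admissible (L : List Dir) (p : List (Dir × ℕ)) : Prop where
  signs : p.map Prod.fst = L
  nodup : p.Nodup
  up_mem : ∀ n, (Dir.down, n) ∈ p → (Dir.up, n) ∈ p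

theorem Admissible.up_mem' {L : List Dir} (h : Admissible L p) {s : Dir} {n : ℕ} (hn : (s, n) ∈ p) :
    (Dir.up, n) ∈ p := by
  cases s
  · exact hn
  · exact h.up_mem n hn

theorem Admissible.reindex {L : List Dir} (h : Admissible L p) {f : ℕ → ℕ}
    (hf : ∀ s m n, (s, m) ∈ p → (s, n) ∈ p → f m = f n → m = n) :
    Admissible L (reindex f p) where
  signs := by rw [map_fst_reindex, h.signs]
  nodup := by
    apply List.Nodup.map_on _ h.nodup
    rintro ⟨s, m⟩ hm ⟨t, n⟩ hn e
    simp only [Prod.map, id, Prod.mk.injEq] at e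
    obtain ⟨rfl, e⟩ := e
    rw [hf s m n hm hn e]
  up_mem n hn := by
    obtain ⟨m, hm, rfl⟩ := mem_reindex.1 hn
    exact mem_reindex.2 ⟨m, h.up_mem m hm, rfl⟩

theorem Admissible.perm {L L' : List Dir} (h : Admissible L p) (hq : p.Perm q)
    (hL : q.map Prod.fst = L') : Admissible L' q where
  signs := hL
  nodup := hq.nodup_iff.1 h.nodup
  up_mem n hn := hq.mem_iff.1 (h.up_mem n (hq.mem_iff.2 hn))

theorem exists_split {l r : List Dir} {p : List (Dir × ℕ)} (h : p.map Prod.fst = l ++ r) :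
    ∃ p₁ p₂, p = p₁ ++ p₂ ∧ p₁.map Prod.fst = l ∧ p₂.map Prod.fst = r ∧ p₁.length = l.length := by
  obtain ⟨p₁, p₂, rfl, h₁, h₂⟩ := List.map_eq_append_iff.1 h
  exact ⟨p₁, p₂, rfl, h₁, h₂, by rw [← h₁, List.length_map]⟩

theorem exists_cons {s : Dir} {r : List Dir} {p : List (Dir × ℕ)} (h : p.map Prod.fst = s :: r) :
    ∃ n p₂, p = (s, n) :: p₂ ∧ p₂.map Prod.fst = r := by
  obtain ⟨⟨s', n⟩, p₂, rfl, rfl, h₂⟩ := List.map_eq_cons_iff.1 h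
  exact ⟨n, p₂, rfl, h₂⟩

theorem Admissible.exists_pair {l r : List Dir} {s t : Dir}
    (hp : Admissible (l ++ [s, t] ++ r) p) : ∃ p₁ x y p₂, p = p₁ ++ (s, x) :: (t, y) :: p₂ ∧
      p₁.length = l.length ∧ p₁.map Prod.fst = l ∧ p₂.map Prod.fst = r := by
  have := hp.signs
  rw [List.append_assoc] at this
  obtain ⟨p₁, p', rfl, h₁, h', h₁'⟩ := exists_split this
  obtain ⟨x, p', rfl, h''⟩ := exists_cons (r := t :: r) h'
  obtain ⟨y, p₂, rfl, h₂⟩ := exists_cons h''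
  exact ⟨p₁, x, y, p₂, rfl, h₁', h₁, h₂⟩

/-- `st'` arises from `st` by renaming the strings. -/
structure Renaming (f : ℕ → ℕ) (st st' : StrandState k A) : Prop where
  ends : st'.1 = reindex f st.1
  inj : ∀ s t m n, (s, m) ∈ st.1 → (t, n) ∈ st.1 → f m = f n → m = n
  label : ∀ s n, (s, n) ∈ st.1 → st'.2 (f n) = st.2 n

/-- Functions on configurations with signs `L` which do not depend on the names of the strings and
are linear in the label of each string. -/
structure Multilinear (L : List Dir) (φ : StrandState k A → N) : Prop where
  rename : ∀ (f : ℕ → ℕ) (st st' : StrandState k A), Admissible L st.1 → Renaming f st st' →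
    φ st' = φ st
  linear : ∀ (p : List (Dir × ℕ)) (lam : ℕ → Module.End k A) (n : ℕ), Admissible L p →
    (Dir.up, n) ∈ p → ∃ g : Module.End k A →ₗ[k] N, ∀ e, φ (p, Function.update lam n e) = g e

/-- A partial map from configurations with signs `L` to configurations with signs `L'` that
preserves admissibility and along which multilinear functions can be pulled back. -/
structure IsStep (L L' : List Dir) (F : StrandState k A → Option (StrandState k A)) : Prop where
  admissible : ∀ st st', Admissible L st.1 → F st = some st' → Admissible L' st'.1
  rename : ∀ f st st', Admissible L st.1 → Renaming f st st' →
    (F st = none ∧ F st' = none) ∨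
      ∃ g u u', F st = some u ∧ F st' = some u' ∧ Renaming g u u'
  linear : ∀ (p : List (Dir × ℕ)) (lam : ℕ → Module.End k A) (n : ℕ), Admissible L p →
    (Dir.up, n) ∈ p → (∀ e, F (p, Function.update lam n e) = none) ∨
      ∃ p' lam' n', ∃ g : Module.End k A →ₗ[k] Module.End k A, (Dir.up, n') ∈ p' ∧
        ∀ e, F (p, Function.update lam n e) = some (p', Function.update lam' n' (g e))

theorem Multilinear.pull {L L' : List Dir} {F : StrandState k A → Option (StrandState k A)}
    (hF : IsStep L L' F) {φ : StrandState k A → N} (h : Multilinear L' φ) :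
    Multilinear L (pull F φ) where
  rename f st st' hst hf := by
    rcases hF.rename f st st' hst hf with ⟨h₁, h₂⟩ | ⟨g, u, u', h₁, h₂, hg⟩
    · rw [pull_none h₁, pull_none h₂]
    · rw [pull_some h₁, pull_some h₂]
      exact h.rename g u u' (hF.admissible _ _ hst h₁) hg
  linear p lam n hp hn := by
    rcases hF.linear p lam n hp hn with h₁ | ⟨p', lam', n', g, hn', h₁⟩
    · exact ⟨0, fun e => pull_none (h₁ e) φ⟩
    · obtain ⟨g', hg'⟩ := h.linear p' lam' n'
        (hF.admissible (p, Function.update lam n 0) _ hp (h₁ 0)) hn'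
      exact ⟨g'.comp g, fun e => by rw [pull_some (h₁ e), hg']; rfl⟩

/-! ### The elementary pieces as partial maps of configurations -/

theorem isStep_cross (l r : List Dir) (s t : Dir) :
    IsStep (k := k) (A := A) (l ++ [s, t] ++ r) (l ++ [t, s] ++ r) (stepCross l.length) := by
  refine ⟨?_, ?_, ?_⟩
  · rintro ⟨p, lam⟩ st' hp e
    obtain ⟨p₁, x, y, p₂, rfl, hl, h₁, h₂⟩ := hp.exists_pair
    rw [stepCross_eq hl] at e
    obtain rfl := Option.some.inj e
    exact hp.perm (List.Perm.append_left _ (List.Perm.swap _ _ _)) (by simp [h₁, h₂])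
  · rintro f ⟨p, lam⟩ ⟨p', lam'⟩ hp ⟨h₀, h₁, h₂⟩
    obtain ⟨p₁, x, y, p₂, rfl, hl, -, -⟩ := hp.exists_pair
    simp only [reindex_append, reindex_cons] at h₀
    subst h₀
    refine .inr ⟨f, _, _, stepCross_eq hl _ _, stepCross_eq (by simpa using hl) _ _, ?_, ?_, ?_⟩
    · simp
    · intro s t m n hm hn
      apply h₁ s t m n <;> simp at hm hn ⊢ <;> tauto
    · intro s n hn
      apply h₂ s n
      simp at hn ⊢
      tauto
  · intro p lam n hp hn
    obtain ⟨p₁, x, y, p₂, rfl, hl, -, -⟩ := hp.exists_pair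
    refine .inr ⟨_, lam, n, LinearMap.id, ?_, fun e => stepCross_eq hl _ _⟩
    simp at hn ⊢
    tauto

theorem isStep_bead (l r : List Dir) (s : Dir) (x : A) :
    IsStep (k := k) (A := A) (l ++ [s] ++ r) (l ++ [s] ++ r) (stepBead s x l.length) := by
  have key : ∀ p : List (Dir × ℕ), Admissible (l ++ [s] ++ r) p → ∃ p₁ n p₂,
      p = p₁ ++ (s, n) :: p₂ ∧ p₁.length = l.length := by
    intro p hp
    have := hp.signs
    rw [List.append_assoc] at this
    obtain ⟨p₁, p', rfl, h₁, h', h₁'⟩ := exists_split this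
    obtain ⟨n, p', rfl, h'⟩ := exists_cons h'
    exact ⟨p₁, n, p', rfl, h₁'⟩
  refine ⟨?_, ?_, ?_⟩
  · rintro ⟨p, lam⟩ st' hp e
    obtain ⟨p₁, n, p₂, rfl, hl⟩ := key p hp
    rw [stepBead_eq hl] at e
    obtain rfl := Option.some.inj e
    exact hp
  · rintro f ⟨p, lam⟩ ⟨p', lam'⟩ hp ⟨h₀, h₁, h₂⟩
    obtain ⟨p₁, n, p₂, rfl, hl⟩ := key p hp
    simp only [reindex_append, reindex_cons] at h₀
    subst h₀
    refine .inr ⟨f, _, _, stepBead_eq hl _ _ _ _, stepBead_eq (by simpa using hl) _ _ _ _,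
      ?_, h₁, ?_⟩
    · simp
    · intro t m hm
      have hm' : lam' (f m) = lam m := h₂ t m hm
      by_cases e : m = n
      · subst e
        simp [hm']
      · have : f m ≠ f n := fun e' => e (h₁ t s m n hm (by simp) e')
        simp [Function.update_of_ne e, Function.update_of_ne this, hm']
  · intro p lam n hp hn
    obtain ⟨p₁, m, p₂, rfl, hl⟩ := key p hp
    -- Either the varied label is the one that receives the bead, and dependence is through
    -- `beadAct`, or the two updates concern different strings and commute.
    by_cases e : m = n
    · subst e
      exact .inr ⟨_, lam, m, beadAct s x, hn, fun e => by rw [stepBead_eq hl]; simp⟩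
    · refine .inr ⟨_, Function.update lam m (beadAct s x (lam m)), n, LinearMap.id, hn, fun e' => ?_⟩
      rw [stepBead_eq hl, Function.update_of_ne e, Function.update_comm e]
      rfl

theorem isStep_cup (l r : List Dir) {s t : Dir} (hst : s ≠ t) (c : Module.End k A) :
    IsStep (l ++ [] ++ r) (l ++ [s, t] ++ r) (stepCup s t c l.length) := by
  have key : ∀ p : List (Dir × ℕ), Admissible (l ++ [] ++ r) p → ∃ p₁ p₂,
      p = p₁ ++ p₂ ∧ p₁.length = l.length ∧ p₁.map Prod.fst = l ∧ p₂.map Prod.fst = r := by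
    intro p hp
    have := hp.signs
    rw [List.append_nil] at this
    obtain ⟨p₁, p', rfl, h₁, h', h₁'⟩ := exists_split this
    exact ⟨p₁, p', rfl, h₁', h₁, h'⟩
  refine ⟨?_, ?_, ?_⟩
  · rintro ⟨p, lam⟩ st' hp e
    obtain ⟨p₁, p₂, rfl, hl, h₁, h₂⟩ := key p hp
    rw [stepCup_eq hl] at e
    obtain rfl := Option.some.inj e
    have hq := hp.reindex (f := Nat.succ) fun s m n _ _ e => Nat.succ.inj e
    -- Apart from the sign list, admissibility ignores the order of the ends, so the two new ends
    -- may be checked at the front.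
    refine Admissible.perm (L := s :: t :: (l ++ r)) (p := (s, 0) :: (t, 0) ::
      reindex Nat.succ (p₁ ++ p₂)) ⟨?_, ?_, ?_⟩ ?_ ?_
    · simp [h₁, h₂]
    · refine List.nodup_cons.2 ⟨?_, List.nodup_cons.2 ⟨?_, hq.nodup⟩⟩
      · simp [hst, mem_reindex, -reindex_append]
      · simp [mem_reindex, -reindex_append]
    · intro n hn
      have := hq.up_mem n
      simp only [List.mem_cons, Prod.mk.injEq, reindex_append, List.mem_append] at hn this ⊢
      cases s <;> cases t <;> simp at hst hn ⊢ <;> tauto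
    · rw [reindex_append]
      exact (List.perm_append_comm_assoc (l₁ := [(s, 0), (t, 0)]) ..)
    · simp [h₁, h₂]
  · rintro f ⟨p, lam⟩ ⟨p', lam'⟩ hp ⟨h₀, h₁, h₂⟩
    obtain ⟨p₁, p₂, rfl, hl, -, -⟩ := key p hp
    simp only [reindex_append] at h₀
    subst h₀
    -- The new string is called `0` in both configurations and all older names go up by one, so the
    -- renaming has to fix `0` and be `f` shifted.
    refine .inr ⟨fun n => Nat.casesOn n 0 fun m => f m + 1, _, _, stepCup_eq hl _ _ _,
      stepCup_eq (by simpa using hl) _ _ _, ?_, ?_, ?_⟩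
    · simp [Function.comp_def]
    · rintro s t (_ | m) (_ | n) hm hn e
      · rfl
      · simp at e
      · simp at e
      · simp only [List.mem_append, List.mem_cons, mem_reindex, Prod.mk.injEq] at hm hn
        simp only [Nat.add_right_cancel_iff] at e ⊢
        refine h₁ s t m n ?_ ?_ e <;> simp at hm hn ⊢ <;> tauto
    · rintro s (_ | n) hn
      · rfl
      · refine h₂ s n ?_
        simp only [List.mem_append, List.mem_cons, mem_reindex, Prod.mk.injEq] at hn
        simp at hn ⊢
        tauto
  · intro p lam n hp hn
    obtain ⟨p₁, p₂, rfl, hl, -, -⟩ := key p hp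
    refine .inr ⟨reindex Nat.succ p₁ ++ (s, 0) :: (t, 0) :: reindex Nat.succ p₂,
      fun n => Nat.casesOn n c lam, n + 1, LinearMap.id, ?_, fun e => ?_⟩
    rotate_left
    · rw [stepCup_eq hl]
      congr 2
      funext m
      rcases m with _ | m
      · simp
      · by_cases e : m = n
        · subst e; simp
        · simp [Function.update_of_ne, e]
    · simp only [List.mem_append, List.mem_cons, mem_reindex, Prod.mk.injEq]
      simp at hn ⊢
      tauto

/-- The cap consumes the rising end of `i` and the falling end of `j`. Only a falling end of `i` and
a rising end of `j` can be left, so giving both strings the same name creates no duplicate end. The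
rising end of `j` exists by admissibility and becomes that of the joined string. -/
theorem Admissible.join {L : List Dir} {q : List (Dir × ℕ)} {i j : ℕ}
    (h : Admissible L ((Dir.up, i) :: (Dir.down, j) :: q)) (hij : i ≠ j) :
    Admissible (q.map Prod.fst) (StrandState.reindex (joinName i j) q) := by
  have hd := h.nodup
  simp only [List.nodup_cons, List.mem_cons, not_or] at hd
  refine ⟨by simp, List.Nodup.map_on ?_ hd.2.2, ?_⟩
  · rintro ⟨s, m⟩ hm ⟨t, n⟩ hn e
    simp only [Prod.map, id, Prod.mk.injEq, joinName] at e
    obtain ⟨rfl, e⟩ := e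
    split_ifs at e with h₁ h₂ h₂
    · rw [h₁, h₂]
    · subst h₁ e
      cases s
      · exact absurd hn hd.1.2
      · exact absurd hm hd.2.1
    · subst h₂ e
      cases s
      · exact absurd hm hd.1.2
      · exact absurd hn hd.2.1
    · rw [e]
  · intro n hn
    obtain ⟨m, hm, rfl⟩ := mem_reindex.1 hn
    have hm' := h.up_mem m (by simp [hm])
    simp only [List.mem_cons, Prod.mk.injEq, true_and, reduceCtorEq, false_and, false_or] at hm'
    rcases hm' with rfl | hm'
    · refine mem_reindex.2 ⟨j, ?_, ?_⟩
      · have := h.up_mem j (by simp)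
        simpa [hij.symm] using this
      · simp [joinName, hij]
    · exact mem_reindex.2 ⟨m, hm', rfl⟩

/-- An injective renaming preserves the tests `n = i` and `n = j` on the names that occur, and these
tests are all that joining depends on. -/
theorem Renaming.join {f : ℕ → ℕ} {q : List (Dir × ℕ)} {i j : ℕ} {lam' : ℕ → Module.End k A}
    {r r' : List (Dir × ℕ)} (h : Renaming f (r, lam) (r', lam'))
    (hi : ∃ s, (s, i) ∈ r) (hj : ∃ s, (s, j) ∈ r) (hq : q ⊆ r) (d : Module.End k A) :
    Renaming f (reindex (joinName i j) q, joinLabel i j d lam)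
      (reindex (joinName (f i) (f j)) (reindex f q), joinLabel (f i) (f j) d lam') := by
  obtain ⟨si, hi⟩ := hi
  obtain ⟨sj, hj⟩ := hj
  have inj : ∀ s t m n, (s, m) ∈ r → (t, n) ∈ r → f m = f n → m = n := h.inj
  have label : ∀ s n, (s, n) ∈ r → lam' (f n) = lam n := h.label
  have hf : ∀ s n, (s, n) ∈ q → joinName (f i) (f j) (f n) = f (joinName i j n) := by
    intro s n hn
    have : f n = f j ↔ n = j := ⟨inj s sj _ _ (hq hn) hj, fun e => by rw [e]⟩
    simp only [joinName, this]
    split_ifs <;> rfl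
  have hmem : ∀ s n, (s, n) ∈ reindex (joinName i j) q → ∃ s, (s, n) ∈ r := by
    intro s n hn
    obtain ⟨m, hm, rfl⟩ := mem_reindex.1 hn
    unfold joinName
    split_ifs
    · exact ⟨si, hi⟩
    · exact ⟨s, hq hm⟩
  refine ⟨?_, ?_, ?_⟩
  · simp only [reindex_reindex]
    exact reindex_congr hf
  · intro s t m n hm hn
    obtain ⟨s', hm⟩ := hmem s m hm
    obtain ⟨t', hn⟩ := hmem t n hn
    exact inj s' t' m n hm hn
  · intro s n hn
    obtain ⟨s', hn⟩ := hmem s n hn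
    have h₁ : f n = f i ↔ n = i := ⟨inj s' si _ _ hn hi, fun e => by rw [e]⟩
    have h₂ : f n = f j ↔ n = j := ⟨inj s' sj _ _ hn hj, fun e => by rw [e]⟩
    simp only [joinLabel, h₁, h₂, label s' n hn, label si i hi, label sj j hj]

/-- The label of the joined string is a product in which the labels of `i` and `j` each occur once,
so it is linear in either of them; every other label passes through unchanged. -/
theorem joinLabel_update {i j n : ℕ} (hij : i ≠ j) (d : Module.End k A) :
    ∃ lam', ∃ g : Module.End k A →ₗ[k] Module.End k A,
      ∀ e, joinLabel i j d (Function.update lam n e) =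
        Function.update lam' (joinName i j n) (g e) := by
  by_cases hi : n = i
  · subst hi
    refine ⟨joinLabel n j d lam, LinearMap.mulLeft k (lam j * d), fun e => funext fun m => ?_⟩
    simp only [joinLabel, joinName, hij, if_false, Function.update_apply, hij.symm]
    split_ifs <;> simp [mul_assoc]
  by_cases hj : n = j
  · subst hj
    refine ⟨joinLabel i n d lam, LinearMap.mulRight k (d * lam i), fun e => funext fun m => ?_⟩
    simp only [joinLabel, joinName, Function.update_apply, hij, if_false, if_true]
    split_ifs <;> simp [mul_assoc]
  · refine ⟨joinLabel i j d lam, LinearMap.id, fun e => funext fun m => ?_⟩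
    simp only [joinLabel, joinName, hj, if_false, Function.update_apply, Ne.symm hi, Ne.symm hj]
    split_ifs <;> simp_all

theorem isStep_cap (l r : List Dir) {s t : Dir} (hst : s ≠ t) (d : Module.End k A) :
    IsStep (l ++ [s, t] ++ r) (l ++ [] ++ r) (stepCap s d l.length) := by
  -- Normal form for both kinds of cap: the rising end `i` and the falling end `j` are moved to the
  -- front. The renaming `f` is built in, so that the same statement serves a configuration and its
  -- renamed copy.
  have key : ∀ p : List (Dir × ℕ), Admissible (l ++ [s, t] ++ r) p → ∃ p₁ p₂ i j L,
      Admissible L ((Dir.up, i) :: (Dir.down, j) :: (p₁ ++ p₂)) ∧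
      p ⊆ (Dir.up, i) :: (Dir.down, j) :: (p₁ ++ p₂) ∧
      (Dir.up, i) :: (Dir.down, j) :: (p₁ ++ p₂) ⊆ p ∧
      p₁.map Prod.fst = l ∧ p₂.map Prod.fst = r ∧
      ∀ (f : ℕ → ℕ) (lam : ℕ → Module.End k A), stepCap s d l.length (reindex f p, lam) =
        if f i = f j then none else some (reindex (joinName (f i) (f j)) (reindex f (p₁ ++ p₂)),
          joinLabel (f i) (f j) d lam) := by
    intro p hp
    obtain ⟨p₁, x, y, p₂, rfl, hl, h₁, h₂⟩ := hp.exists_pair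
    have hl' : ∀ f, (reindex f p₁).length = l.length := by simpa using hl
    have hperm : ∀ a b : Dir × ℕ, (p₁ ++ a :: b :: p₂).Perm (a :: b :: (p₁ ++ p₂)) := fun a b =>
      (List.perm_append_comm_assoc (l₁ := [a, b]) ..).symm
    cases s <;> cases t <;> simp only [ne_eq, not_true_eq_false] at hst
    · refine ⟨p₁, p₂, x, y, _, hp.perm (hperm _ _) rfl, (hperm _ _).subset,
        (hperm _ _).symm.subset, h₁, h₂, fun f lam => ?_⟩
      rw [reindex_append, reindex_cons, reindex_cons, stepCap_up_eq (hl' f), reindex_append,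
        reindex_append]
    · have hperm' := (hperm (Dir.down, x) (Dir.up, y)).trans (List.Perm.swap _ _ _)
      refine ⟨p₁, p₂, y, x, _, hp.perm hperm' rfl, hperm'.subset,
        hperm'.symm.subset, h₁, h₂, fun f lam => ?_⟩
      rw [reindex_append, reindex_cons, reindex_cons, stepCap_down_eq (hl' f), reindex_append,
        reindex_append]
  have hid : ∀ p : List (Dir × ℕ), reindex id p = p := fun p => by simp [reindex]
  refine ⟨?_, ?_, ?_⟩
  · rintro ⟨p, lam⟩ st' hp e
    obtain ⟨p₁, p₂, i, j, L, hL, -, -, h₁, h₂, he⟩ := key p hp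
    have he := he id lam
    simp only [hid, id] at he
    rw [he] at e
    split_ifs at e with hij
    obtain rfl := Option.some.inj e
    simpa [h₁, h₂] using hL.join hij
  · rintro f ⟨p, lam⟩ ⟨p', lam'⟩ hp hf
    obtain ⟨p₁, p₂, i, j, L, hL, hs, hs', h₁, h₂, he⟩ := key p hp
    obtain rfl : p' = reindex f p := hf.ends
    have he' := he f lam'
    have he := he id lam
    simp only [hid, id] at he
    have hi : (Dir.up, i) ∈ p := hs' (by simp)
    have hj : (Dir.down, j) ∈ p := hs' (by simp)
    -- A cap that closes a string is undefined. Injectivity of `f` ensures that it closes a string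
    -- in one configuration exactly when it does in the other.
    by_cases hij : i = j
    · subst hij
      exact .inl ⟨by simpa using he, by simpa using he'⟩
    · have hij' : f i ≠ f j := fun e => hij (hf.inj _ _ i j hi hj e)
      rw [if_neg hij] at he
      rw [if_neg hij'] at he'
      exact .inr ⟨f, _, _, he, he', hf.join ⟨_, hi⟩ ⟨_, hj⟩
        (fun _ h => hs' (List.mem_cons_of_mem _ (List.mem_cons_of_mem _ h))) d⟩
  · intro p lam n hp hn
    obtain ⟨p₁, p₂, i, j, L, hL, hs, hs', h₁, h₂, he⟩ := key p hp
    have he := he id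
    simp only [hid, id] at he
    by_cases hij : i = j
    · exact .inl fun e => by rw [he, if_pos hij]
    · obtain ⟨lam', g, hg⟩ := joinLabel_update (lam := lam) (n := n) hij d
      refine .inr ⟨_, lam', joinName i j n, g, ?_, fun e => by rw [he, if_neg hij, hg]⟩
      have hn' := hs hn
      simp only [List.mem_cons, Prod.mk.injEq, true_and, reduceCtorEq, false_and, false_or] at hn'
      rcases hn' with rfl | hn'
      -- The rising end of `i` is gone; the joined string keeps the rising end of `j`.
      · refine mem_reindex.2 ⟨j, ?_, ?_⟩
        · have := hL.up_mem j (by simp)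
          simpa [Ne.symm hij] using this
        · simp [joinName, hij]
      · exact mem_reindex.2 ⟨n, hn', rfl⟩

end

end StrandState

namespace StrandState

section

variable {k A N : Type*} [CommRing k] [Ring A] [Algebra k A] [AddCommGroup N] [Module k N]

theorem reindex_id (p : List (Dir × ℕ)) : reindex id p = p := by simp [reindex]

theorem exists_single {s : Dir} {p : List (Dir × ℕ)} (h : p.map Prod.fst = [s]) :
    ∃ n, p = [(s, n)] := by
  obtain ⟨n, p₂, rfl, h₂⟩ := exists_cons h
  rw [List.map_eq_nil_iff.1 h₂]
  exact ⟨n, rfl⟩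

theorem exists_pair {s t : Dir} {p : List (Dir × ℕ)} (h : p.map Prod.fst = [s, t]) :
    ∃ m n, p = [(s, m), (t, n)] := by
  obtain ⟨m, p₂, rfl, h₂⟩ := exists_cons h
  obtain ⟨n, rfl⟩ := exists_single h₂
  exact ⟨m, n, rfl⟩

/-! ### Locality -/

/-- The effect of a step on the ends and the labels it concerns: the renaming of the strings,
the new ends, and the new labels. -/
abbrev LocalStep (k A : Type*) [CommRing k] [Ring A] [Algebra k A] : Type _ :=
  List (Dir × ℕ) → (ℕ → Module.End k A) →
    Option ((ℕ → ℕ) × List (Dir × ℕ) × (ℕ → Module.End k A))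

/-- Exchange of two ends. -/
def localCross : LocalStep k A
  | [x, y], lam => some (id, [y, x], lam)
  | _, _ => none

/-- A new bead. -/
def localBead (s : Dir) (x : A) : LocalStep k A
  | [(s', n)], lam => some (id, [(s', n)], Function.update lam n (beadAct s x (lam n)))
  | _, _ => none

/-- A new string. -/
def localCup (s t : Dir) (c : Module.End k A) : LocalStep k A
  | [], lam => some (Nat.succ, [(s, 0), (t, 0)], fun n => Nat.casesOn n c lam)
  | _, _ => none

/-- Closing two ends. -/
def localCap (s : Dir) (d : Module.End k A) : LocalStep k A
  | [(_, x), (_, y)], lam =>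
      match s with
      | .up => if x = y then none else some (joinName x y, [], joinLabel x y d lam)
      | .down => if y = x then none else some (joinName y x, [], joinLabel y x d lam)
  | _, _ => none

/-- `F` concerns `m` neighbouring ends, which it replaces by `n` ends, and its effect on them is
given by `G`. -/
structure IsLocal (m n : ℕ) (F : ℕ → StrandState k A → Option (StrandState k A))
    (G : LocalStep k A) : Prop where
  eq : ∀ (p M q : List (Dir × ℕ)) (lam : ℕ → Module.End k A), M.length = m →
    F p.length (p ++ (M ++ q), lam) =
      (G M lam).map fun u => (reindex u.1 p ++ (u.2.1 ++ reindex u.1 q), u.2.2)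
  length : ∀ (M : List (Dir × ℕ)) (lam : ℕ → Module.End k A), ∀ u ∈ G M lam, u.2.1.length = n

theorem isLocal_cross (s t : Dir) :
    IsLocal [s, t].length [t, s].length (stepCross (k := k) (A := A)) localCross := by
  refine ⟨fun p M q lam h => ?_, fun M lam u hu => ?_⟩
  · obtain ⟨x, y, rfl⟩ := List.length_eq_two.1 h
    simp [localCross, stepCross, reindex_id]
  · unfold localCross at hu
    split at hu <;> simp at hu
    simp [← hu]

theorem isLocal_bead (s : Dir) (x : A) :
    IsLocal [s].length [s].length (stepBead (k := k) s x) (localBead s x) := by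
  refine ⟨fun p M q lam h => ?_, fun M lam u hu => ?_⟩
  · obtain ⟨⟨s', n⟩, rfl⟩ := List.length_eq_one_iff.1 h
    simp [localBead, stepBead, reindex_id]
  · unfold localBead at hu
    split at hu <;> simp at hu
    simp [← hu]

theorem isLocal_cup (s t : Dir) (c : Module.End k A) :
    IsLocal ([] : List Dir).length [s, t].length (stepCup s t c) (localCup s t c) := by
  refine ⟨fun p M q lam h => ?_, fun M lam u hu => ?_⟩
  · obtain rfl := List.length_eq_zero_iff.1 h
    simp [localCup, stepCup]
  · unfold localCup at hu
    split at hu <;> simp at hu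
    simp [← hu]

theorem isLocal_cap (s t : Dir) (d : Module.End k A) :
    IsLocal [s, t].length ([] : List Dir).length (stepCap s d) (localCap s d) := by
  refine ⟨fun p M q lam h => ?_, fun M lam u hu => ?_⟩
  · obtain ⟨⟨s', x⟩, ⟨t', y⟩, rfl⟩ := List.length_eq_two.1 h
    cases s <;> simp only [localCap, stepCap, List.drop_left, List.cons_append, List.nil_append,
      List.take_left] <;> split_ifs <;> simp
  · unfold localCap at hu
    repeat' split at hu
    all_goals simp at hu
    all_goals simp [← hu]

/-- Two local steps applied to disjoint sets of ends, the first one first. -/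
def localPair (G₁ G₂ : LocalStep k A) (M₁ M₂ : List (Dir × ℕ)) (lam : ℕ → Module.End k A) :
    Option ((ℕ → ℕ) × List (Dir × ℕ) × List (Dir × ℕ) × (ℕ → Module.End k A)) :=
  (G₁ M₁ lam).bind fun u => (G₂ (reindex u.1 M₂) u.2.2).map fun v =>
    (v.1 ∘ u.1, reindex v.1 u.2.1, v.2.1, v.2.2)

/-- The two steps do not depend on the order. -/
def LocallyCommute (G₁ G₂ : LocalStep k A) (a c : List Dir) : Prop :=
  ∀ (M₁ M₂ : List (Dir × ℕ)) (lam : ℕ → Module.End k A), M₁.map Prod.fst = a →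
    M₂.map Prod.fst = c → (∀ x ∈ M₁, x ∉ M₂) → localPair G₁ G₂ M₁ M₂ lam =
      (localPair G₂ G₁ M₂ M₁ lam).map fun u => (u.1, u.2.2.1, u.2.1, u.2.2.2)

theorem LocallyCommute.symm {G₁ G₂ : LocalStep k A} {a c : List Dir}
    (h : LocallyCommute G₁ G₂ a c) : LocallyCommute G₂ G₁ c a := by
  intro M₂ M₁ lam h₂ h₁ hd
  rw [h M₁ M₂ lam h₁ h₂ fun x hx hx' => hd x hx' hx, Option.map_map]
  exact Option.map_id'.symm

/-- The bystanders `p₁`, `p₂`, `p₃` are affected only through the total renaming. Once the total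
renamings, the new ends and the labels agree locally, the full configurations agree on the nose, and
the order of the steps is irrelevant for every function `φ`. -/
theorem pull_comm {a b c d : List Dir} {F₁ F₂ : ℕ → StrandState k A → Option (StrandState k A)}
    {G₁ G₂ : LocalStep k A} (h₁ : IsLocal a.length b.length F₁ G₁)
    (h₂ : IsLocal c.length d.length F₂ G₂) (h : LocallyCommute G₁ G₂ a c) (l m r : List Dir)
    (φ : StrandState k A → N) (st : StrandState k A) (hst : Admissible (l ++ a ++ m ++ c ++ r) st.1) :
    pull (F₁ l.length) (pull (F₂ (l.length + b.length + m.length)) φ) st =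
      pull (F₂ (l.length + a.length + m.length)) (pull (F₁ l.length) φ) st := by
  obtain ⟨p, lam⟩ := st
  have hs := hst.signs
  have hd := hst.nodup
  simp only [List.append_assoc] at hs
  obtain ⟨p₁, p, rfl, -, hs, hp₁⟩ := exists_split hs
  obtain ⟨M₁, p, rfl, ha, hs, hM₁⟩ := exists_split hs
  obtain ⟨p₂, p, rfl, -, hs, hp₂⟩ := exists_split hs
  obtain ⟨M₂, p₃, rfl, hc, -, hM₂⟩ := exists_split hs
  -- The two groups of ends are disjoint because no end is repeated, although one string may well
  -- have an end in each group.
  have key := h M₁ M₂ lam ha hc (by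
    intro x hx hx'
    have := (List.nodup_append.1 (List.nodup_append.1 hd).2.1).2.2 x hx x
    simp [hx'] at this)
  unfold localPair at key
  have e₁ : ∀ q lam, F₁ l.length (p₁ ++ (M₁ ++ q), lam) = (G₁ M₁ lam).map fun u =>
      (reindex u.1 p₁ ++ (u.2.1 ++ reindex u.1 q), u.2.2) := by
    intro q lam
    rw [← hp₁, h₁.eq _ _ _ _ hM₁]
  have e₂ : F₂ (l.length + a.length + m.length) (p₁ ++ (M₁ ++ (p₂ ++ (M₂ ++ p₃))), lam) =
      (G₂ M₂ lam).map fun u => (reindex u.1 p₁ ++ (reindex u.1 M₁ ++ (reindex u.1 p₂ ++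
        (u.2.1 ++ reindex u.1 p₃))), u.2.2) := by
    have := h₂.eq (p₁ ++ M₁ ++ p₂) M₂ p₃ lam hM₂
    simp only [List.length_append, hp₁, hM₁, hp₂, List.append_assoc, reindex_append,
      ← Nat.add_assoc] at this
    exact this
  have e₃ : ∀ u ∈ G₁ M₁ lam, F₂ (l.length + b.length + m.length)
      (reindex u.1 p₁ ++ (u.2.1 ++ reindex u.1 (p₂ ++ (M₂ ++ p₃))), u.2.2) =
      (G₂ (reindex u.1 M₂) u.2.2).map fun v => (reindex v.1 (reindex u.1 p₁) ++
        (reindex v.1 u.2.1 ++ (reindex v.1 (reindex u.1 p₂) ++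
          (v.2.1 ++ reindex v.1 (reindex u.1 p₃)))), v.2.2) := by
    intro u hu
    have := h₂.eq (reindex u.1 p₁ ++ u.2.1 ++ reindex u.1 p₂) (reindex u.1 M₂) (reindex u.1 p₃)
      u.2.2 (by simpa using hM₂)
    simp only [List.length_append, length_reindex, hp₁, h₁.length _ _ _ hu, hp₂, List.append_assoc,
      reindex_append, ← Nat.add_assoc] at this
    simpa only [reindex_append] using this
  have e₄ : ∀ v ∈ G₂ M₂ lam, F₁ l.length (reindex v.1 p₁ ++ (reindex v.1 M₁ ++ (reindex v.1 p₂ ++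
        (v.2.1 ++ reindex v.1 p₃))), v.2.2) =
      (G₁ (reindex v.1 M₁) v.2.2).map fun u => (reindex u.1 (reindex v.1 p₁) ++
        (u.2.1 ++ (reindex u.1 (reindex v.1 p₂) ++
          (reindex u.1 v.2.1 ++ reindex u.1 (reindex v.1 p₃)))), u.2.2) := by
    intro v hv
    have := h₁.eq (reindex v.1 p₁) (reindex v.1 M₁) (reindex v.1 p₂ ++ (v.2.1 ++ reindex v.1 p₃))
      v.2.2 (by simpa using hM₁)
    simpa only [length_reindex, hp₁, reindex_append] using this
  have E₁ : ((F₁ l.length (p₁ ++ (M₁ ++ (p₂ ++ (M₂ ++ p₃))), lam)).bind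
      (F₂ (l.length + b.length + m.length))) =
      ((F₂ (l.length + a.length + m.length) (p₁ ++ (M₁ ++ (p₂ ++ (M₂ ++ p₃))), lam)).bind
        (F₁ l.length)) := by
    have := congrArg (Option.map fun w => (reindex w.1 p₁ ++ (w.2.1 ++ (reindex w.1 p₂ ++
      (w.2.2.1 ++ reindex w.1 p₃))), w.2.2.2)) key
    rw [e₁, e₂]
    rcases hG₁ : G₁ M₁ lam with _ | u <;> rcases hG₂ : G₂ M₂ lam with _ | v <;>
      simp only [hG₁, hG₂, Option.bind_none, Option.map_none, Option.bind_some, Option.map_some,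
        Option.map_map] at this ⊢
    · rw [e₄ v hG₂]
      simp only [Function.comp_def] at this
      simpa only [reindex_reindex, Function.comp_def] using this
    · rw [e₃ u hG₁]
      simp only [Function.comp_def] at this
      simpa only [reindex_reindex, Function.comp_def] using this
    · rw [e₄ v hG₂, e₃ u hG₁]
      simp only [Function.comp_def] at this
      simpa only [reindex_reindex, Function.comp_def] using this
  have E₂ : ∀ (F F' : StrandState k A → Option (StrandState k A)) (st : StrandState k A),
      pull F (pull F' φ) st = ((F st).bind F').elim 0 φ := by
    intro F F' st
    rcases h : F st with _ | u
    · rw [pull_none h]; rfl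
    · rw [pull_some h]; rfl
  rw [E₂, E₂, E₁]

/-! ### Exchange of the elementary steps -/

theorem locallyCommute_cross_cross (s t u v : Dir) :
    LocallyCommute (localCross (k := k) (A := A)) localCross [s, t] [u, v] := by
  intro M₁ M₂ lam h₁ h₂ hd
  obtain ⟨x, y, rfl⟩ := exists_pair h₁
  obtain ⟨z, w, rfl⟩ := exists_pair h₂
  simp [localPair, localCross]

theorem locallyCommute_cross_bead (s t u : Dir) (a : A) :
    LocallyCommute (localCross (k := k) (A := A)) (localBead u a) [s, t] [u] := by
  intro M₁ M₂ lam h₁ h₂ hd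
  obtain ⟨x, y, rfl⟩ := exists_pair h₁
  obtain ⟨z, rfl⟩ := exists_single h₂
  simp [localPair, localCross, localBead]

theorem locallyCommute_cross_cup (s t u v : Dir) (c : Module.End k A) :
    LocallyCommute localCross (localCup u v c) [s, t] [] := by
  intro M₁ M₂ lam h₁ h₂ hd
  obtain ⟨x, y, rfl⟩ := exists_pair h₁
  obtain rfl := List.map_eq_nil_iff.1 h₂
  simp [localPair, localCross, localCup]

theorem locallyCommute_cross_cap (s t u v : Dir) (d : Module.End k A) :
    LocallyCommute localCross (localCap u d) [s, t] [u, v] := by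
  intro M₁ M₂ lam h₁ h₂ hd
  obtain ⟨x, y, rfl⟩ := exists_pair h₁
  obtain ⟨z, w, rfl⟩ := exists_pair h₂
  cases u <;> simp only [localPair, localCross, localCap, Option.bind_some, reindex_cons,
    reindex_nil, id] <;> split_ifs <;> simp

/-- On one and the same string the two beads must sit at its two different ends. One of them
composes with the label on the left and the other on the right, so they commute by associativity. -/
theorem locallyCommute_bead_bead (s u : Dir) (a b : A) :
    LocallyCommute (localBead (k := k) s a) (localBead u b) [s] [u] := by
  intro M₁ M₂ lam h₁ h₂ hd
  obtain ⟨x, rfl⟩ := exists_single h₁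
  obtain ⟨z, rfl⟩ := exists_single h₂
  simp only [List.mem_singleton, forall_eq, Prod.mk.injEq] at hd
  by_cases e : x = z
  · subst e
    cases s <;> cases u <;> simp [localPair, localBead, beadAct, mul_assoc] at hd ⊢
  · simp [localPair, localBead, Function.update_of_ne (Ne.symm e), Function.update_of_ne e,
      Function.update_comm e]

theorem locallyCommute_bead_cup (s u v : Dir) (a : A) (c : Module.End k A) :
    LocallyCommute (localBead s a) (localCup u v c) [s] [] := by
  intro M₁ M₂ lam h₁ h₂ hd
  obtain ⟨x, rfl⟩ := exists_single h₁
  obtain rfl := List.map_eq_nil_iff.1 h₂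
  simp only [localPair, localBead, localCup, Option.bind_some, Option.map_some, reindex_cons,
    reindex_nil, id, Option.some.injEq, Prod.mk.injEq, true_and, Function.comp_id,
    Function.id_comp]
  refine funext fun n => ?_
  rcases n with _ | n
  · simp
  · by_cases e : n = x
    · subst e; simp
    · simp [Function.update_of_ne, e]

/-- The bead sits at an end that survives the cap. If this end belongs to one of the joined strings,
it is the rising end of `j` or the falling end of `i`, and the bead acts at an outer end of the
product `lam j * d * lam i`. -/
theorem locallyCommute_bead_cap (s u v : Dir) (huv : u ≠ v) (a : A) (d : Module.End k A) :
    LocallyCommute (localBead s a) (localCap u d) [s] [u, v] := by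
  intro M₁ M₂ lam h₁ h₂ hd
  obtain ⟨x, rfl⟩ := exists_single h₁
  obtain ⟨z, w, rfl⟩ := exists_pair h₂
  have key : ∀ i j : ℕ, i ≠ j → (s = .up → x ≠ i) → (s = .down → x ≠ j) →
      joinLabel i j d (Function.update lam x (beadAct s a (lam x))) =
        Function.update (joinLabel i j d lam) (joinName i j x)
          (beadAct s a (joinLabel i j d lam (joinName i j x))) := by
    intro i j hij hi hj
    funext n
    cases s <;> simp only [ne_eq, forall_const, reduceCtorEq, false_imp_iff] at hi hj <;>
      simp only [joinLabel, joinName, Function.update_apply, beadAct] <;> split_ifs <;>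
        subst_vars <;> first | contradiction | simp [mul_assoc]
  cases u <;> cases v <;> simp only [ne_eq, not_true_eq_false] at huv
  · by_cases e : z = w
    · simp [localPair, localBead, localCap, e]
    · have := key z w e (by rintro rfl rfl; simp at hd) (by rintro rfl rfl; simp at hd)
      simp [localPair, localBead, localCap, e, this]
  · by_cases e : w = z
    · simp [localPair, localBead, localCap, e]
    · have := key w z e (by rintro rfl rfl; simp at hd) (by rintro rfl rfl; simp at hd)
      simp [localPair, localBead, localCap, e, this]

theorem locallyCommute_cup_cap (s t u v : Dir) (c d : Module.End k A) :
    LocallyCommute (localCup s t c) (localCap u d) [] [u, v] := by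
  intro M₁ M₂ lam h₁ h₂ hd
  obtain rfl := List.map_eq_nil_iff.1 h₁
  obtain ⟨z, w, rfl⟩ := exists_pair h₂
  have key₁ : ∀ i j : ℕ, joinName (i + 1) (j + 1) ∘ Nat.succ = Nat.succ ∘ joinName i j := by
    intro i j
    funext n
    simp only [joinName, Function.comp_apply, Nat.succ_eq_add_one, Nat.add_right_cancel_iff]
    split_ifs <;> rfl
  have key₂ : ∀ i j : ℕ, joinLabel (i + 1) (j + 1) d (fun n => Nat.casesOn n c lam) =
      fun n => Nat.casesOn n c (joinLabel i j d lam) := by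
    intro i j
    funext n
    rcases n with _ | n <;> simp [joinLabel]
  have key₃ : ∀ i j : ℕ, joinName (i + 1) (j + 1) 0 = 0 := by
    intro i j
    simp [joinName]
  cases u
  · by_cases e : z = w
    · simp [localPair, localCup, localCap, e]
    · simp [localPair, localCup, localCap, e, key₁, key₂, key₃]
  · by_cases e : w = z
    · simp [localPair, localCup, localCap, e]
    · simp [localPair, localCup, localCap, e, key₁, key₂, key₃]

/-- The two caps may involve the same string. They then join three pieces into a chain, whose name
is that of its first piece and whose label is an associative product, or they close a loop and both
orders are undefined. -/
theorem locallyCommute_cap_cap (s t u v : Dir) (hst : s ≠ t) (huv : u ≠ v) (d e : Module.End k A) :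
    LocallyCommute (localCap s d) (localCap u e) [s, t] [u, v] := by
  intro M₁ M₂ lam h₁ h₂ hd
  obtain ⟨x, y, rfl⟩ := exists_pair h₁
  obtain ⟨z, w, rfl⟩ := exists_pair h₂
  have key : ∀ i j m n : ℕ, i ≠ m → j ≠ n →
      ((if i = j then none else if joinName i j m = joinName i j n then none else
        some (joinName (joinName i j m) (joinName i j n) ∘ joinName i j,
          joinLabel (joinName i j m) (joinName i j n) e (joinLabel i j d lam))) :
        Option ((ℕ → ℕ) × (ℕ → Module.End k A))) =
      if m = n then none else if joinName m n i = joinName m n j then none else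
        some (joinName (joinName m n i) (joinName m n j) ∘ joinName m n,
          joinLabel (joinName m n i) (joinName m n j) d (joinLabel m n e lam)) := by
    intro i j m n him hjn
    by_cases hij : i = j
    · subst hij
      simp
    by_cases hmn : m = n
    · subst hmn
      simp
    rw [if_neg hij, if_neg hmn]
    by_cases hmj : m = j
    · subst hmj
      by_cases hin : i = n
      · subst hin
        simp [joinName]
      · have h₁ : joinName i m m = i := by simp [joinName]
        have h₂ : joinName i m n = n := by simp [joinName, hjn.symm]
        have h₃ : joinName m n i = i := by simp [joinName, hin]
        have h₄ : joinName m n m = m := by simp [joinName, hmn]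
        rw [h₁, h₂, h₃, h₄, if_neg hin, if_neg hij]
        congr 2
        · funext a
          simp only [joinName, Function.comp_apply]
          split_ifs <;> simp_all
        · funext a
          simp only [joinLabel]
          split_ifs <;> simp_all [mul_assoc]
    · have h₁ : joinName i j m = m := by simp [joinName, hmj]
      have h₄ : joinName m n j = j := by simp [joinName, hjn]
      rw [h₁, h₄]
      by_cases hin : i = n
      · subst hin
        have h₂ : joinName i j i = i := by simp [joinName, hij]
        have h₃ : joinName m i i = m := by simp [joinName]
        rw [h₂, h₃, if_neg hmn, if_neg hmj]
        congr 2
        · funext a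
          simp only [joinName, Function.comp_apply]
          split_ifs <;> simp_all
        · funext a
          simp only [joinLabel]
          split_ifs <;> simp_all [mul_assoc]
      · have h₂ : joinName i j n = n := by simp [joinName, Ne.symm hjn]
        have h₃ : joinName m n i = i := by simp [joinName, hin]
        rw [h₂, h₃, if_neg hmn, if_neg hij]
        congr 2
        · funext a
          simp only [joinName, Function.comp_apply]
          split_ifs <;> simp_all
        · funext a
          simp only [joinLabel]
          split_ifs <;> simp_all
  cases s <;> cases t <;> simp only [ne_eq, not_true_eq_false] at hst <;>
    cases u <;> cases v <;> simp only [ne_eq, not_true_eq_false] at huv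
  · have := key x y z w (by rintro rfl; simp at hd) (by rintro rfl; simp at hd)
    simp only [localPair, localCap, reindex_cons, reindex_nil]
    split_ifs at this ⊢ <;> simp_all
  · have := key x y w z (by rintro rfl; simp at hd) (by rintro rfl; simp at hd)
    simp only [localPair, localCap, reindex_cons, reindex_nil]
    split_ifs at this ⊢ <;> simp_all
  · have := key y x z w (by rintro rfl; simp at hd) (by rintro rfl; simp at hd)
    simp only [localPair, localCap, reindex_cons, reindex_nil]
    split_ifs at this ⊢ <;> simp_all
  · have := key y x w z (by rintro rfl; simp at hd) (by rintro rfl; simp at hd)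
    simp only [localPair, localCap, reindex_cons, reindex_nil]
    split_ifs at this ⊢ <;> simp_all

end

end StrandState

namespace StrandState

section

variable {k A N : Type*} [CommRing k] [Ring A] [Algebra k A] [AddCommGroup N] [Module k N]

/-! ### The action of decorated flat tangles -/

/-- The turn made by a string at a cup whose left leg has sign `s`. -/
def cupTurn (U D : A ≃ₐ[k] A) : Dir → Module.End k A
  | .up => D.symm.toLinearMap
  | .down => U.toLinearMap

/-- The turn made by a string at a cap whose left leg has sign `s`. -/
def capTurn (U D : A ≃ₐ[k] A) : Dir → Module.End k A
  | .up => U.symm.toLinearMap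
  | .down => D.toLinearMap

/-- Functions on configurations are pulled back along the decorated flat tangle which is attached at
the ends number `o`, `o + 1`, … -/
def act (U D : A ≃ₐ[k] A) : ∀ {a b : List Dir}, BeadDiagram k A a b → ℕ →
    ((StrandState k A → N) →ₗ[k] (StrandState k A → N))
  | _, _, .id _, _ => LinearMap.id
  | _, _, .comp f g, o => act U D f o ∘ₗ act U D g o
  | _, _, @BeadDiagram.tensor _ _ _ b _ _ f g, o => act U D f o ∘ₗ act U D g (o + b.length)
  | _, _, @BeadDiagram.cup _ _ s t _, o => pull (stepCup s t (cupTurn U D s) o)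
  | _, _, @BeadDiagram.cap _ _ s _ _, o => pull (stepCap s (capTurn U D s) o)
  | _, _, .crossing _ _, o => pull (stepCross o)
  | _, _, .bead s x, o => pull (stepBead s x o)
  | _, _, .zero _ _, _ => 0
  | _, _, .add f g, o => act U D f o + act U D g o
  | _, _, .smul c f, o => c • act U D f o

variable {U D : A ≃ₐ[k] A}

theorem act_cast {a a' b b' : List Dir} (ha : a = a') (hb : b = b') (f : BeadDiagram k A a b)
    (o : ℕ) : (act U D (f.cast ha hb) o : (StrandState k A → N) →ₗ[k] _) = act U D f o := by
  subst ha hb; rfl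

theorem pull_congr {L L' : List Dir} {F : StrandState k A → Option (StrandState k A)}
    (hF : IsStep L L' F) {φ ψ : StrandState k A → N}
    (h : ∀ st, Admissible L' st.1 → φ st = ψ st) (st : StrandState k A) (hst : Admissible L st.1) :
    pull F φ st = pull F ψ st := by
  rcases e : F st with _ | u
  · rw [pull_none e, pull_none e]
  · rw [pull_some e, pull_some e, h u (hF.admissible _ _ hst e)]

/-- Every step maps admissible configurations to admissible ones, so an equality of functions that
is known only there can still be used inside a composite. -/
theorem act_congr {a b : List Dir} (f : BeadDiagram k A a b) (l r : List Dir)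
    {φ ψ : StrandState k A → N} (h : ∀ st, Admissible (l ++ b ++ r) st.1 → φ st = ψ st)
    (st : StrandState k A) (hst : Admissible (l ++ a ++ r) st.1) :
    act U D f l.length φ st = act U D f l.length ψ st := by
  induction f generalizing l r φ ψ st with
  | id a => exact h st hst
  | comp f g ihf ihg => exact ihf l r (ihg l r h) st hst
  | @tensor a b c d f g ihf ihg =>
    refine ihf l (c ++ r) (fun st hst => ?_) st (by simpa using hst)
    simpa using ihg (l ++ b) r (by simpa using h) st (by simpa using hst)
  | cup hs => exact pull_congr (isStep_cup l r hs _) h st hst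
  | cap hs => exact pull_congr (isStep_cap l r hs _) h st hst
  | crossing s t => exact pull_congr (isStep_cross l r s t) h st hst
  | bead s x => exact pull_congr (isStep_bead l r s x) h st hst
  | zero => rfl
  | add f g ihf ihg => exact congrArg₂ (· + ·) (ihf l r h st hst) (ihg l r h st hst)
  | smul c f ih => exact congrArg (c • ·) (ih l r h st hst)

theorem Multilinear.zero (L : List Dir) : Multilinear L (0 : StrandState k A → N) :=
  ⟨fun _ _ _ _ _ => rfl, fun _ _ _ _ _ => ⟨0, fun _ => rfl⟩⟩

theorem Multilinear.add {L : List Dir} {φ ψ : StrandState k A → N} (hφ : Multilinear L φ)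
    (hψ : Multilinear L ψ) : Multilinear L (φ + ψ) where
  rename f st st' hst h := congrArg₂ (· + ·) (hφ.rename f st st' hst h) (hψ.rename f st st' hst h)
  linear p lam n hp hn := by
    obtain ⟨g, hg⟩ := hφ.linear p lam n hp hn
    obtain ⟨g', hg'⟩ := hψ.linear p lam n hp hn
    exact ⟨g + g', fun e => congrArg₂ (· + ·) (hg e) (hg' e)⟩

theorem Multilinear.smul {L : List Dir} {φ : StrandState k A → N} (c : k)
    (hφ : Multilinear L φ) : Multilinear L (c • φ) where
  rename f st st' hst h := congrArg (c • ·) (hφ.rename f st st' hst h)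
  linear p lam n hp hn := by
    obtain ⟨g, hg⟩ := hφ.linear p lam n hp hn
    exact ⟨c • g, fun e => congrArg (c • ·) (hg e)⟩

theorem Multilinear.act {a b : List Dir} (f : BeadDiagram k A a b) (l r : List Dir)
    {φ : StrandState k A → N} (h : Multilinear (l ++ b ++ r) φ) :
    Multilinear (l ++ a ++ r) (act U D f l.length φ) := by
  induction f generalizing l r φ with
  | id a => exact h
  | comp f g ihf ihg => exact ihf l r (ihg l r h)
  | @tensor a b c d f g ihf ihg =>
    have h₁ := ihg (l ++ b) r (φ := φ) (by simpa using h)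
    have h₂ := ihf l (c ++ r) (by simpa using h₁)
    simpa [StrandState.act] using h₂
  | cup hs => exact h.pull (isStep_cup l r hs _)
  | cap hs => exact h.pull (isStep_cap l r hs _)
  | crossing s t => exact h.pull (isStep_cross l r s t)
  | bead s x => exact h.pull (isStep_bead l r s x)
  | zero => exact Multilinear.zero _
  | add f g ihf ihg => exact (ihf l r h).add (ihg l r h)
  | smul c f ih => exact (ih l r h).smul c

/-- Whichever cup comes last is named `0`, so the two orders produce configurations with the names
`0` and `1` exchanged. Unlike the other pairs of elementary pieces, two cups commute only up to
renaming, and invariance of `φ` under renaming is needed. -/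
theorem pull_cup_comm {s t u v : Dir} (hst : s ≠ t) (huv : u ≠ v) (c d : Module.End k A)
    (l m r : List Dir) {φ : StrandState k A → N}
    (hφ : Multilinear (l ++ [s, t] ++ m ++ [u, v] ++ r) φ) (st : StrandState k A)
    (hp : Admissible (l ++ m ++ r) st.1) :
    pull (stepCup s t c l.length) (pull (stepCup u v d (l.length + 2 + m.length)) φ) st =
      pull (stepCup u v d (l.length + m.length)) (pull (stepCup s t c l.length) φ) st := by
  obtain ⟨p, lam⟩ := st
  have hs := hp.signs
  simp only [List.append_assoc] at hs
  obtain ⟨p₁, p, rfl, -, hs, hp₁⟩ := exists_split hs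
  obtain ⟨p₂, p₃, rfl, -, -, hp₂⟩ := exists_split hs
  have e₁ := stepCup_eq (q := p₂ ++ p₃) (lam := lam) hp₁ s t c
  have e₂ := stepCup_eq (o := l.length + m.length) (p := p₁ ++ p₂) (q := p₃) (lam := lam)
    (by simp [hp₁, hp₂]) u v d
  rw [List.append_assoc] at e₂
  have e₃ := stepCup_eq (o := l.length + 2 + m.length)
    (p := reindex Nat.succ p₁ ++ (s, 0) :: (t, 0) :: reindex Nat.succ p₂)
    (q := reindex Nat.succ p₃) (lam := fun n => Nat.casesOn n c lam)
    (by simp [hp₁, hp₂]; omega) u v d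
  rw [List.append_assoc, List.cons_append, List.cons_append, ← reindex_append] at e₃
  have e₄ := stepCup_eq (o := l.length) (p := reindex Nat.succ p₁)
    (q := reindex Nat.succ p₂ ++ (u, 0) :: (v, 0) :: reindex Nat.succ p₃)
    (lam := fun n => Nat.casesOn n d lam) (by simp [hp₁]) s t c
  rw [← List.append_assoc, ← reindex_append] at e₄
  have a₁ := (isStep_cup l (m ++ r) hst c).admissible (p₁ ++ (p₂ ++ p₃), lam) _
    (by simpa using hp) e₁
  have hl : (l ++ [s, t] ++ m).length = l.length + 2 + m.length := by simp; omega
  have a₂ := (isStep_cup (l ++ [s, t] ++ m) r huv d).admissible _ _ (by simpa using a₁)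
    ((congrArg (fun o => stepCup u v d o _) hl).trans e₃)
  rw [pull_some e₁, pull_some e₂, pull_some e₃, pull_some e₄]
  symm
  refine hφ.rename (Equiv.swap 0 1) _ _ (by simpa using a₂) ⟨?_, ?_, ?_⟩
  · have : ∀ q : List (Dir × ℕ), reindex (⇑(Equiv.swap 0 1) ∘ Nat.succ ∘ Nat.succ) q =
        reindex (Nat.succ ∘ Nat.succ) q := fun q => reindex_congr fun _ n _ =>
      Equiv.swap_apply_of_ne_of_ne (by simp) (by simp)
    simp [this]
  · intro _ _ m n _ _ e
    exact (Equiv.swap 0 1).injective e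
  · rintro _ (_ | _ | n) _
    · simp
    · simp
    · rw [Equiv.swap_apply_of_ne_of_ne (by simp) (by simp)]

theorem pull_cup_comm' {s t u v : Dir} (hst : s ≠ t) (huv : u ≠ v) (c d : Module.End k A)
    (l m r : List Dir) {φ : StrandState k A → N}
    (hφ : Multilinear (l ++ [s, t] ++ m ++ [u, v] ++ r) φ) (st : StrandState k A)
    (hp : Admissible (l ++ [] ++ m ++ [] ++ r) st.1) :
    pull (stepCup s t c l.length) (pull (stepCup u v d (l.length + [s, t].length + m.length)) φ)
      st = pull (stepCup u v d (l.length + ([] : List Dir).length + m.length))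
        (pull (stepCup s t c l.length) φ) st :=
  pull_cup_comm hst huv c d l m r hφ st (by simpa using hp)

/-- Elementary decorated flat tangles. -/
inductive IsElementary : ∀ {a b : List Dir}, BeadDiagram k A a b → Prop
  | cup {s t : Dir} (h : s ≠ t) : IsElementary (.cup h)
  | cap {s t : Dir} (h : s ≠ t) : IsElementary (.cap h)
  | crossing (s t : Dir) : IsElementary (.crossing s t)
  | bead (s : Dir) (x : A) : IsElementary (.bead s x)

theorem act_comm_elementary {a b c d : List Dir} {f : BeadDiagram k A a b}
    {g : BeadDiagram k A c d} (hf : IsElementary f) (hg : IsElementary g)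
    (l m r : List Dir) {φ : StrandState k A → N} (hφ : Multilinear (l ++ b ++ m ++ d ++ r) φ)
    (st : StrandState k A) (hst : Admissible (l ++ a ++ m ++ c ++ r) st.1) :
    act U D f l.length (act U D g (l.length + b.length + m.length) φ) st =
      act U D g (l.length + a.length + m.length) (act U D f l.length φ) st := by
  cases hf with
  | cup h =>
    cases hg with
    | cup h' => exact pull_cup_comm' h h' _ _ l m r hφ st hst
    | cap h' =>
      exact pull_comm (isLocal_cup _ _ _) (isLocal_cap _ _ _)
        (locallyCommute_cup_cap _ _ _ _ _ _) l m r φ st hst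
    | crossing s t =>
      exact pull_comm (isLocal_cup _ _ _) (isLocal_cross _ _)
        (locallyCommute_cross_cup _ _ _ _ _).symm l m r φ st hst
    | bead s x =>
      exact pull_comm (isLocal_cup _ _ _) (isLocal_bead _ _)
        (locallyCommute_bead_cup _ _ _ _ _).symm l m r φ st hst
  | cap h =>
    cases hg with
    | cup h' =>
      exact pull_comm (isLocal_cap _ _ _) (isLocal_cup _ _ _)
        (locallyCommute_cup_cap _ _ _ _ _ _).symm l m r φ st hst
    | cap h' =>
      exact pull_comm (isLocal_cap _ _ _) (isLocal_cap _ _ _)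
        (locallyCommute_cap_cap _ _ _ _ h h' _ _) l m r φ st hst
    | crossing s t =>
      exact pull_comm (isLocal_cap _ _ _) (isLocal_cross _ _)
        (locallyCommute_cross_cap _ _ _ _ _).symm l m r φ st hst
    | bead s x =>
      exact pull_comm (isLocal_cap _ _ _) (isLocal_bead _ _)
        (locallyCommute_bead_cap _ _ _ h _ _).symm l m r φ st hst
  | crossing s' t' =>
    cases hg with
    | cup h' =>
      exact pull_comm (isLocal_cross _ _) (isLocal_cup _ _ _)
        (locallyCommute_cross_cup _ _ _ _ _) l m r φ st hst
    | cap h' =>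
      exact pull_comm (isLocal_cross _ _) (isLocal_cap _ _ _)
        (locallyCommute_cross_cap _ _ _ _ _) l m r φ st hst
    | crossing s t =>
      exact pull_comm (isLocal_cross _ _) (isLocal_cross _ _)
        (locallyCommute_cross_cross _ _ _ _) l m r φ st hst
    | bead s x =>
      exact pull_comm (isLocal_cross _ _) (isLocal_bead _ _)
        (locallyCommute_cross_bead _ _ _ _) l m r φ st hst
  | bead s' x' =>
    cases hg with
    | cup h' =>
      exact pull_comm (isLocal_bead _ _) (isLocal_cup _ _ _)
        (locallyCommute_bead_cup _ _ _ _ _) l m r φ st hst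
    | cap h' =>
      exact pull_comm (isLocal_bead _ _) (isLocal_cap _ _ _)
        (locallyCommute_bead_cap _ _ _ h' _ _) l m r φ st hst
    | crossing s t =>
      exact pull_comm (isLocal_bead _ _) (isLocal_cross _ _)
        (locallyCommute_cross_bead _ _ _ _).symm l m r φ st hst
    | bead s x =>
      exact pull_comm (isLocal_bead _ _) (isLocal_bead _ _)
        (locallyCommute_bead_bead _ _ _ _) l m r φ st hst

/-- The elementary piece is moved past the constituents of `g` one at a time. Multilinearity is
carried along because the function seen at an inner stage is `φ` pulled back along the later
constituents. -/
theorem act_comm_of_isElementary {a b c d : List Dir} {f : BeadDiagram k A a b}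
    (hf : IsElementary f) (g : BeadDiagram k A c d)
    (l m r : List Dir) {φ : StrandState k A → N} (hφ : Multilinear (l ++ b ++ m ++ d ++ r) φ)
    (st : StrandState k A) (hst : Admissible (l ++ a ++ m ++ c ++ r) st.1) :
    act U D f l.length (act U D g (l.length + b.length + m.length) φ) st =
      act U D g (l.length + a.length + m.length) (act U D f l.length φ) st := by
  induction g generalizing m r φ st with
  | id a => rfl
  | @comp c₁ c₂ c₃ g₁ g₂ ih₁ ih₂ =>
    have h₁ := Multilinear.act (U := U) (D := D) g₂ (l ++ b ++ m) r hφ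
    simp only [List.length_append] at h₁
    refine (ih₁ m r h₁ st hst).trans ?_
    have := act_congr (U := U) (D := D) g₁ (l ++ a ++ m) r (fun st hst => ih₂ m r hφ st hst) st hst
    simpa only [List.length_append, act, LinearMap.comp_apply] using this
  | @tensor c₁ d₁ c₂ d₂ g₁ g₂ ih₁ ih₂ =>
    have h₁ := Multilinear.act (U := U) (D := D) g₂ (l ++ b ++ m ++ d₁) r (φ := φ)
      (by simpa using hφ)
    have e₁ := ih₁ m (c₂ ++ r) (φ := act U D g₂ (l ++ b ++ m ++ d₁).length φ) (by simpa using h₁)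
      st (by simpa using hst)
    have e₂ := act_congr (U := U) (D := D) g₁ (l ++ a ++ m) (c₂ ++ r)
      (fun st hst => ih₂ (m ++ d₁) r (φ := φ) (by simpa using hφ) st (by simpa using hst)) st
      (by simpa using hst)
    simp only [List.length_append, ← Nat.add_assoc] at e₁ e₂
    simp only [act, LinearMap.comp_apply]
    exact e₁.trans e₂
  | zero => simp [act]
  | add g₁ g₂ ih₁ ih₂ =>
    simp only [act, LinearMap.add_apply, Pi.add_apply, map_add] at ih₁ ih₂ ⊢
    rw [ih₁ m r hφ st hst, ih₂ m r hφ st hst]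
  | smul x g ih =>
    simp only [act, LinearMap.smul_apply, Pi.smul_apply, map_smul] at ih ⊢
    rw [ih m r hφ st hst]
  | cup h => exact act_comm_elementary hf (.cup h) l m r hφ st hst
  | cap h => exact act_comm_elementary hf (.cap h) l m r hφ st hst
  | crossing s t => exact act_comm_elementary hf (.crossing s t) l m r hφ st hst
  | bead s x => exact act_comm_elementary hf (.bead s x) l m r hφ st hst

/-- Decorated flat tangles that are attached next to each other can be attached in any order. -/
theorem act_comm {a b c d : List Dir} (f : BeadDiagram k A a b) (g : BeadDiagram k A c d)
    (l m r : List Dir) {φ : StrandState k A → N} (hφ : Multilinear (l ++ b ++ m ++ d ++ r) φ)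
    (st : StrandState k A) (hst : Admissible (l ++ a ++ m ++ c ++ r) st.1) :
    act U D f l.length (act U D g (l.length + b.length + m.length) φ) st =
      act U D g (l.length + a.length + m.length) (act U D f l.length φ) st := by
  induction f generalizing c d l m r φ st with
  | id a => rfl
  | @comp a₁ a₂ a₃ f₁ f₂ ih₁ ih₂ =>
    have h₁ : Multilinear (l ++ a₂ ++ m ++ d ++ r) (act U D f₂ l.length φ) := by
      simpa using Multilinear.act (U := U) (D := D) f₂ l (m ++ d ++ r) (by simpa using hφ)
    refine Eq.trans ?_ (ih₁ g l m r h₁ st hst)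
    exact act_congr f₁ l (m ++ c ++ r) (fun st hst => ih₂ g l m r hφ st (by simpa using hst)) st
      (by simpa using hst)
  | @tensor a₁ b₁ a₂ b₂ f₁ f₂ ih₁ ih₂ =>
    have h₁ := Multilinear.act (U := U) (D := D) f₂ (l ++ b₁) (m ++ d ++ r) (φ := φ)
      (by simpa using hφ)
    have e₁ := ih₁ g l (a₂ ++ m) r (φ := act U D f₂ (l ++ b₁).length φ) (by simpa using h₁) st
      (by simpa using hst)
    have e₂ := ih₂ g (l ++ b₁) m r (φ := φ) (by simpa using hφ)
    simp only [List.length_append, ← Nat.add_assoc] at e₁ e₂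
    simp only [act, List.length_append, LinearMap.comp_apply, ← Nat.add_assoc]
    refine Eq.trans ?_ e₁
    exact act_congr f₁ l (a₂ ++ m ++ c ++ r) (fun st hst => e₂ st (by simpa using hst)) st
      (by simpa using hst)
  | zero => simp [act]
  | add f₁ f₂ ih₁ ih₂ =>
    simp only [act, LinearMap.add_apply, Pi.add_apply, map_add] at ih₁ ih₂ ⊢
    rw [ih₁ g l m r hφ st hst, ih₂ g l m r hφ st hst]
  | smul x f ih =>
    simp only [act, LinearMap.smul_apply, Pi.smul_apply, map_smul] at ih ⊢
    rw [ih g l m r hφ st hst]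
  | cup h => exact act_comm_of_isElementary (.cup h) g l m r hφ st hst
  | cap h => exact act_comm_of_isElementary (.cap h) g l m r hφ st hst
  | crossing s t => exact act_comm_of_isElementary (.crossing s t) g l m r hφ st hst
  | bead s x => exact act_comm_of_isElementary (.bead s x) g l m r hφ st hst

end

end StrandState

namespace StrandState

section

variable {k A N : Type*} [CommRing k] [Ring A] [Algebra k A] [AddCommGroup N] [Module k N]

/-! ### Invariance -/

/-! ### Values of the elementary pullbacks on explicit configurations -/

section Evaluation

variable {o : ℕ} {p q : List (Dir × ℕ)} (lam : ℕ → Module.End k A) (φ : StrandState k A → N)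

theorem pull_cross (h : p.length = o) (x y : Dir × ℕ) :
    pull (stepCross o) φ (p ++ x :: y :: q, lam) = φ (p ++ y :: x :: q, lam) :=
  pull_some (stepCross_eq h x y) φ

theorem pull_cross_succ (h : p.length = o) (a x y : Dir × ℕ) :
    pull (stepCross (o + 1)) φ (p ++ a :: x :: y :: q, lam) = φ (p ++ a :: y :: x :: q, lam) := by
  simpa using pull_cross (p := p ++ [a]) (q := q) lam φ (by simpa using h) x y

theorem pull_bead (h : p.length = o) (s s' : Dir) (x : A) (n : ℕ) :
    pull (stepBead s x o) φ (p ++ (s', n) :: q, lam) =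
      φ (p ++ (s', n) :: q, Function.update lam n (beadAct s x (lam n))) :=
  pull_some (stepBead_eq h s s' x n) φ

theorem pull_bead_succ (h : p.length = o) (s s' : Dir) (x : A) (a : Dir × ℕ) (n : ℕ) :
    pull (stepBead s x (o + 1)) φ (p ++ a :: (s', n) :: q, lam) =
      φ (p ++ a :: (s', n) :: q, Function.update lam n (beadAct s x (lam n))) := by
  simpa using pull_bead (p := p ++ [a]) (q := q) lam φ (by simpa using h) s s' x n

theorem pull_cup (h : p.length = o) (s t : Dir) (c : Module.End k A) :
    pull (stepCup s t c o) φ (p ++ q, lam) = φ (reindex Nat.succ p ++ (s, 0) :: (t, 0) ::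
      reindex Nat.succ q, fun n => Nat.casesOn n c lam) :=
  pull_some (stepCup_eq h s t c) φ

theorem pull_cup_succ (h : p.length = o) (s t u : Dir) (n : ℕ) (c : Module.End k A) :
    pull (stepCup s t c (o + 1)) φ (p ++ (u, n) :: q, lam) =
      φ (reindex Nat.succ p ++ (u, n + 1) :: (s, 0) :: (t, 0) :: reindex Nat.succ q,
        fun n => Nat.casesOn n c lam) := by
  simpa using pull_cup (p := p ++ [(u, n)]) (q := q) lam φ (by simpa using h) s t c

theorem pull_cap_up (h : p.length = o) (s t : Dir) (x y : ℕ) (d : Module.End k A) :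
    pull (stepCap .up d o) φ (p ++ (s, x) :: (t, y) :: q, lam) =
      if x = y then 0 else
        φ (reindex (joinName x y) p ++ reindex (joinName x y) q, joinLabel x y d lam) := by
  have := stepCap_up_eq (q := q) (lam := lam) h s t x y d
  split_ifs at this ⊢
  · exact pull_none this φ
  · exact pull_some this φ

theorem pull_cap_up_succ (h : p.length = o) (s t u : Dir) (n x y : ℕ) (d : Module.End k A) :
    pull (stepCap .up d (o + 1)) φ (p ++ (u, n) :: (s, x) :: (t, y) :: q, lam) =
      if x = y then 0 else φ (reindex (joinName x y) p ++ (u, joinName x y n) ::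
        reindex (joinName x y) q, joinLabel x y d lam) := by
  simpa using pull_cap_up (p := p ++ [(u, n)]) (q := q) lam φ (by simpa using h) s t x y d

theorem pull_cap_down (h : p.length = o) (s t : Dir) (x y : ℕ) (d : Module.End k A) :
    pull (stepCap .down d o) φ (p ++ (s, y) :: (t, x) :: q, lam) =
      if x = y then 0 else
        φ (reindex (joinName x y) p ++ reindex (joinName x y) q, joinLabel x y d lam) := by
  have := stepCap_down_eq (q := q) (lam := lam) h s t x y d
  split_ifs at this ⊢
  · exact pull_none this φ
  · exact pull_some this φ

theorem pull_cap_down_succ (h : p.length = o) (s t u : Dir) (n x y : ℕ) (d : Module.End k A) :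
    pull (stepCap .down d (o + 1)) φ (p ++ (u, n) :: (s, y) :: (t, x) :: q, lam) =
      if x = y then 0 else φ (reindex (joinName x y) p ++ (u, joinName x y n) ::
        reindex (joinName x y) q, joinLabel x y d lam) := by
  simpa using pull_cap_down (p := p ++ [(u, n)]) (q := q) lam φ (by simpa using h) s t x y d

end Evaluation

variable {U D : A ≃ₐ[k] A}

/-- A zigzag traversed so that the new string `0` follows the old one multiplies the old label by `c
* d` on the left. As this is `1`, only the shift of names is left. -/
theorem renaming_append (p : List (Dir × ℕ)) (lam : ℕ → Module.End k A) (n : ℕ)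
    {c d : Module.End k A} (hcd : c * d = 1) :
    Renaming Nat.succ (p, lam) (reindex (joinName (n + 1) 0) (reindex Nat.succ p),
      joinLabel (n + 1) 0 d fun n => Nat.casesOn n c lam) := by
  refine ⟨?_, fun _ _ _ _ _ _ e => Nat.succ.inj e, fun s m hm => ?_⟩
  · rw [reindex_reindex]
    exact reindex_congr fun s m _ => by simp [joinName]
  · by_cases e : m = n
    · subst e
      simp [joinLabel, hcd]
    · simp [joinLabel, e]

/-- Here the new string comes first. The joined string inherits the name `0`, and its label is the
old one times `d * c`. -/
theorem renaming_prepend (p : List (Dir × ℕ)) (lam : ℕ → Module.End k A) (n : ℕ)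
    {c d : Module.End k A} (hdc : d * c = 1) :
    Renaming (joinName 0 (n + 1) ∘ Nat.succ) (p, lam)
      (reindex (joinName 0 (n + 1)) (reindex Nat.succ p),
        joinLabel 0 (n + 1) d fun n => Nat.casesOn n c lam) := by
  refine ⟨by rw [reindex_reindex], fun _ _ m m' _ _ e => ?_, fun s m hm => ?_⟩
  · simp only [joinName, Function.comp_apply, Nat.succ_eq_add_one, Nat.add_right_cancel_iff] at e
    split_ifs at e <;> omega
  · by_cases e : m = n
    · subst e
      simp [joinLabel, joinName, mul_assoc, hdc]
    · simp [joinLabel, joinName, e]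

/-- The minimum and the maximum of a zigzag turn in opposite senses, and the automorphisms attached
to them are mutually inverse. -/
theorem cupTurn_mul_capTurn {s t : Dir} (h : s ≠ t) : cupTurn U D s * capTurn U D t = 1 := by
  cases s <;> cases t <;> simp only [ne_eq, not_true_eq_false] at h <;> ext x <;>
    simp [cupTurn, capTurn]

theorem capTurn_mul_cupTurn {s t : Dir} (h : s ≠ t) : capTurn U D t * cupTurn U D s = 1 := by
  cases s <;> cases t <;> simp only [ne_eq, not_true_eq_false] at h <;> ext x <;>
    simp [cupTurn, capTurn]

/-- An algebra automorphism `T` satisfies `T (a * x) = T a * T x`, hence moving right multiplication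
by `x` past `T` replaces `x` by `T x`. This forces the choice of `capTurn`; the two cases differ in
which leg is traversed first. -/
theorem beadAct_turn_right {s t : Dir} (h : s ≠ t) (x : A) (a b : Module.End k A) :
    (s = .up → beadAct t x b * capTurn U D s * a =
      b * capTurn U D s * beadAct s (turn U D s x) a) ∧
    (s = .down → a * capTurn U D s * beadAct t x b =
      beadAct s (turn U D s x) a * capTurn U D s * b) := by
  cases s <;> cases t <;> simp only [ne_eq, not_true_eq_false] at h <;> constructor <;>
    simp only [reduceCtorEq, false_imp_iff, forall_const] <;> ext y <;>
    simp [beadAct, capTurn, turn]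

/-- After the joining, the labels of `i` and `j` are visible only through their product with `d`. -/
theorem joinLabel_update_eq {i j : ℕ} (hij : i ≠ j) {d e e' : Module.End k A}
    {lam : ℕ → Module.End k A} (h : e * d * lam i = lam j * d * e') :
    joinLabel i j d (Function.update lam j e) = joinLabel i j d (Function.update lam i e') := by
  funext n
  by_cases hi : n = i
  · subst hi
    simp [joinLabel, Function.update_of_ne hij, Function.update_of_ne hij.symm, h]
  · by_cases hj : n = j
    · subst hj
      simp [joinLabel, hi]
    · simp [joinLabel, hi, hj]

theorem beadAct_cupTurn {s t : Dir} (h : s ≠ t) (x : A) :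
    (beadAct s x (cupTurn U D s) : Module.End k A) =
      beadAct t (turn U D t x) (cupTurn U D s) := by
  cases s <;> cases t <;> simp only [ne_eq, not_true_eq_false] at h <;> ext y <;>
    simp [beadAct, cupTurn, turn]

theorem exists_triple_split {L : List Dir} {p : List (Dir × ℕ)} {l r : List Dir} {s t u : Dir}
    (h : Admissible L p) (hL : L = l ++ [s, t, u] ++ r) : ∃ p₁ x y z p₂,
    p = p₁ ++ (s, x) :: (t, y) :: (u, z) :: p₂ ∧ p₁.length = l.length := by
  subst hL
  obtain ⟨p₁, x, y, p', rfl, h₁, -, h'⟩ := Admissible.exists_pair (l := l) (r := u :: r)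
    (by simpa using h)
  obtain ⟨z, p₂, rfl, -⟩ := exists_cons h'
  exact ⟨p₁, x, y, z, p₂, rfl, h₁⟩

theorem exists_single_split {p : List (Dir × ℕ)} {l r : List Dir} {s : Dir}
    (h : Admissible (l ++ [s] ++ r) p) : ∃ p₁ x p₂, p = p₁ ++ (s, x) :: p₂ ∧
      p₁.length = l.length := by
  have := h.signs
  rw [List.append_assoc] at this
  obtain ⟨p₁, p', rfl, -, h', h₁⟩ := exists_split this
  obtain ⟨z, p₂, rfl, -⟩ := exists_cons h'
  exact ⟨p₁, z, p₂, rfl, h₁⟩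

theorem exists_empty_split {p : List (Dir × ℕ)} {l r : List Dir}
    (h : Admissible (l ++ [] ++ r) p) : ∃ p₁ p₂, p = p₁ ++ p₂ ∧ p₁.length = l.length := by
  have := h.signs
  rw [List.append_assoc] at this
  obtain ⟨p₁, p', rfl, -, h', h₁⟩ := exists_split this
  exact ⟨p₁, p', rfl, h₁⟩

/-- Moves II and III and the switchbacks lead to literally equal configurations, since a flat
crossing merely permutes ends. The zigzags lead to configurations that differ by a renaming of
strings. -/
theorem act_flatMove {a b : List Dir} {f g : BeadDiagram k A a b}
    (h : BeadDiagram.FlatMove k A f g) (l r : List Dir) {φ : StrandState k A → N}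
    (hφ : Multilinear (l ++ b ++ r) φ) (st : StrandState k A)
    (hst : Admissible (l ++ a ++ r) st.1) :
    act U D f l.length φ st = act U D g l.length φ st := by
  obtain ⟨p, lam⟩ := st
  cases h with
  | @zigzag_left s t h =>
    obtain ⟨p₁, n, p₂, rfl, hl⟩ := exists_single_split hst
    have h₁ := hφ.rename _ _ _ hst (renaming_append _ lam n (cupTurn_mul_capTurn (U := U) (D := D) h))
    have h₂ := hφ.rename _ _ _ hst (renaming_prepend _ lam n (capTurn_mul_cupTurn (U := U) (D := D) h))
    have hl' : (reindex Nat.succ p₁).length = l.length := by simpa using hl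
    simp only [act, LinearMap.comp_apply, LinearMap.id_apply, List.length_singleton,
      pull_cup _ _ hl, reindex_cons, Nat.succ_eq_add_one]
    cases s <;> cases t <;> simp only [ne_eq, not_true_eq_false] at h
    · rw [pull_cap_down_succ _ _ hl', if_neg (by simp), ← h₁]
      simp [joinName]
    · rw [pull_cap_up_succ _ _ hl', if_neg (by simp), ← h₂]
      simp [joinName]
  | @zigzag_right s t h =>
    obtain ⟨p₁, n, p₂, rfl, hl⟩ := exists_single_split hst
    have h₁ := hφ.rename _ _ _ hst
      (renaming_append _ lam n (cupTurn_mul_capTurn (U := U) (D := D) h.symm))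
    have h₂ := hφ.rename _ _ _ hst
      (renaming_prepend _ lam n (capTurn_mul_cupTurn (U := U) (D := D) h.symm))
    have hl' : (reindex Nat.succ p₁).length = l.length := by simpa using hl
    simp only [act, LinearMap.comp_apply, LinearMap.id_apply, List.length_singleton,
      pull_cup_succ _ _ hl]
    cases s <;> cases t <;> simp only [ne_eq, not_true_eq_false] at h
    · rw [pull_cap_up _ _ hl', if_neg (by simp), ← h₁]
      simp [joinName]
    · rw [pull_cap_down _ _ hl', if_neg (by simp), ← h₂]
      simp [joinName]
  | two s t =>
    obtain ⟨p₁, x, y, p₂, rfl, hl, -, -⟩ := hst.exists_pair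
    simp only [act, LinearMap.comp_apply, LinearMap.id_apply, pull_cross _ _ hl]
  | three s t u =>
    obtain ⟨p₁, x, y, z, p₂, rfl, hl⟩ := exists_triple_split hst rfl
    simp only [act, LinearMap.comp_apply, LinearMap.id_apply, List.length_singleton,
      pull_cross _ _ hl, pull_cross_succ _ _ hl]
  | @switchback_cap s t h u =>
    obtain ⟨p₁, x, y, z, p₂, rfl, hl⟩ := exists_triple_split hst rfl
    simp only [act, LinearMap.comp_apply, LinearMap.id_apply, List.length_singleton,
      pull_cross _ _ hl, pull_cross_succ _ _ hl]
    cases s <;> simp only [pull_cap_up _ _ hl, pull_cap_up_succ _ _ hl, pull_cap_down _ _ hl,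
      pull_cap_down_succ _ _ hl, reindex_cons]
  | @switchback_cup s t h u =>
    obtain ⟨p₁, n, p₂, rfl, hl⟩ := exists_single_split hst
    have hl' : (reindex Nat.succ p₁).length = l.length := by simpa using hl
    simp only [act, LinearMap.comp_apply, LinearMap.id_apply, List.length_singleton,
      pull_cup_succ _ _ hl, pull_cup _ _ hl, pull_cross _ _ hl',
      pull_cross_succ _ _ hl', reindex_cons]

theorem act_beadMove {a b : List Dir} {f g : BeadDiagram k A a b}
    (h : BeadDiagram.BeadMove U D f g) (l r : List Dir) {φ : StrandState k A → N}
    (hφ : Multilinear (l ++ b ++ r) φ) (st : StrandState k A)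
    (hst : Admissible (l ++ a ++ r) st.1) :
    act U D f l.length φ st = act U D g l.length φ st := by
  obtain ⟨p, lam⟩ := st
  cases h with
  | one s =>
    obtain ⟨p₁, n, p₂, rfl, hl⟩ := exists_single_split hst
    have : beadAct s (1 : A) (lam n) = lam n := by cases s <;> ext <;> simp [beadAct]
    simp only [act, LinearMap.id_apply, pull_bead _ _ hl, this, Function.update_eq_self]
  | mul_up x y =>
    obtain ⟨p₁, n, p₂, rfl, hl⟩ := exists_single_split hst
    have : beadAct .up y (beadAct .up x (lam n)) = beadAct .up (x * y) (lam n) := by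
      ext; simp [beadAct, mul_assoc]
    simp only [act, LinearMap.comp_apply, pull_bead _ _ hl, Function.update_self,
      Function.update_idem, this]
  | mul_down x y =>
    obtain ⟨p₁, n, p₂, rfl, hl⟩ := exists_single_split hst
    have : beadAct .down y (beadAct .down x (lam n)) = beadAct .down (y * x) (lam n) := by
      ext; simp [beadAct, mul_assoc]
    simp only [act, LinearMap.comp_apply, pull_bead _ _ hl, Function.update_self,
      Function.update_idem, this]
  | add s x y =>
    obtain ⟨p₁, n, p₂, rfl, hl⟩ := exists_single_split hst
    have : beadAct s (x + y) (lam n) = beadAct s x (lam n) + beadAct s y (lam n) := by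
      cases s <;> ext <;> simp [beadAct, mul_add]
    -- Configurations cannot be added; additivity of beads is expressed by linearity of `φ` in the
    -- label of this string.
    obtain ⟨g, hg⟩ := hφ.linear _ lam n hst (hst.up_mem' (s := s) (by simp))
    simp only [act, LinearMap.add_apply, Pi.add_apply, pull_bead _ _ hl, this, hg, map_add]
  | smul s c x =>
    obtain ⟨p₁, n, p₂, rfl, hl⟩ := exists_single_split hst
    have : beadAct s (c • x) (lam n) = c • beadAct s x (lam n) := by
      cases s <;> ext <;> simp [beadAct]
    obtain ⟨g, hg⟩ := hφ.linear _ lam n hst (hst.up_mem' (s := s) (by simp))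
    simp only [act, LinearMap.smul_apply, Pi.smul_apply, pull_bead _ _ hl, this, hg, map_smul]
  | slide_left s t x =>
    obtain ⟨p₁, m, n, p₂, rfl, hl, -, -⟩ := hst.exists_pair
    simp only [act, LinearMap.comp_apply, LinearMap.id_apply, List.length_singleton,
      pull_cross _ _ hl, pull_bead _ _ hl, pull_bead_succ _ _ hl]
  | slide_right s t x =>
    obtain ⟨p₁, m, n, p₂, rfl, hl, -, -⟩ := hst.exists_pair
    simp only [act, LinearMap.comp_apply, LinearMap.id_apply, List.length_singleton,
      pull_cross _ _ hl, pull_bead _ _ hl, pull_bead_succ _ _ hl]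
  | @cap s t h x =>
    obtain ⟨p₁, m, n, p₂, rfl, hl, -, -⟩ := hst.exists_pair
    have key := beadAct_turn_right (U := U) (D := D) h x (lam m) (lam n)
    simp only [act, LinearMap.comp_apply, LinearMap.id_apply, List.length_singleton,
      pull_bead _ _ hl, pull_bead_succ _ _ hl]
    cases s
    · rw [pull_cap_up _ _ hl, pull_cap_up _ _ hl]
      split_ifs with e
      · rfl
      · rw [joinLabel_update_eq e (key.1 rfl)]
    · rw [pull_cap_down _ _ hl, pull_cap_down _ _ hl]
      split_ifs with e
      · rfl
      · rw [joinLabel_update_eq e (key.2 rfl).symm]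
  | @cup s t h x =>
    obtain ⟨p₁, p₂, rfl, hl⟩ := exists_empty_split hst
    have hl' : (reindex Nat.succ p₁).length = l.length := by simpa using hl
    simp only [act, LinearMap.comp_apply, LinearMap.id_apply, List.length_singleton,
      pull_cup _ _ hl, pull_bead _ _ hl', pull_bead_succ _ _ hl']
    exact congrArg (fun e => φ (_, Function.update _ 0 e)) (beadAct_cupTurn h x)

/-- Soundness of the model. Arbitrary ends `l` and `r` on both sides have to be allowed, because
juxtaposition places each factor next to the ends of the other. -/
theorem act_equivalent {a b : List Dir} {f g : BeadDiagram k A a b}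
    (h : BeadDiagram.Equivalent U D f g) (l r : List Dir) {φ : StrandState k A → N}
    (hφ : Multilinear (l ++ b ++ r) φ) (st : StrandState k A)
    (hst : Admissible (l ++ a ++ r) st.1) :
    act U D f l.length φ st = act U D g l.length φ st := by
  induction h generalizing l r φ st with
  | refl f => rfl
  | symm _ ih => exact (ih l r hφ st hst).symm
  | trans _ _ ih₁ ih₂ => exact (ih₁ l r hφ st hst).trans (ih₂ l r hφ st hst)
  | @comp_congr a b c f f' g g' _ _ ih₁ ih₂ =>
    exact (ih₁ l r (hφ.act g l r) st hst).trans
      (act_congr f' l r (fun st hst => ih₂ l r hφ st hst) st hst)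
  | @tensor_congr a b c d f f' g g' _ _ ih₁ ih₂ =>
    have h₁ := Multilinear.act (U := U) (D := D) g (l ++ b) r (φ := φ) (by simpa using hφ)
    have e₁ := ih₁ l (c ++ r) (by simpa using h₁) st (by simpa using hst)
    have e₂ := act_congr (U := U) (D := D) f' l (c ++ r)
      (fun st hst => ih₂ (l ++ b) r (φ := φ) (by simpa using hφ) st (by simpa using hst)) st
      (by simpa using hst)
    simp only [List.length_append] at e₁ e₂
    exact e₁.trans e₂
  | add_congr _ _ ih₁ ih₂ => exact congrArg₂ (· + ·) (ih₁ l r hφ st hst) (ih₂ l r hφ st hst)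
  | smul_congr c _ ih => exact congrArg (c • ·) (ih l r hφ st hst)
  | tensor_nil f => rw [act_cast]; rfl
  | tensor_assoc f g h =>
    rw [act_cast]
    simp [act, Nat.add_assoc]
  | @interchange a b c a' b' c' f g f' g' =>
    -- The interchange law amounts to exchanging the inner factors `g` and `f'`, which are attached
    -- to neighbouring groups of ends, hence the empty middle list.
    have h₁ := Multilinear.act (U := U) (D := D) g' (l ++ c) r (φ := φ) (by simpa using hφ)
    have := act_congr (U := U) (D := D) f l (a' ++ r) (fun st hst => act_comm (U := U) (D := D) g f' l [] r
      (φ := act U D g' (l ++ c).length φ) (by simpa using h₁) st (by simpa using hst)) st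
      (by simpa using hst)
    simpa [act] using this
  | flat h => exact act_flatMove h l r hφ st hst
  | bead h => exact act_beadMove h l r hφ st hst
  | zero_smul f => simp [act]
  | add_assoc f g h => simp [act, _root_.add_assoc]
  | add_comm f g => simp [act, _root_.add_comm]
  | add_smul c d f => simp [act, _root_.add_smul]
  | mul_smul c d f => simp [act, smul_smul]
  | _ => simp [act]

end

end StrandState

namespace StrandState

section

variable {k A : Type*} [CommRing k] [Ring A] [Algebra k A]

/-! ### Reading off the beads -/

/-- The strings that end at an end of sign `+`. -/
def ups : List (Dir × ℕ) → List ℕ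
  | [] => []
  | (.up, n) :: p => n :: ups p
  | (.down, _) :: p => ups p

theorem mem_ups {n : ℕ} {p : List (Dir × ℕ)} : n ∈ ups p ↔ (Dir.up, n) ∈ p := by
  induction p with
  | nil => simp [ups]
  | cons a p ih => rcases a with ⟨_ | _, m⟩ <;> simp [ups, ih]

theorem ups_reindex (f : ℕ → ℕ) (p : List (Dir × ℕ)) : ups (reindex f p) = (ups p).map f := by
  induction p with
  | nil => rfl
  | cons a p ih => rcases a with ⟨_ | _, m⟩ <;> simp [ups, ih]

theorem nodup_ups {p : List (Dir × ℕ)} (h : p.Nodup) : (ups p).Nodup := by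
  induction p with
  | nil => exact List.nodup_nil
  | cons a p ih =>
    have ⟨h₁, h₂⟩ := List.nodup_cons.1 h
    rcases a with ⟨_ | _, m⟩
    · exact List.nodup_cons.2 ⟨fun hm => h₁ (mem_ups.1 hm), ih h₂⟩
    · exact ih h₂

/-- The beads on the strings of a configuration of two strings. -/
noncomputable def readout (st : StrandState k A) : A ⊗[k] A :=
  match ups st.1 with
  | [m, n] => st.2 m 1 ⊗ₜ st.2 n 1
  | _ => 0

theorem readout_eq {st : StrandState k A} {m n : ℕ} (h : ups st.1 = [m, n]) :
    readout st = st.2 m 1 ⊗ₜ[k] st.2 n 1 := by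
  simp [readout, h]

/-- The two rising ends belong to different strings, so varying one label changes only one tensor
factor. -/
theorem multilinear_readout (L : List Dir) :
    Multilinear L (readout : StrandState k A → A ⊗[k] A) := by
  refine ⟨fun f st st' hst h => ?_, fun p lam i hp hi => ?_⟩
  · have e : ups st'.1 = (ups st.1).map f := by rw [h.ends, ups_reindex]
    rcases e' : ups st.1 with _ | ⟨m, _ | ⟨n, _ | ⟨_, _⟩⟩⟩ <;> rw [e'] at e
    · simp [readout, e, e']
    · simp [readout, e, e']
    · rw [readout_eq e, readout_eq e', h.label .up m (mem_ups.1 (by simp [e'])),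
        h.label .up n (mem_ups.1 (by simp [e']))]
    · simp [readout, e, e']
  · have hd := nodup_ups hp.nodup
    have hi := mem_ups.2 hi
    rcases e' : ups p with _ | ⟨m, _ | ⟨n, _ | ⟨_, _⟩⟩⟩ <;> rw [e'] at hd hi
    · simp at hi
    · exact ⟨0, fun e => by simp [readout, e']⟩
    · simp only [List.mem_cons, List.not_mem_nil, or_false, List.nodup_cons,
        not_false_eq_true, List.nodup_nil, and_self, and_true] at hi hd
      rcases hi with rfl | rfl
      · refine ⟨(TensorProduct.mk k A A).flip (lam n 1) ∘ₗ LinearMap.applyₗ 1, fun e => ?_⟩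
        rw [readout_eq e']
        simp [Function.update_of_ne (Ne.symm hd)]
      · refine ⟨TensorProduct.mk k A A (lam m 1) ∘ₗ LinearMap.applyₗ 1, fun e => ?_⟩
        rw [readout_eq e']
        simp [Function.update_of_ne hd]
    · exact ⟨0, fun e => by simp [readout, e']⟩

variable {U D : A ≃ₐ[k] A}

/-- The beads that are read off after a morphism has been attached to a configuration. -/
noncomputable def eval {a b : List Dir} (r : List Dir) (st : StrandState k A)
    (hst : Admissible (a ++ r) st.1) : BeadHom U D a b →ₗ[k] A ⊗[k] A where
  toFun f := Quot.lift (fun d : BeadDiagram k A a b => act U D d 0 readout st)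
    (fun _ _ h => act_equivalent h [] r (multilinear_readout _) st hst) f
  map_add' := by
    rintro ⟨f⟩ ⟨g⟩
    change act U D (f.add g) 0 readout st = _
    simp only [act]
    rfl
  map_smul' := by
    rintro c ⟨f⟩
    change act U D (f.smul c) 0 readout st = _
    simp only [act]
    rfl

theorem eval_mk {a b : List Dir} (r : List Dir) (st : StrandState k A)
    (hst : Admissible (a ++ r) st.1) (d : BeadDiagram k A a b) :
    eval (U := U) (D := D) r st hst (Quot.mk _ d) = act U D d 0 readout st := rfl

end

end StrandState

/-! ### Faithfulness on two antiparallel strings -/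

section

variable {k A : Type*} [CommRing k] [Ring A] [Algebra k A] {U D : A ≃ₐ[k] A}

open StrandState

/-- The additional rising end on the right is the head of the falling string `0`, so that its bead
can be read off. The rising ends are then met in the order `1`, `0`, which explains the flip. -/
theorem beads_down_up_injective : Function.Injective (beads (k := k) U D .down .up) := by
  have hst : Admissible ([.down, .up] ++ [.up]) [(Dir.down, 0), (Dir.up, 1), (Dir.up, 0)] :=
    ⟨rfl, by simp, by simp⟩
  have key : (TensorProduct.comm k A A).toLinearMap ∘ₗ
      (eval [.up] (_, fun _ => 1) hst ∘ₗ beads (k := k) U D .down .up) = LinearMap.id := by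
    ext x y
    change TensorProduct.comm k A A (act U D (.tensor (.bead .down x) (.bead .up y)) 0 readout
      ([(Dir.down, 0), (Dir.up, 1), (Dir.up, 0)], fun _ => 1)) = x ⊗ₜ y
    simp [act, pull, stepBead, readout, ups, beadAct]
  intro v w h
  have := congrArg (fun f => TensorProduct.comm k A A (eval [.up] (_, fun _ => 1) hst f)) h
  exact (LinearMap.congr_fun key v).symm.trans (this.trans (LinearMap.congr_fun key w))

/-- With the head of the falling string added on the right, the rising ends are met in the order
`0`, `1`, and no flip is needed. -/
theorem beads_up_down_injective : Function.Injective (beads (k := k) U D .up .down) := by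
  have hst : Admissible ([.up, .down] ++ [.up]) [(Dir.up, 0), (Dir.down, 1), (Dir.up, 1)] :=
    ⟨rfl, by simp, by simp⟩
  have key : eval [.up] (_, fun _ => 1) hst ∘ₗ beads (k := k) U D .up .down = LinearMap.id := by
    ext x y
    change act U D (.tensor (.bead .up x) (.bead .down y)) 0 readout
      ([(Dir.up, 0), (Dir.down, 1), (Dir.up, 1)], fun _ => 1) = x ⊗ₜ y
    simp [act, pull, stepBead, readout, ups, beadAct]
  intro v w h
  have := congrArg (eval [.up] (_, fun _ => 1) hst) h
  exact (LinearMap.congr_fun key v).symm.trans (this.trans (LinearMap.congr_fun key w))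

end

/-! ## Calculus of decorated flat tangles -/

namespace BeadHom

section

variable {k A : Type*} [CommRing k] [Ring A] [Algebra k A] {U D : A ≃ₐ[k] A}

/-- Vertical strings. -/
def ident (a : List Dir) : BeadHom U D a a := Quot.mk _ (.id a)

/-- A vertical string with a bead. -/
def bead (s : Dir) (x : A) : BeadHom U D [s] [s] := Quot.mk _ (.bead s x)

/-- A minimum. -/
def cup {s t : Dir} (h : s ≠ t) : BeadHom U D [] [s, t] := Quot.mk _ (.cup h)

/-- A maximum. -/
def cap {s t : Dir} (h : s ≠ t) : BeadHom U D [s, t] [] := Quot.mk _ (.cap h)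

/-- A flat crossing. -/
def cross (s t : Dir) : BeadHom U D [s, t] [t, s] := Quot.mk _ (.crossing s t)

variable {a b c d a' b' c' : List Dir}

theorem ident_comp (f : BeadHom U D a b) : (ident a).comp f = f := by
  obtain ⟨f⟩ := f; exact Quot.sound (.id_comp f)

theorem comp_ident (f : BeadHom U D a b) : f.comp (ident b) = f := by
  obtain ⟨f⟩ := f; exact Quot.sound (.comp_id f)

theorem comp_assoc (f : BeadHom U D a b) (g : BeadHom U D b c) (h : BeadHom U D c d) :
    (f.comp g).comp h = f.comp (g.comp h) := by
  obtain ⟨f⟩ := f; obtain ⟨g⟩ := g; obtain ⟨h⟩ := h; exact Quot.sound (.assoc f g h)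

theorem tensor_comp (f : BeadHom U D a b) (g : BeadHom U D b c) (f' : BeadHom U D a' b')
    (g' : BeadHom U D b' c') :
    (f.comp g).tensor (f'.comp g') = (f.tensor f').comp (g.tensor g') := by
  obtain ⟨f⟩ := f; obtain ⟨g⟩ := g; obtain ⟨f'⟩ := f'; obtain ⟨g'⟩ := g'
  exact Quot.sound (.interchange f g f' g')

theorem ident_tensor_ident (a b : List Dir) :
    (ident a).tensor (ident b) = (ident (a ++ b) : BeadHom U D _ _) :=
  Quot.sound (.tensor_id a b)

protected theorem add_comp (f f' : BeadHom U D a b) (g : BeadHom U D b c) :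
    (f + f').comp g = f.comp g + f'.comp g := by
  obtain ⟨f⟩ := f; obtain ⟨f'⟩ := f'; obtain ⟨g⟩ := g; exact Quot.sound (.add_comp f f' g)

protected theorem comp_add (f : BeadHom U D a b) (g g' : BeadHom U D b c) :
    f.comp (g + g') = f.comp g + f.comp g' := by
  obtain ⟨f⟩ := f; obtain ⟨g⟩ := g; obtain ⟨g'⟩ := g'; exact Quot.sound (.comp_add f g g')

protected theorem smul_comp (r : k) (f : BeadHom U D a b) (g : BeadHom U D b c) :
    (r • f).comp g = r • f.comp g := by
  obtain ⟨f⟩ := f; obtain ⟨g⟩ := g; exact Quot.sound (.smul_comp r f g)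

protected theorem comp_smul (r : k) (f : BeadHom U D a b) (g : BeadHom U D b c) :
    f.comp (r • g) = r • f.comp g := by
  obtain ⟨f⟩ := f; obtain ⟨g⟩ := g; exact Quot.sound (.comp_smul r f g)

protected theorem add_tensor (f f' : BeadHom U D a b) (g : BeadHom U D c d) :
    (f + f').tensor g = f.tensor g + f'.tensor g := by
  obtain ⟨f⟩ := f; obtain ⟨f'⟩ := f'; obtain ⟨g⟩ := g; exact Quot.sound (.add_tensor f f' g)

protected theorem tensor_add (f : BeadHom U D a b) (g g' : BeadHom U D c d) :
    f.tensor (g + g') = f.tensor g + f.tensor g' := by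
  obtain ⟨f⟩ := f; obtain ⟨g⟩ := g; obtain ⟨g'⟩ := g'; exact Quot.sound (.tensor_add f g g')

protected theorem smul_tensor (r : k) (f : BeadHom U D a b) (g : BeadHom U D c d) :
    (r • f).tensor g = r • f.tensor g := by
  obtain ⟨f⟩ := f; obtain ⟨g⟩ := g; exact Quot.sound (.smul_tensor r f g)

protected theorem tensor_smul (r : k) (f : BeadHom U D a b) (g : BeadHom U D c d) :
    f.tensor (r • g) = r • f.tensor g := by
  obtain ⟨f⟩ := f; obtain ⟨g⟩ := g; exact Quot.sound (.tensor_smul r f g)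

/-- Composition is bilinear. -/
def compₗ (U D : A ≃ₐ[k] A) (a b c : List Dir) :
    BeadHom U D a b →ₗ[k] BeadHom U D b c →ₗ[k] BeadHom U D a c :=
  LinearMap.mk₂ k comp BeadHom.add_comp BeadHom.smul_comp BeadHom.comp_add BeadHom.comp_smul

/-- Adding vertical strings on the right. -/
def whiskerRight (U D : A ≃ₐ[k] A) (a b r : List Dir) :
    BeadHom U D a b →ₗ[k] BeadHom U D (a ++ r) (b ++ r) where
  toFun f := f.tensor (ident r)
  map_add' f g := BeadHom.add_tensor f g _
  map_smul' c f := BeadHom.smul_tensor c f _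

/-- Adding vertical strings on the left. -/
def whiskerLeft (U D : A ≃ₐ[k] A) (l a b : List Dir) :
    BeadHom U D a b →ₗ[k] BeadHom U D (l ++ a) (l ++ b) where
  toFun f := (ident l).tensor f
  map_add' f g := BeadHom.tensor_add _ f g
  map_smul' c f := BeadHom.tensor_smul c _ f

theorem comp_tensor_ident (f : BeadHom U D a b) (g : BeadHom U D b c) (r : List Dir) :
    (f.comp g).tensor (ident r) = (f.tensor (ident r)).comp (g.tensor (ident r)) := by
  rw [← tensor_comp, ident_comp]

theorem ident_tensor_comp (f : BeadHom U D a b) (g : BeadHom U D b c) (l : List Dir) :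
    (ident l).tensor (f.comp g) = ((ident l).tensor f).comp ((ident l).tensor g) := by
  rw [← tensor_comp, ident_comp]

/-- The product `f * g` has `f` below `g`. This ring is the target of the homomorphisms and
antihomomorphisms given by beads on strings, so that moves become ring identities. -/
instance : Ring (BeadHom U D a a) where
  mul := comp
  one := ident a
  mul_assoc := comp_assoc
  one_mul := ident_comp
  mul_one := comp_ident
  left_distrib := BeadHom.comp_add
  right_distrib := BeadHom.add_comp
  zero_mul g := ((compₗ U D a a a).flip g).map_zero
  mul_zero f := (compₗ U D a a a f).map_zero
  zsmul := zsmulRec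
  neg_add_cancel := neg_add_cancel

theorem mul_eq_comp (f g : BeadHom U D a a) : f * g = f.comp g := rfl

instance : Algebra k (BeadHom U D a a) :=
  Algebra.ofModule BeadHom.smul_comp fun c f g => BeadHom.comp_smul c f g

end

end BeadHom

section

variable {k A B : Type*} [CommRing k] [Ring A] [Algebra k A] [Ring B] [Algebra k B]

/-- The linear extension of `x ⊗ y ↦ f x * g y`. -/
noncomputable def pair (f g : A →ₗ[k] B) : A ⊗[k] A →ₗ[k] B :=
  LinearMap.mul' k B ∘ₗ TensorProduct.map f g

theorem pair_tmul (f g : A →ₗ[k] B) (x y : A) : pair f g (x ⊗ₜ y) = f x * g y := rfl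

end

/-! ### Beads on individual strings and their sliding -/

namespace BeadHom

section

variable {k A : Type*} [CommRing k] [Ring A] [Algebra k A] {U D : A ≃ₐ[k] A}

/-- A bead on a single string. -/
def beadₗ (U D : A ≃ₐ[k] A) (s : Dir) : A →ₗ[k] BeadHom U D [s] [s] where
  toFun := bead s
  map_add' x y := Quot.sound (.bead (.add s x y))
  map_smul' c x := Quot.sound (.bead (.smul s c x))

/-- A bead on the left one of two strings. -/
def leftBead (U D : A ≃ₐ[k] A) (s t : Dir) : A →ₗ[k] BeadHom U D [s, t] [s, t] :=
  whiskerRight U D [s] [s] [t] ∘ₗ beadₗ U D s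

/-- A bead on the right one of two strings. -/
def rightBead (U D : A ≃ₐ[k] A) (s t : Dir) : A →ₗ[k] BeadHom U D [s, t] [s, t] :=
  whiskerLeft U D [s] [t] [t] ∘ₗ beadₗ U D t

theorem leftBead_mul_rightBead (s t : Dir) (x y : A) :
    leftBead U D s t x * rightBead U D s t y = (bead s x).tensor (bead t y) := by
  change comp (a := [s, t]) (b := [s, t]) (c := [s, t]) ((bead s x).tensor (ident [t]))
    ((ident [s]).tensor (bead t y)) = _
  exact (tensor_comp _ _ _ _).symm.trans (by rw [comp_ident, ident_comp])

theorem rightBead_mul_leftBead (s t : Dir) (x y : A) :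
    rightBead U D s t y * leftBead U D s t x = (bead s x).tensor (bead t y) := by
  change comp (a := [s, t]) (b := [s, t]) (c := [s, t]) ((ident [s]).tensor (bead t y))
    ((bead s x).tensor (ident [t])) = _
  exact (tensor_comp _ _ _ _).symm.trans (by rw [comp_ident, ident_comp])

theorem beads_eq_pair (s t : Dir) :
    beads U D s t = pair (leftBead U D s t) (rightBead U D s t) := by
  ext x y
  exact (leftBead_mul_rightBead s t x y).symm

/-- Beads slide through `X`. -/
def Slides {a b : List Dir} (X : BeadHom U D a b) (f : A →ₗ[k] BeadHom U D a a)
    (g : A →ₗ[k] BeadHom U D b b) : Prop :=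
  ∀ x, (f x).comp X = X.comp (g x)

/-- Both sides are linear in `w`, so it suffices to slide two single beads one after the other. -/
theorem Slides.pair {a b : List Dir} {X : BeadHom U D a b} {f f' : A →ₗ[k] BeadHom U D a a}
    {g g' : A →ₗ[k] BeadHom U D b b} (h : Slides X f g) (h' : Slides X f' g') :
    ∀ w, (pair f f' w).comp X = X.comp (pair g g' w) := by
  intro w
  have : (compₗ U D a a b).flip X ∘ₗ _root_.pair f f' = compₗ U D a b b X ∘ₗ _root_.pair g g' := by
    ext x y
    change ((f x).comp (f' y)).comp X = X.comp ((g x).comp (g' y))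
    rw [comp_assoc, h' y, ← comp_assoc, h x, comp_assoc]
  exact LinearMap.congr_fun this w

theorem slides_cross_left (s t : Dir) :
    Slides (cross s t) (leftBead U D s t) (rightBead U D t s) :=
  fun x => Quot.sound (.bead (.slide_left s t x))

theorem slides_cross_right (s t : Dir) :
    Slides (cross s t) (rightBead U D s t) (leftBead U D t s) :=
  fun x => Quot.sound (.bead (.slide_right s t x))

theorem Slides.whiskerRight {a b : List Dir} {X : BeadHom U D a b}
    {f : A →ₗ[k] BeadHom U D a a} {g : A →ₗ[k] BeadHom U D b b} (h : Slides X f g)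
    (r : List Dir) : Slides (X.tensor (ident r)) (BeadHom.whiskerRight U D a a r ∘ₗ f)
      (BeadHom.whiskerRight U D b b r ∘ₗ g) := by
  intro x
  change ((f x).tensor (ident r)).comp (X.tensor (ident r)) =
    (X.tensor (ident r)).comp ((g x).tensor (ident r))
  rw [← comp_tensor_ident, ← comp_tensor_ident, h x]

theorem Slides.whiskerLeft {a b : List Dir} {X : BeadHom U D a b}
    {f : A →ₗ[k] BeadHom U D a a} {g : A →ₗ[k] BeadHom U D b b} (h : Slides X f g)
    (l : List Dir) : Slides ((ident l).tensor X) (BeadHom.whiskerLeft U D l a a ∘ₗ f)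
      (BeadHom.whiskerLeft U D l b b ∘ₗ g) := by
  intro x
  change ((ident l).tensor (f x)).comp ((ident l).tensor X) =
    ((ident l).tensor X).comp ((ident l).tensor (g x))
  rw [← ident_tensor_comp, ← ident_tensor_comp, h x]

/-- A bead on the first one of three strings. -/
def bead₁ (U D : A ≃ₐ[k] A) (s t u : Dir) : A →ₗ[k] BeadHom U D [s, t, u] [s, t, u] :=
  whiskerRight U D [s, t] [s, t] [u] ∘ₗ leftBead U D s t

/-- A bead on the second one of three strings. -/
def bead₂ (U D : A ≃ₐ[k] A) (s t u : Dir) : A →ₗ[k] BeadHom U D [s, t, u] [s, t, u] :=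
  whiskerRight U D [s, t] [s, t] [u] ∘ₗ rightBead U D s t

/-- A bead on the third one of three strings. -/
def bead₃ (U D : A ≃ₐ[k] A) (s t u : Dir) : A →ₗ[k] BeadHom U D [s, t, u] [s, t, u] :=
  whiskerLeft U D [s] [t, u] [t, u] ∘ₗ rightBead U D t u

/-- The middle string is the right one of the first two and the left one of the last two. The first
view fits a crossing of strings 1 and 2, the second a crossing of strings 2 and 3. -/
theorem bead₂_eq (s t u : Dir) :
    bead₂ U D s t u = whiskerLeft U D [s] [t, u] [t, u] ∘ₗ leftBead U D t u := by
  ext x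
  exact Quot.sound (.tensor_assoc (.id [s]) (.bead t x) (.id [u]))

theorem bead₁_eq (s t u : Dir) (x : A) :
    bead₁ U D s t u x = (bead s x).tensor (ident [t, u]) := by
  have h : (((bead s x).tensor (ident [t])).tensor (ident [u]) : BeadHom U D [s, t, u] [s, t, u]) =
      (bead s x).tensor ((ident [t]).tensor (ident [u])) :=
    Quot.sound (.tensor_assoc (.bead s x) (.id [t]) (.id [u]))
  rw [ident_tensor_ident] at h
  exact h

theorem bead₃_eq (s t u : Dir) (x : A) :
    bead₃ U D s t u x = (ident [s, t]).tensor (bead u x) := by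
  have h : (((ident [s]).tensor (ident [t])).tensor (bead u x) :
      BeadHom U D [s, t, u] [s, t, u]) = (ident [s]).tensor ((ident [t]).tensor (bead u x)) :=
    Quot.sound (.tensor_assoc (.id [s]) (.id [t]) (.bead u x))
  rw [ident_tensor_ident] at h
  exact h.symm

theorem whiskerRight_pair {a : List Dir} (r : List Dir) (f g : A →ₗ[k] BeadHom U D a a)
    (w : A ⊗[k] A) : (pair f g w).tensor (ident r) =
      pair (whiskerRight U D a a r ∘ₗ f) (whiskerRight U D a a r ∘ₗ g) w := by
  have : whiskerRight U D a a r ∘ₗ pair f g =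
      pair (whiskerRight U D a a r ∘ₗ f) (whiskerRight U D a a r ∘ₗ g) := by
    ext x y
    exact comp_tensor_ident (f x) (g y) r
  exact LinearMap.congr_fun this w

theorem whiskerLeft_pair {a : List Dir} (l : List Dir) (f g : A →ₗ[k] BeadHom U D a a)
    (w : A ⊗[k] A) : (ident l).tensor (pair f g w) =
      pair (whiskerLeft U D l a a ∘ₗ f) (whiskerLeft U D l a a ∘ₗ g) w := by
  have : whiskerLeft U D l a a ∘ₗ pair f g =
      pair (whiskerLeft U D l a a ∘ₗ f) (whiskerLeft U D l a a ∘ₗ g) := by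
    ext x y
    exact ident_tensor_comp (f x) (g y) l
  exact LinearMap.congr_fun this w

theorem commute_left_right (s t : Dir) (x y : A) :
    leftBead U D s t x * rightBead U D s t y = rightBead U D s t y * leftBead U D s t x := by
  rw [leftBead_mul_rightBead, rightBead_mul_leftBead]

theorem commute₁₂ (s t u : Dir) (x y : A) :
    bead₁ U D s t u x * bead₂ U D s t u y = bead₂ U D s t u y * bead₁ U D s t u x := by
  have := congrArg (whiskerRight U D [s, t] [s, t] [u]) (commute_left_right s t x y)
  exact (comp_tensor_ident (leftBead U D s t x) (rightBead U D s t y) [u]).symm.trans (this.trans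
    (comp_tensor_ident (rightBead U D s t y) (leftBead U D s t x) [u]))

theorem commute₂₃ (s t u : Dir) (x y : A) :
    bead₂ U D s t u x * bead₃ U D s t u y = bead₃ U D s t u y * bead₂ U D s t u x := by
  have := congrArg (whiskerLeft U D [s] [t, u] [t, u]) (commute_left_right t u x y)
  rw [bead₂_eq]
  exact (ident_tensor_comp (leftBead U D t u x) (rightBead U D t u y) [s]).symm.trans (this.trans
    (ident_tensor_comp (rightBead U D t u y) (leftBead U D t u x) [s]))

theorem commute₁₃ (s t u : Dir) (x y : A) :
    bead₁ U D s t u x * bead₃ U D s t u y = bead₃ U D s t u y * bead₁ U D s t u x := by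
  rw [bead₁_eq]
  change comp (a := [s] ++ [t, u]) (b := [s] ++ [t, u]) (c := [s] ++ [t, u])
    ((bead s x).tensor (ident [t, u])) ((ident [s]).tensor (rightBead U D t u y)) =
    comp (a := [s] ++ [t, u]) (b := [s] ++ [t, u]) (c := [s] ++ [t, u])
      ((ident [s]).tensor (rightBead U D t u y)) ((bead s x).tensor (ident [t, u]))
  rw [← tensor_comp, ← tensor_comp, ident_comp, ident_comp, comp_ident, comp_ident]

end

end BeadHom

section

variable {k A B : Type*} [CommRing k] [Ring A] [Algebra k A] [Ring B] [Algebra k B]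

theorem pair_comm {f g : A →ₗ[k] B} (h : ∀ x y, f x * g y = g y * f x) (w : A ⊗[k] A) :
    pair f g (TensorProduct.comm k A A w) = pair g f w := by
  have : pair f g ∘ₗ (TensorProduct.comm k A A).toLinearMap = pair g f := by
    ext x y
    exact h y x
  exact LinearMap.congr_fun this w

theorem pair_map (f g : A →ₗ[k] B) (σ τ : A →ₗ[k] A) (w : A ⊗[k] A) :
    pair f g (TensorProduct.map σ τ w) = pair (f ∘ₗ σ) (g ∘ₗ τ) w := by
  have : pair f g ∘ₗ TensorProduct.map σ τ = pair (f ∘ₗ σ) (g ∘ₗ τ) := by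
    ext x y
    rfl
  exact LinearMap.congr_fun this w

/-- `f` is a homomorphism of algebras for the sign `+`, an antihomomorphism for the sign `-`. -/
structure IsStrand (s : Dir) (f : A →ₗ[k] B) : Prop where
  map_one : f 1 = 1
  map_mul_up : s = .up → ∀ x y, f (x * y) = f x * f y
  map_mul_down : s = .down → ∀ x y, f (x * y) = f y * f x

theorem IsStrand.comp_algEquiv {s : Dir} {f : A →ₗ[k] B} (h : IsStrand s f) (T : A ≃ₐ[k] A) :
    IsStrand s (f ∘ₗ T.toLinearMap) where
  map_one := by simp [h.map_one]
  map_mul_up hs x y := by simp [h.map_mul_up hs]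
  map_mul_down hs x y := by simp [h.map_mul_down hs]

end

namespace BeadHom

section

variable {k A : Type*} [CommRing k] [Ring A] [Algebra k A] {U D : A ≃ₐ[k] A}

/-- Stacking reads upwards, so on a falling string it multiplies beads against their order of
occurrence. -/
theorem isStrand_beadₗ (s : Dir) : IsStrand s (beadₗ U D s) where
  map_one := Quot.sound (.bead (.one s))
  map_mul_up := by rintro rfl x y; exact (Quot.sound (.bead (.mul_up x y))).symm
  map_mul_down := by rintro rfl x y; exact (Quot.sound (.bead (.mul_down y x))).symm

theorem _root_.IsStrand.whiskerRight {s : Dir} {a : List Dir} {f : A →ₗ[k] BeadHom U D a a}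
    (h : IsStrand s f) (r : List Dir) : IsStrand s (BeadHom.whiskerRight U D a a r ∘ₗ f) where
  map_one := by
    change (f 1).tensor (ident r) = _
    rw [h.map_one]
    exact ident_tensor_ident a r
  map_mul_up hs x y := by
    change (f (x * y)).tensor (ident r) = _
    rw [h.map_mul_up hs]
    exact comp_tensor_ident _ _ r
  map_mul_down hs x y := by
    change (f (x * y)).tensor (ident r) = _
    rw [h.map_mul_down hs]
    exact comp_tensor_ident _ _ r

theorem _root_.IsStrand.whiskerLeft {s : Dir} {a : List Dir} {f : A →ₗ[k] BeadHom U D a a}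
    (h : IsStrand s f) (l : List Dir) : IsStrand s (BeadHom.whiskerLeft U D l a a ∘ₗ f) where
  map_one := by
    change (ident l).tensor (f 1) = _
    rw [h.map_one]
    exact ident_tensor_ident l a
  map_mul_up hs x y := by
    change (ident l).tensor (f (x * y)) = _
    rw [h.map_mul_up hs]
    exact ident_tensor_comp _ _ l
  map_mul_down hs x y := by
    change (ident l).tensor (f (x * y)) = _
    rw [h.map_mul_down hs]
    exact ident_tensor_comp _ _ l

theorem isStrand_leftBead (s t : Dir) : IsStrand s (leftBead U D s t) :=
  (isStrand_beadₗ s).whiskerRight [t]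

theorem isStrand_rightBead (s t : Dir) : IsStrand t (rightBead U D s t) :=
  (isStrand_beadₗ t).whiskerLeft [s]

theorem isStrand_bead₁ (s t u : Dir) : IsStrand s (bead₁ U D s t u) :=
  (isStrand_leftBead s t).whiskerRight [u]

theorem isStrand_bead₂ (s t u : Dir) : IsStrand t (bead₂ U D s t u) :=
  (isStrand_rightBead s t).whiskerRight [u]

theorem isStrand_bead₃ (s t u : Dir) : IsStrand u (bead₃ U D s t u) :=
  (isStrand_rightBead t u).whiskerLeft [s]

/-! ### The second Reidemeister move -/

theorem cross_comp_cross (s t : Dir) :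
    (cross s t).comp (cross t s) = (ident [s, t] : BeadHom U D _ _) :=
  Quot.sound (.flat (.two s t))

/-- All beads are slid below both flat crossings, which then cancel. The string entering the second
crossing from the left is the right one at the bottom, hence the exchanged roles in the second
factor. -/
theorem decorate_two (ρ : (A ⊗[k] A)ˣ) (s t : Dir) (o o' : Bool) :
    decorate ρ U D (.comp (.crossing s t o) (.crossing t s o')) =
      pair (leftBead U D s t) (rightBead U D s t) (crossingLabel ρ U D s t o) *
        pair (rightBead U D s t) (leftBead U D s t) (crossingLabel ρ U D t s o') := by
  change ((beads U D s t _).comp (cross s t)).comp ((beads U D t s _).comp (cross t s)) = _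
  rw [beads_eq_pair, beads_eq_pair, comp_assoc, ← comp_assoc (cross s t),
    ← (slides_cross_right s t).pair (slides_cross_left s t), comp_assoc, cross_comp_cross,
    comp_ident]
  rfl

/-! ### The third Reidemeister move -/

/-- The flat crossing of the first two of three strings. -/
def cross₁₂ (U D : A ≃ₐ[k] A) (s t u : Dir) : BeadHom U D [s, t, u] [t, s, u] :=
  (cross s t).tensor (ident [u])

/-- The flat crossing of the last two of three strings. -/
def cross₂₃ (U D : A ≃ₐ[k] A) (s t u : Dir) : BeadHom U D [s, t, u] [s, u, t] :=
  (ident [s]).tensor (cross t u)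

theorem slides_cross₁₂_bead₁ (s t u : Dir) :
    Slides (cross₁₂ U D s t u) (bead₁ U D s t u) (bead₂ U D t s u) :=
  (slides_cross_left s t).whiskerRight [u]

theorem slides_cross₁₂_bead₂ (s t u : Dir) :
    Slides (cross₁₂ U D s t u) (bead₂ U D s t u) (bead₁ U D t s u) :=
  (slides_cross_right s t).whiskerRight [u]

theorem slides_cross₁₂_bead₃ (s t u : Dir) :
    Slides (cross₁₂ U D s t u) (bead₃ U D s t u) (bead₃ U D t s u) := by
  intro x
  rw [bead₃_eq, bead₃_eq]
  change comp (a := [s, t] ++ [u]) (b := [s, t] ++ [u]) (c := [t, s] ++ [u])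
    ((ident [s, t]).tensor (bead u x)) ((cross s t).tensor (ident [u])) =
    comp (a := [s, t] ++ [u]) (b := [t, s] ++ [u]) (c := [t, s] ++ [u])
    ((cross s t).tensor (ident [u])) ((ident [t, s]).tensor (bead u x))
  rw [← tensor_comp, ← tensor_comp, ident_comp, ident_comp, comp_ident, comp_ident]

theorem slides_cross₂₃_bead₁ (s t u : Dir) :
    Slides (cross₂₃ U D s t u) (bead₁ U D s t u) (bead₁ U D s u t) := by
  intro x
  rw [bead₁_eq, bead₁_eq]
  change comp (a := [s] ++ [t, u]) (b := [s] ++ [t, u]) (c := [s] ++ [u, t])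
    ((bead s x).tensor (ident [t, u])) ((ident [s]).tensor (cross t u)) =
    comp (a := [s] ++ [t, u]) (b := [s] ++ [u, t]) (c := [s] ++ [u, t])
    ((ident [s]).tensor (cross t u)) ((bead s x).tensor (ident [u, t]))
  rw [← tensor_comp, ← tensor_comp, ident_comp, ident_comp, comp_ident, comp_ident]

theorem slides_cross₂₃_bead₂ (s t u : Dir) :
    Slides (cross₂₃ U D s t u) (bead₂ U D s t u) (bead₃ U D s u t) := by
  rw [bead₂_eq]
  exact (slides_cross_left t u).whiskerLeft [s]

theorem slides_cross₂₃_bead₃ (s t u : Dir) :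
    Slides (cross₂₃ U D s t u) (bead₃ U D s t u) (bead₂ U D s u t) := by
  rw [bead₂_eq]
  exact (slides_cross_right t u).whiskerLeft [s]

theorem decorate_crossing_tensor (ρ : (A ⊗[k] A)ˣ) (s t u : Dir) (o : Bool) :
    decorate ρ U D (.tensor (.crossing s t o) (.id [u])) =
      comp (b := [s, t, u]) (pair (bead₁ U D s t u) (bead₂ U D s t u) (crossingLabel ρ U D s t o))
        (cross₁₂ U D s t u) := by
  change ((beads U D s t _).comp (cross s t)).tensor (ident [u]) = _
  rw [comp_tensor_ident, beads_eq_pair]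
  exact congrArg (fun f => comp f (cross₁₂ U D s t u)) (whiskerRight_pair [u] _ _ _)

theorem decorate_tensor_crossing (ρ : (A ⊗[k] A)ˣ) (s t u : Dir) (o : Bool) :
    decorate ρ U D (.tensor (.id [s]) (.crossing t u o)) =
      comp (b := [s, t, u]) (pair (bead₂ U D s t u) (bead₃ U D s t u) (crossingLabel ρ U D t u o))
        (cross₂₃ U D s t u) := by
  change (ident [s]).tensor ((beads U D t u _).comp (cross t u)) = _
  rw [ident_tensor_comp, beads_eq_pair, bead₂_eq]
  exact congrArg (fun f => comp f (cross₂₃ U D s t u)) (whiskerLeft_pair [s] _ _ _)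

/-- All beads are slid to the bottom. Indexed by the positions of the strings there, the factors
appear in the order 12, 13, 23. -/
theorem decorate_three_left (ρ : (A ⊗[k] A)ˣ) (s t u : Dir) (o₁₂ o₁₃ o₂₃ : Bool) :
    decorate ρ U D (TangleDiagram.comp (a := [s, t, u]) (b := [t, s, u]) (c := [u, t, s])
      (.tensor (.crossing s t o₁₂) (.id [u]))
      (.comp (b := [t, u, s]) (.tensor (.id [t]) (.crossing s u o₁₃))
        (.tensor (.crossing t u o₂₃) (.id [s])))) =
    comp (pair (bead₁ U D s t u) (bead₂ U D s t u) (crossingLabel ρ U D s t o₁₂) *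
        pair (bead₁ U D s t u) (bead₃ U D s t u) (crossingLabel ρ U D s u o₁₃) *
        pair (bead₂ U D s t u) (bead₃ U D s t u) (crossingLabel ρ U D t u o₂₃))
      ((cross₁₂ U D s t u).comp ((cross₂₃ U D t s u).comp (cross₁₂ U D t u s))) := by
  change comp (a := [s, t, u]) (b := [t, s, u]) (c := [u, t, s])
    (decorate ρ U D (.tensor (.crossing s t o₁₂) (.id [u])))
    (comp (a := [t, s, u]) (b := [t, u, s]) (c := [u, t, s])
      (decorate ρ U D (.tensor (.id [t]) (.crossing s u o₁₃)))
      (decorate ρ U D (.tensor (.crossing t u o₂₃) (.id [s])))) = _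
  rw [decorate_crossing_tensor, decorate_tensor_crossing, decorate_crossing_tensor]
  simp only [mul_eq_comp, comp_assoc]
  congr 1
  rw [← comp_assoc (cross₂₃ U D t s u),
    ← (slides_cross₂₃_bead₁ t s u).pair (slides_cross₂₃_bead₃ t s u)]
  simp only [comp_assoc]
  rw [← comp_assoc (cross₁₂ U D s t u),
    ← (slides_cross₁₂_bead₁ s t u).pair (slides_cross₁₂_bead₃ s t u), comp_assoc]
  congr 1
  rw [← comp_assoc (cross₁₂ U D s t u),
    ← (slides_cross₁₂_bead₂ s t u).pair (slides_cross₁₂_bead₃ s t u), comp_assoc]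

/-- The same normal form with the factors in the order 23, 13, 12; the remaining flat parts on the
two sides agree by the flat move III. -/
theorem decorate_three_right (ρ : (A ⊗[k] A)ˣ) (s t u : Dir) (o₁₂ o₁₃ o₂₃ : Bool) :
    decorate ρ U D (TangleDiagram.comp (a := [s, t, u]) (b := [s, u, t]) (c := [u, t, s])
      (.tensor (.id [s]) (.crossing t u o₂₃))
      (.comp (b := [u, s, t]) (.tensor (.crossing s u o₁₃) (.id [t]))
        (.tensor (.id [u]) (.crossing s t o₁₂)))) =
    comp (pair (bead₂ U D s t u) (bead₃ U D s t u) (crossingLabel ρ U D t u o₂₃) *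
        pair (bead₁ U D s t u) (bead₃ U D s t u) (crossingLabel ρ U D s u o₁₃) *
        pair (bead₁ U D s t u) (bead₂ U D s t u) (crossingLabel ρ U D s t o₁₂))
      ((cross₂₃ U D s t u).comp ((cross₁₂ U D s u t).comp (cross₂₃ U D u s t))) := by
  change comp (a := [s, t, u]) (b := [s, u, t]) (c := [u, t, s])
    (decorate ρ U D (.tensor (.id [s]) (.crossing t u o₂₃)))
    (comp (a := [s, u, t]) (b := [u, s, t]) (c := [u, t, s])
      (decorate ρ U D (.tensor (.crossing s u o₁₃) (.id [t])))
      (decorate ρ U D (.tensor (.id [u]) (.crossing s t o₁₂)))) = _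
  rw [decorate_tensor_crossing, decorate_crossing_tensor, decorate_tensor_crossing]
  simp only [mul_eq_comp, comp_assoc]
  congr 1
  rw [← comp_assoc (cross₁₂ U D s u t),
    ← (slides_cross₁₂_bead₁ s u t).pair (slides_cross₁₂_bead₃ s u t)]
  simp only [comp_assoc]
  rw [← comp_assoc (cross₂₃ U D s t u),
    ← (slides_cross₂₃_bead₁ s t u).pair (slides_cross₂₃_bead₃ s t u), comp_assoc]
  congr 1
  rw [← comp_assoc (cross₂₃ U D s t u),
    ← (slides_cross₂₃_bead₁ s t u).pair (slides_cross₂₃_bead₂ s t u), comp_assoc]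

theorem cross_three (s t u : Dir) :
    (cross₁₂ U D s t u).comp ((cross₂₃ U D t s u).comp (cross₁₂ U D t u s)) =
      (cross₂₃ U D s t u).comp ((cross₁₂ U D s u t).comp (cross₂₃ U D u s t)) :=
  Quot.sound (.flat (.three s t u))

/-! ### The switchback moves -/

/-- A maximum behind a vertical string. -/
def capPast (U D : A ≃ₐ[k] A) {s t : Dir} (h : s ≠ t) (u : Dir) : BeadHom U D [s, u, t] [u] :=
  comp (cross₁₂ U D s u t) ((ident [u]).tensor (cap h))

/-- A minimum behind a vertical string. -/
def cupPast (U D : A ≃ₐ[k] A) {s t : Dir} (h : s ≠ t) (u : Dir) : BeadHom U D [u] [s, u, t] :=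
  comp (b := [u, s, t]) ((ident [u]).tensor (cup h)) (cross₁₂ U D u s t)

theorem capPast_eq {s t : Dir} (h : s ≠ t) (u : Dir) :
    capPast U D h u = comp (cross₂₃ U D s u t) ((cap h).tensor (ident [u])) :=
  Quot.sound (.flat (.switchback_cap h u))

theorem cupPast_eq {s t : Dir} (h : s ≠ t) (u : Dir) :
    cupPast U D h u = comp (b := [s, t, u]) ((cup h).tensor (ident [u])) (cross₂₃ U D s t u) :=
  Quot.sound (.flat (.switchback_cup h u))

/-- By the flat switchback the vertical string may be drawn across the right leg instead. The bead
then slides through that crossing, over the maximum and down the left leg. -/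
theorem bead₃_comp_capPast {s t : Dir} (h : s ≠ t) (u : Dir) (x : A) :
    (bead₃ U D s u t x).comp (capPast U D h u) =
      (bead₁ U D s u t (turn U D s x)).comp (capPast U D h u) := by
  have e : (rightBead U D s t x).comp (cap h) = (leftBead U D s t (turn U D s x)).comp (cap h) :=
    Quot.sound (.bead (.cap h x))
  have e' : comp (b := [s, t, u]) (bead₂ U D s t u x) ((cap h).tensor (ident [u])) =
      comp (b := [s, t, u]) (bead₁ U D s t u (turn U D s x)) ((cap h).tensor (ident [u])) := by
    have := congrArg (fun f => f.tensor (ident [u])) e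
    simp only [comp_tensor_ident] at this
    exact this
  rw [capPast_eq, ← comp_assoc, ← comp_assoc, slides_cross₂₃_bead₃, slides_cross₂₃_bead₁,
    comp_assoc, comp_assoc, e']

theorem cupPast_comp_bead₁ {s t : Dir} (h : s ≠ t) (u : Dir) (x : A) :
    (cupPast U D h u).comp (bead₁ U D s u t x) =
      (cupPast U D h u).comp (bead₃ U D s u t (turn U D t x)) := by
  have e : (cup h).comp (leftBead U D s t x) = (cup h).comp (rightBead U D s t (turn U D t x)) :=
    Quot.sound (.bead (.cup h x))
  have e' : comp (b := [s, t, u]) ((cup h).tensor (ident [u])) (bead₁ U D s t u x) =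
      comp (b := [s, t, u]) ((cup h).tensor (ident [u])) (bead₂ U D s t u (turn U D t x)) := by
    have := congrArg (fun f => f.tensor (ident [u])) e
    simp only [comp_tensor_ident] at this
    exact this
  rw [cupPast_eq, comp_assoc, comp_assoc, ← slides_cross₂₃_bead₁, ← slides_cross₂₃_bead₂,
    ← comp_assoc, ← comp_assoc, e']

theorem decorate_switchback_cap_left (ρ : (A ⊗[k] A)ˣ) {s t : Dir} (h : s ≠ t) (u : Dir)
    (o : Bool) :
    decorate ρ U D (TangleDiagram.comp (a := [s, u, t]) (b := [u, s, t]) (c := [u])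
      (.tensor (.crossing s u o) (.id [t])) (.tensor (.id [u]) (.cap h))) =
    (pair (bead₁ U D s u t) (bead₂ U D s u t) (crossingLabel ρ U D s u o)).comp
      (capPast U D h u) := by
  change comp (a := [s, u, t]) (b := [u, s, t]) (c := [u])
    (decorate ρ U D (.tensor (.crossing s u o) (.id [t]))) ((ident [u]).tensor (cap h)) = _
  rw [decorate_crossing_tensor, comp_assoc]
  rfl

/-- The bead on the right leg is carried over the maximum, at the cost of a turn, to the left leg.
Both sides of the move then have beads on the first two strings below the same flat tangle and can
be compared. -/
theorem decorate_switchback_cap_right (ρ : (A ⊗[k] A)ˣ) {s t : Dir} (h : s ≠ t) (u : Dir)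
    (o : Bool) :
    decorate ρ U D (TangleDiagram.comp (a := [s, u, t]) (b := [s, t, u]) (c := [u])
      (.tensor (.id [s]) (.crossing u t o)) (.tensor (.cap h) (.id [u]))) =
    (pair (bead₁ U D s u t) (bead₂ U D s u t)
      (TensorProduct.map (turn U D s).toLinearMap LinearMap.id
        (TensorProduct.comm k A A (crossingLabel ρ U D u t o)))).comp (capPast U D h u) := by
  change comp (a := [s, u, t]) (b := [s, t, u]) (c := [u])
    (decorate ρ U D (.tensor (.id [s]) (.crossing u t o))) ((cap h).tensor (ident [u])) = _
  rw [decorate_tensor_crossing, comp_assoc, ← capPast_eq, pair_map, LinearMap.comp_id,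
    pair_comm fun x y => commute₁₂ s u t _ _]
  have : (compₗ U D _ _ _).flip (capPast U D h u) ∘ₗ
      pair (bead₂ U D s u t) (bead₃ U D s u t) =
      (compₗ U D _ _ _).flip (capPast U D h u) ∘ₗ
      pair (bead₂ U D s u t) (bead₁ U D s u t ∘ₗ (turn U D s).toLinearMap) := by
    ext x y
    change ((bead₂ U D s u t x).comp (bead₃ U D s u t y)).comp (capPast U D h u) =
      ((bead₂ U D s u t x).comp (bead₁ U D s u t (turn U D s y))).comp (capPast U D h u)
    rw [comp_assoc, comp_assoc, bead₃_comp_capPast]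
  exact LinearMap.congr_fun this _

/-- At a minimum the turn rule goes from the left leg to the right leg, so the common normal form
has its beads above the flat tangle, on the third and the second string. -/
theorem decorate_switchback_cup_left (ρ : (A ⊗[k] A)ˣ) {s t : Dir} (h : s ≠ t) (u : Dir)
    (o : Bool) :
    decorate ρ U D (TangleDiagram.comp (a := [u]) (b := [u, s, t]) (c := [s, u, t])
      (.tensor (.id [u]) (.cup h)) (.tensor (.crossing u s o) (.id [t]))) =
    (cupPast U D h u).comp (pair (bead₃ U D s u t) (bead₂ U D s u t)
      (TensorProduct.map (turn U D t).toLinearMap LinearMap.id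
        (TensorProduct.comm k A A (crossingLabel ρ U D u s o)))) := by
  change comp (a := [u]) (b := [u, s, t]) (c := [s, u, t]) ((ident [u]).tensor (cup h))
    (decorate ρ U D (.tensor (.crossing u s o) (.id [t]))) = _
  rw [decorate_crossing_tensor, (slides_cross₁₂_bead₁ u s t).pair (slides_cross₁₂_bead₂ u s t),
    ← comp_assoc, pair_map, LinearMap.comp_id, pair_comm fun x y => (commute₂₃ s u t _ _).symm]
  have : compₗ U D _ _ _ (cupPast U D h u) ∘ₗ pair (bead₂ U D s u t) (bead₁ U D s u t) =
      compₗ U D _ _ _ (cupPast U D h u) ∘ₗ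
      pair (bead₂ U D s u t) (bead₃ U D s u t ∘ₗ (turn U D t).toLinearMap) := by
    ext x y
    change (cupPast U D h u).comp (bead₂ U D s u t x * bead₁ U D s u t y) =
      (cupPast U D h u).comp (bead₂ U D s u t x * bead₃ U D s u t (turn U D t y))
    -- The bead on the leg is brought next to the minimum, past the bead on the vertical string.
    rw [← commute₁₂, commute₂₃, mul_eq_comp, mul_eq_comp, ← comp_assoc, ← comp_assoc,
      cupPast_comp_bead₁]
  exact LinearMap.congr_fun this _

theorem decorate_switchback_cup_right (ρ : (A ⊗[k] A)ˣ) {s t : Dir} (h : s ≠ t) (u : Dir)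
    (o : Bool) :
    decorate ρ U D (TangleDiagram.comp (a := [u]) (b := [s, t, u]) (c := [s, u, t])
      (.tensor (.cup h) (.id [u])) (.tensor (.id [s]) (.crossing t u o))) =
    (cupPast U D h u).comp (pair (bead₃ U D s u t) (bead₂ U D s u t)
      (crossingLabel ρ U D t u o)) := by
  change comp (a := [u]) (b := [s, t, u]) (c := [s, u, t]) ((cup h).tensor (ident [u]))
    (decorate ρ U D (.tensor (.id [s]) (.crossing t u o))) = _
  rw [decorate_tensor_crossing, (slides_cross₂₃_bead₂ s t u).pair (slides_cross₂₃_bead₃ s t u),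
    ← comp_assoc, ← cupPast_eq]

end

end BeadHom

/-! ## Yang-Baxter elements on strings of arbitrary orientation -/

section

variable {k A B : Type*} [CommRing k] [Ring A] [Algebra k A] [Ring B] [Algebra k B]

/-- The embedding of `A ⊗ A` into the first two factors of `A ⊗ A ⊗ A`. -/
noncomputable def incl₁₂ (k A : Type*) [CommRing k] [Ring A] [Algebra k A] :
    A ⊗[k] A →ₐ[k] A ⊗[k] (A ⊗[k] A) :=
  Algebra.TensorProduct.map (AlgHom.id k A) Algebra.TensorProduct.includeLeft

/-- The embedding of `A ⊗ A` into the first and the third factor of `A ⊗ A ⊗ A`. -/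
noncomputable def incl₁₃ (k A : Type*) [CommRing k] [Ring A] [Algebra k A] :
    A ⊗[k] A →ₐ[k] A ⊗[k] (A ⊗[k] A) :=
  Algebra.TensorProduct.map (AlgHom.id k A) Algebra.TensorProduct.includeRight

/-- The embedding of `A ⊗ A` into the last two factors of `A ⊗ A ⊗ A`. -/
noncomputable def incl₂₃ (k A : Type*) [CommRing k] [Ring A] [Algebra k A] :
    A ⊗[k] A →ₐ[k] A ⊗[k] (A ⊗[k] A) :=
  Algebra.TensorProduct.includeRight

theorem incl₁₂_tmul (x y : A) : incl₁₂ k A (x ⊗ₜ y) = x ⊗ₜ (y ⊗ₜ 1) := rfl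

theorem incl₁₃_tmul (x y : A) : incl₁₃ k A (x ⊗ₜ y) = x ⊗ₜ (1 ⊗ₜ y) := rfl

theorem incl₂₃_tmul (x y : A) : incl₂₃ k A (x ⊗ₜ y) = 1 ⊗ₜ (x ⊗ₜ y) := rfl

/-- The linear extension of `x ⊗ y ⊗ z ↦ f x * g y * h z`. -/
noncomputable def triple (f g h : A →ₗ[k] B) : A ⊗[k] (A ⊗[k] A) →ₗ[k] B :=
  LinearMap.mul' k B ∘ₗ TensorProduct.map f (pair g h)

theorem triple_tmul (f g h : A →ₗ[k] B) (x y z : A) :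
    triple f g h (x ⊗ₜ (y ⊗ₜ z)) = f x * (g y * h z) := rfl

theorem tensor_induction₃ {V W : Type*} [AddCommMonoid V] [AddCommMonoid W] [Module k V]
    [Module k W] {P : V ⊗[k] W → V ⊗[k] W → V ⊗[k] W → Prop}
    (tmul : ∀ x y x' y' x'' y'', P (x ⊗ₜ y) (x' ⊗ₜ y') (x'' ⊗ₜ y''))
    (zero₁ : ∀ β γ, P 0 β γ) (zero₂ : ∀ α γ, P α 0 γ) (zero₃ : ∀ α β, P α β 0)
    (add₁ : ∀ α α' β γ, P α β γ → P α' β γ → P (α + α') β γ)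
    (add₂ : ∀ α β β' γ, P α β γ → P α β' γ → P α (β + β') γ)
    (add₃ : ∀ α β γ γ', P α β γ → P α β γ' → P α β (γ + γ')) (α β γ : V ⊗[k] W) : P α β γ := by
  induction α using TensorProduct.induction_on with
  | zero => exact zero₁ β γ
  | add α α' h h' => exact add₁ _ _ _ _ h h'
  | tmul x y =>
    induction β using TensorProduct.induction_on with
    | zero => exact zero₂ _ γ
    | add β β' h h' => exact add₂ _ _ _ _ h h'
    | tmul x' y' =>
      induction γ using TensorProduct.induction_on with
      | zero => exact zero₃ _ _
      | add γ γ' h h' => exact add₃ _ _ _ _ h h'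
      | tmul x'' y'' => exact tmul x y x' y' x'' y''

theorem triple_mul_induction₁₂₃ (f g h : A →ₗ[k] B)
    {i₁ i₂ i₃ : A ⊗[k] A →ₐ[k] A ⊗[k] (A ⊗[k] A)} {p₁ p₂ p₃ : A ⊗[k] A →ₗ[k] B}
    (H : ∀ x y x' y' x'' y'' : A, triple f g h (i₁ (x ⊗ₜ y) * i₂ (x' ⊗ₜ y') * i₃ (x'' ⊗ₜ y'')) =
      p₁ (x ⊗ₜ y) * p₂ (x' ⊗ₜ y') * p₃ (x'' ⊗ₜ y'')) (α β γ : A ⊗[k] A) :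
    triple f g h (i₁ α * i₂ β * i₃ γ) = p₁ α * p₂ β * p₃ γ := by
  refine tensor_induction₃ (P := fun α β γ => triple f g h (i₁ α * i₂ β * i₃ γ) =
    p₁ α * p₂ β * p₃ γ) H ?_ ?_ ?_ ?_ ?_ ?_ α β γ
  all_goals intros
  all_goals simp only [map_add, map_zero, add_mul, mul_add, mul_zero, zero_mul, *]

/-- The last two factors are exchanged: this is the effect of reversing the one string that they
share. -/
theorem triple_mul_induction₁₃₂ (f g h : A →ₗ[k] B)
    {i₁ i₂ i₃ : A ⊗[k] A →ₐ[k] A ⊗[k] (A ⊗[k] A)} {p₁ p₂ p₃ : A ⊗[k] A →ₗ[k] B}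
    (H : ∀ x y x' y' x'' y'' : A, triple f g h (i₁ (x ⊗ₜ y) * i₂ (x' ⊗ₜ y') * i₃ (x'' ⊗ₜ y'')) =
      p₁ (x ⊗ₜ y) * p₃ (x'' ⊗ₜ y'') * p₂ (x' ⊗ₜ y')) (α β γ : A ⊗[k] A) :
    triple f g h (i₁ α * i₂ β * i₃ γ) = p₁ α * p₃ γ * p₂ β := by
  refine tensor_induction₃ (P := fun α β γ => triple f g h (i₁ α * i₂ β * i₃ γ) =
    p₁ α * p₃ γ * p₂ β) H ?_ ?_ ?_ ?_ ?_ ?_ α β γ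
  all_goals intros
  all_goals simp only [map_add, map_zero, add_mul, mul_add, mul_zero, zero_mul, *]

theorem triple_mul_induction₂₁₃ (f g h : A →ₗ[k] B)
    {i₁ i₂ i₃ : A ⊗[k] A →ₐ[k] A ⊗[k] (A ⊗[k] A)} {p₁ p₂ p₃ : A ⊗[k] A →ₗ[k] B}
    (H : ∀ x y x' y' x'' y'' : A, triple f g h (i₁ (x ⊗ₜ y) * i₂ (x' ⊗ₜ y') * i₃ (x'' ⊗ₜ y'')) =
      p₂ (x' ⊗ₜ y') * p₁ (x ⊗ₜ y) * p₃ (x'' ⊗ₜ y'')) (α β γ : A ⊗[k] A) :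
    triple f g h (i₁ α * i₂ β * i₃ γ) = p₂ β * p₁ α * p₃ γ := by
  refine tensor_induction₃ (P := fun α β γ => triple f g h (i₁ α * i₂ β * i₃ γ) =
    p₂ β * p₁ α * p₃ γ) H ?_ ?_ ?_ ?_ ?_ ?_ α β γ
  all_goals intros
  all_goals simp only [map_add, map_zero, add_mul, mul_add, mul_zero, zero_mul, *]

section

set_option linter.unusedSimpArgs false

variable {f g h : A →ₗ[k] B} {ρ : (A ⊗[k] A)ˣ}

theorem left_comm_of_comm (fg : ∀ x y, f x * g y = g y * f x) (x y : A) (z : B) :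
    g y * (f x * z) = f x * (g y * z) := by
  rw [← mul_assoc, ← fg, mul_assoc]

/-- The forms of the Yang-Baxter equation in which factors are inverted. -/
theorem yangBaxter_inv {M : Type*} [Monoid M] {x y z : Mˣ} (h : x.1 * y.1 * z.1 = z * y * x) :
    x.1 * z⁻¹.1 * y⁻¹.1 = y⁻¹ * z⁻¹ * x ∧ y⁻¹.1 * x⁻¹.1 * z.1 = z * x⁻¹ * y⁻¹ ∧
      y.1 * x.1 * z⁻¹.1 = z⁻¹ * x * y ∧ x⁻¹.1 * z.1 * y.1 = y * z * x⁻¹ ∧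
      z⁻¹.1 * y⁻¹.1 * x⁻¹.1 = x⁻¹ * y⁻¹ * z⁻¹ := by
  have h : x * y * z = z * y * x := Units.ext h
  have h₁ : x * z⁻¹ * y⁻¹ = y⁻¹ * z⁻¹ * x := by
    calc x * z⁻¹ * y⁻¹ = y⁻¹ * z⁻¹ * (z * y * x) * z⁻¹ * y⁻¹ := by group
      _ = y⁻¹ * z⁻¹ * x := by rw [← h]; group
  have h₂ : y⁻¹ * x⁻¹ * z = z * x⁻¹ * y⁻¹ := by
    calc y⁻¹ * x⁻¹ * z = y⁻¹ * x⁻¹ * (z * y * x) * x⁻¹ * y⁻¹ := by group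
      _ = z * x⁻¹ * y⁻¹ := by rw [← h]; group
  have h₃ : y * x * z⁻¹ = z⁻¹ * x * y := by
    calc y * x * z⁻¹ = z⁻¹ * (z * y * x) * z⁻¹ := by group
      _ = z⁻¹ * x * y := by rw [← h]; group
  have h₄ : x⁻¹ * z * y = y * z * x⁻¹ := by
    calc x⁻¹ * z * y = x⁻¹ * (z * y * x) * x⁻¹ := by group
      _ = y * z * x⁻¹ := by rw [← h]; group
  have h₅ : z⁻¹ * y⁻¹ * x⁻¹ = x⁻¹ * y⁻¹ * z⁻¹ := by
    simpa only [mul_inv_rev, mul_assoc] using congrArg Inv.inv h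
  exact ⟨congrArg Units.val h₁, congrArg Units.val h₂, congrArg Units.val h₃,
    congrArg Units.val h₄, congrArg Units.val h₅⟩

theorem YangBaxter.units (hρ : YangBaxter (ρ : A ⊗[k] A)) :
    (Units.map (incl₁₂ k A : A ⊗[k] A →* A ⊗[k] (A ⊗[k] A)) ρ).1 * (Units.map (incl₁₃ k A : A ⊗[k] A →* A ⊗[k] (A ⊗[k] A)) ρ).1 *
      (Units.map (incl₂₃ k A : A ⊗[k] A →* A ⊗[k] (A ⊗[k] A)) ρ).1 =
    (Units.map (incl₂₃ k A : A ⊗[k] A →* A ⊗[k] (A ⊗[k] A)) ρ).1 * (Units.map (incl₁₃ k A : A ⊗[k] A →* A ⊗[k] (A ⊗[k] A)) ρ).1 *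
      (Units.map (incl₁₂ k A : A ⊗[k] A →* A ⊗[k] (A ⊗[k] A)) ρ).1 := hρ

theorem pair_triple_up_up_up (hf : IsStrand .up f) (hg : IsStrand .up g)
    (hh : IsStrand .up h) (fg : ∀ x y, f x * g y = g y * f x)
    (fh : ∀ x y, f x * h y = h y * f x) (gh : ∀ x y, g x * h y = h y * g x)
    (hρ : YangBaxter (ρ : A ⊗[k] A)) :
    pair f g ρ.1 * pair f h ρ.1 * pair g h ρ.1 =
      pair g h ρ.1 * pair f h ρ.1 * pair f g ρ.1 := by
  have hf' := hf.map_mul_up rfl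
  have hg' := hg.map_mul_up rfl
  have hh' := hh.map_mul_up rfl
  rw [← triple_mul_induction₁₂₃ f g h (i₁ := incl₁₂ k A) (i₂ := incl₁₃ k A) (i₃ := incl₂₃ k A) (by
      intro x y x' y' x'' y''
      simp only [incl₁₂_tmul, incl₁₃_tmul, incl₂₃_tmul, Algebra.TensorProduct.tmul_mul_tmul,
        triple_tmul, pair_tmul, hf', hg', hh', mul_one, one_mul, mul_assoc, ← fg, ← fh, ← gh,
        left_comm_of_comm fg, left_comm_of_comm fh, left_comm_of_comm gh]),
    ← triple_mul_induction₁₂₃ f g h (i₁ := incl₂₃ k A) (i₂ := incl₁₃ k A) (i₃ := incl₁₂ k A) (by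
      intro x y x' y' x'' y''
      simp only [incl₁₂_tmul, incl₁₃_tmul, incl₂₃_tmul, Algebra.TensorProduct.tmul_mul_tmul,
        triple_tmul, pair_tmul, hf', hg', hh', mul_one, one_mul, mul_assoc, ← fg, ← fh, ← gh,
        left_comm_of_comm fg, left_comm_of_comm fh, left_comm_of_comm gh])]
  exact congrArg (triple f g h) (hρ)

/-- The falling third string reverses its two factors, those indexed 13 and 23. Pulled back to `A ⊗
A ⊗ A`, the claim is `ρ₁₂ ρ₂₃⁻¹ ρ₁₃⁻¹ = ρ₁₃⁻¹ ρ₂₃⁻¹ ρ₁₂`. -/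
theorem pair_triple_up_up_down (hf : IsStrand .up f) (hg : IsStrand .up g)
    (hh : IsStrand .down h) (fg : ∀ x y, f x * g y = g y * f x)
    (fh : ∀ x y, f x * h y = h y * f x) (gh : ∀ x y, g x * h y = h y * g x)
    (hρ : YangBaxter (ρ : A ⊗[k] A)) :
    pair f g ρ.1 * pair f h ρ⁻¹.1 * pair g h ρ⁻¹.1 =
      pair g h ρ⁻¹.1 * pair f h ρ⁻¹.1 * pair f g ρ.1 := by
  have hf' := hf.map_mul_up rfl
  have hg' := hg.map_mul_up rfl
  have hh' := hh.map_mul_down rfl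
  rw [← triple_mul_induction₁₃₂ f g h (i₁ := incl₁₂ k A) (i₂ := incl₂₃ k A) (i₃ := incl₁₃ k A) (by
      intro x y x' y' x'' y''
      simp only [incl₁₂_tmul, incl₁₃_tmul, incl₂₃_tmul, Algebra.TensorProduct.tmul_mul_tmul,
        triple_tmul, pair_tmul, hf', hg', hh', mul_one, one_mul, mul_assoc, ← fg, ← fh, ← gh,
        left_comm_of_comm fg, left_comm_of_comm fh, left_comm_of_comm gh]),
    ← triple_mul_induction₂₁₃ f g h (i₁ := incl₁₃ k A) (i₂ := incl₂₃ k A) (i₃ := incl₁₂ k A) (by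
      intro x y x' y' x'' y''
      simp only [incl₁₂_tmul, incl₁₃_tmul, incl₂₃_tmul, Algebra.TensorProduct.tmul_mul_tmul,
        triple_tmul, pair_tmul, hf', hg', hh', mul_one, one_mul, mul_assoc, ← fg, ← fh, ← gh,
        left_comm_of_comm fg, left_comm_of_comm fh, left_comm_of_comm gh])]
  exact congrArg (triple f g h) ((yangBaxter_inv (YangBaxter.units hρ)).1)

/-- Now the factors on the first string are exchanged, and the claim is the image of `ρ₁₃⁻¹ ρ₁₂⁻¹
ρ₂₃ = ρ₂₃ ρ₁₂⁻¹ ρ₁₃⁻¹`. -/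
theorem pair_triple_down_up_up (hf : IsStrand .down f) (hg : IsStrand .up g)
    (hh : IsStrand .up h) (fg : ∀ x y, f x * g y = g y * f x)
    (fh : ∀ x y, f x * h y = h y * f x) (gh : ∀ x y, g x * h y = h y * g x)
    (hρ : YangBaxter (ρ : A ⊗[k] A)) :
    pair f g ρ⁻¹.1 * pair f h ρ⁻¹.1 * pair g h ρ.1 =
      pair g h ρ.1 * pair f h ρ⁻¹.1 * pair f g ρ⁻¹.1 := by
  have hf' := hf.map_mul_down rfl
  have hg' := hg.map_mul_up rfl
  have hh' := hh.map_mul_up rfl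
  rw [← triple_mul_induction₂₁₃ f g h (i₁ := incl₁₃ k A) (i₂ := incl₁₂ k A) (i₃ := incl₂₃ k A) (by
      intro x y x' y' x'' y''
      simp only [incl₁₂_tmul, incl₁₃_tmul, incl₂₃_tmul, Algebra.TensorProduct.tmul_mul_tmul,
        triple_tmul, pair_tmul, hf', hg', hh', mul_one, one_mul, mul_assoc, ← fg, ← fh, ← gh,
        left_comm_of_comm fg, left_comm_of_comm fh, left_comm_of_comm gh]),
    ← triple_mul_induction₁₃₂ f g h (i₁ := incl₂₃ k A) (i₂ := incl₁₂ k A) (i₃ := incl₁₃ k A) (by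
      intro x y x' y' x'' y''
      simp only [incl₁₂_tmul, incl₁₃_tmul, incl₂₃_tmul, Algebra.TensorProduct.tmul_mul_tmul,
        triple_tmul, pair_tmul, hf', hg', hh', mul_one, one_mul, mul_assoc, ← fg, ← fh, ← gh,
        left_comm_of_comm fg, left_comm_of_comm fh, left_comm_of_comm gh])]
  exact congrArg (triple f g h) ((yangBaxter_inv (YangBaxter.units hρ)).2.1)

/-- The factors on the middle string are exchanged: the source is `ρ₁₃ ρ₁₂ ρ₂₃⁻¹ = ρ₂₃⁻¹ ρ₁₂ ρ₁₃`.
The order of the factors obtained here is not that of a move III; this is corrected later by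
conjugation. -/
theorem pair_triple_up_down_up (hf : IsStrand .up f) (hg : IsStrand .down g)
    (hh : IsStrand .up h) (fg : ∀ x y, f x * g y = g y * f x)
    (fh : ∀ x y, f x * h y = h y * f x) (gh : ∀ x y, g x * h y = h y * g x)
    (hρ : YangBaxter (ρ : A ⊗[k] A)) :
    pair f h ρ.1 * pair g h ρ⁻¹.1 * pair f g ρ.1 =
      pair f g ρ.1 * pair g h ρ⁻¹.1 * pair f h ρ.1 := by
  have hf' := hf.map_mul_up rfl
  have hg' := hg.map_mul_down rfl
  have hh' := hh.map_mul_up rfl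
  rw [← triple_mul_induction₁₃₂ f g h (i₁ := incl₁₃ k A) (i₂ := incl₁₂ k A) (i₃ := incl₂₃ k A) (by
      intro x y x' y' x'' y''
      simp only [incl₁₂_tmul, incl₁₃_tmul, incl₂₃_tmul, Algebra.TensorProduct.tmul_mul_tmul,
        triple_tmul, pair_tmul, hf', hg', hh', mul_one, one_mul, mul_assoc, ← fg, ← fh, ← gh,
        left_comm_of_comm fg, left_comm_of_comm fh, left_comm_of_comm gh]),
    ← triple_mul_induction₂₁₃ f g h (i₁ := incl₂₃ k A) (i₂ := incl₁₂ k A) (i₃ := incl₁₃ k A) (by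
      intro x y x' y' x'' y''
      simp only [incl₁₂_tmul, incl₁₃_tmul, incl₂₃_tmul, Algebra.TensorProduct.tmul_mul_tmul,
        triple_tmul, pair_tmul, hf', hg', hh', mul_one, one_mul, mul_assoc, ← fg, ← fh, ← gh,
        left_comm_of_comm fg, left_comm_of_comm fh, left_comm_of_comm gh])]
  exact congrArg (triple f g h) ((yangBaxter_inv (YangBaxter.units hρ)).2.2.1)

end

/-- Passing from an algebra to the opposite algebra. -/
def opMap (k B : Type*) [CommRing k] [Ring B] [Algebra k B] : B →ₗ[k] Bᵐᵒᵖ :=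
  (MulOpposite.opLinearEquiv k).toLinearMap

theorem opMap_injective : Function.Injective (opMap k B) := MulOpposite.op_injective

theorem opMap_mul (x y : B) : opMap k B (x * y) = opMap k B y * opMap k B x := rfl

theorem IsStrand.op_up {f : A →ₗ[k] B} (h : IsStrand .up f) : IsStrand .down (opMap k B ∘ₗ f) where
  map_one := congrArg MulOpposite.op h.map_one
  map_mul_up := nofun
  map_mul_down _ x y := congrArg MulOpposite.op (h.map_mul_up rfl x y)

theorem IsStrand.op_down {f : A →ₗ[k] B} (h : IsStrand .down f) :
    IsStrand .up (opMap k B ∘ₗ f) where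
  map_one := congrArg MulOpposite.op h.map_one
  map_mul_up _ x y := congrArg MulOpposite.op (h.map_mul_down rfl x y)
  map_mul_down := nofun

theorem op_comm {f g : A →ₗ[k] B} (fg : ∀ x y, f x * g y = g y * f x) (x y : A) :
    (opMap k B ∘ₗ f) x * (opMap k B ∘ₗ g) y = (opMap k B ∘ₗ g) y * (opMap k B ∘ₗ f) x :=
  congrArg MulOpposite.op (fg x y).symm

theorem pair_op {f g : A →ₗ[k] B} (fg : ∀ x y, f x * g y = g y * f x) (w : A ⊗[k] A) :
    pair (opMap k B ∘ₗ f) (opMap k B ∘ₗ g) w = opMap k B (pair f g w) := by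
  have : pair (opMap k B ∘ₗ f) (opMap k B ∘ₗ g) = opMap k B ∘ₗ pair f g := by
    ext x y
    exact congrArg MulOpposite.op (fg x y).symm
  exact LinearMap.congr_fun this w

section

variable {f g h : A →ₗ[k] B} {ρ : (A ⊗[k] A)ˣ} {s t : Dir}

/-- Passing to `Bᵐᵒᵖ` turns falling strings into rising ones and interchanges the two sides of the
equation, so half of the orientations suffice. -/
theorem pair_triple_same (hf : IsStrand s f) (hg : IsStrand s g)
    (hh : IsStrand s h) (fg : ∀ x y, f x * g y = g y * f x)
    (fh : ∀ x y, f x * h y = h y * f x) (gh : ∀ x y, g x * h y = h y * g x)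
    (hρ : YangBaxter (ρ : A ⊗[k] A)) :
    pair f g ρ.1 * pair f h ρ.1 * pair g h ρ.1 =
      pair g h ρ.1 * pair f h ρ.1 * pair f g ρ.1 := by
  cases s with
  | up => exact pair_triple_up_up_up hf hg hh fg fh gh hρ
  | down =>
    have := pair_triple_up_up_up hf.op_down hg.op_down hh.op_down (op_comm fg) (op_comm fh) (op_comm gh) hρ
    rw [pair_op fg, pair_op fh, pair_op gh] at this
    exact opMap_injective (k := k) (by simpa only [opMap_mul, mul_assoc] using this.symm)

theorem pair_triple_last (st : s ≠ t) (hf : IsStrand s f) (hg : IsStrand s g)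
    (hh : IsStrand t h) (fg : ∀ x y, f x * g y = g y * f x)
    (fh : ∀ x y, f x * h y = h y * f x) (gh : ∀ x y, g x * h y = h y * g x)
    (hρ : YangBaxter (ρ : A ⊗[k] A)) :
    pair f g ρ.1 * pair f h ρ⁻¹.1 * pair g h ρ⁻¹.1 =
      pair g h ρ⁻¹.1 * pair f h ρ⁻¹.1 * pair f g ρ.1 := by
  match s, t, st with
  | .up, .down, _ => exact pair_triple_up_up_down hf hg hh fg fh gh hρ
  | .down, .up, _ =>
    have := pair_triple_up_up_down hf.op_down hg.op_down hh.op_up (op_comm fg) (op_comm fh) (op_comm gh) hρ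
    rw [pair_op fg, pair_op fh, pair_op gh] at this
    exact opMap_injective (k := k) (by simpa only [opMap_mul, mul_assoc] using this.symm)

theorem pair_triple_first (st : s ≠ t) (hf : IsStrand t f) (hg : IsStrand s g)
    (hh : IsStrand s h) (fg : ∀ x y, f x * g y = g y * f x)
    (fh : ∀ x y, f x * h y = h y * f x) (gh : ∀ x y, g x * h y = h y * g x)
    (hρ : YangBaxter (ρ : A ⊗[k] A)) :
    pair f g ρ⁻¹.1 * pair f h ρ⁻¹.1 * pair g h ρ.1 =
      pair g h ρ.1 * pair f h ρ⁻¹.1 * pair f g ρ⁻¹.1 := by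
  match s, t, st with
  | .up, .down, _ => exact pair_triple_down_up_up hf hg hh fg fh gh hρ
  | .down, .up, _ =>
    have := pair_triple_down_up_up hf.op_up hg.op_down hh.op_down (op_comm fg) (op_comm fh) (op_comm gh) hρ
    rw [pair_op fg, pair_op fh, pair_op gh] at this
    exact opMap_injective (k := k) (by simpa only [opMap_mul, mul_assoc] using this.symm)

theorem pair_triple_middle (st : s ≠ t) (hf : IsStrand s f) (hg : IsStrand t g)
    (hh : IsStrand s h) (fg : ∀ x y, f x * g y = g y * f x)
    (fh : ∀ x y, f x * h y = h y * f x) (gh : ∀ x y, g x * h y = h y * g x)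
    (hρ : YangBaxter (ρ : A ⊗[k] A)) :
    pair f h ρ.1 * pair g h ρ⁻¹.1 * pair f g ρ.1 =
      pair f g ρ.1 * pair g h ρ⁻¹.1 * pair f h ρ.1 := by
  match s, t, st with
  | .up, .down, _ => exact pair_triple_up_down_up hf hg hh fg fh gh hρ
  | .down, .up, _ =>
    have := pair_triple_up_down_up hf.op_down hg.op_up hh.op_down (op_comm fg) (op_comm fh) (op_comm gh) hρ
    rw [pair_op fg, pair_op fh, pair_op gh] at this
    exact opMap_injective (k := k) (by simpa only [opMap_mul, mul_assoc] using this.symm)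

theorem pair_mul_pair_same_up (hf : IsStrand .up f) (hg : IsStrand .up g)
    (fg : ∀ x y, f x * g y = g y * f x) {v w : A ⊗[k] A} (hvw : v * w = 1) :
    pair f g v * pair f g w = 1 := by
  let φ : A ⊗[k] A →ₐ[k] B := Algebra.TensorProduct.lift
    (AlgHom.ofLinearMap f hf.map_one (hf.map_mul_up rfl))
    (AlgHom.ofLinearMap g hg.map_one (hg.map_mul_up rfl)) fg
  have hφ : pair f g = φ.toLinearMap := by
    ext x y
    rfl
  rw [hφ, AlgHom.toLinearMap_apply, AlgHom.toLinearMap_apply, ← map_mul, hvw, map_one]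

/-- On strings of the same sign, multiplication in `A ⊗ A` corresponds to stacking. -/
theorem pair_mul_pair_same (hf : IsStrand s f) (hg : IsStrand s g)
    (fg : ∀ x y, f x * g y = g y * f x) {v w : A ⊗[k] A} (hvw : v * w = 1) (hwv : w * v = 1) :
    pair f g v * pair f g w = 1 := by
  cases s with
  | up => exact pair_mul_pair_same_up hf hg fg hvw
  | down =>
    have := pair_mul_pair_same_up hf.op_down hg.op_down (op_comm fg) hwv
    rw [pair_op fg, pair_op fg] at this
    exact opMap_injective (k := k) (this.trans rfl)

/-- The linear identification of `A ⊗ Aᵒᵖ` with `A ⊗ A`. -/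
def unopTensor (k A : Type*) [CommRing k] [Ring A] [Algebra k A] :
    A ⊗[k] Aᵐᵒᵖ ≃ₗ[k] A ⊗[k] A :=
  TensorProduct.congr (LinearEquiv.refl k A) (MulOpposite.opLinearEquiv k).symm

theorem unopTensor_one : unopTensor k A 1 = 1 := rfl

/-- An antihomomorphism from `A` is a homomorphism from `Aᵒᵖ`. Together with the commuting
homomorphism `f` it extends to an algebra homomorphism on `A ⊗ Aᵒᵖ`, which is why the axiom for
antiparallel strings lives in that algebra. -/
theorem pair_mul_pair_up_down {S T S' T' : A ≃ₐ[k] A} (hf : IsStrand .up f)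
    (hg : IsStrand .down g) (fg : ∀ x y, f x * g y = g y * f x) (v w : A ⊗[k] A) :
    pair (f ∘ₗ S.toLinearMap) (g ∘ₗ T.toLinearMap) v *
      pair (f ∘ₗ S'.toLinearMap) (g ∘ₗ T'.toLinearMap) w =
    pair f g (unopTensor k A (toTensorOp S T v * toTensorOp S' T' w)) := by
  let φ : A ⊗[k] Aᵐᵒᵖ →ₐ[k] B := Algebra.TensorProduct.lift
    (AlgHom.ofLinearMap f hf.map_one (hf.map_mul_up rfl))
    (AlgHom.ofLinearMap (g ∘ₗ (MulOpposite.opLinearEquiv k).symm.toLinearMap)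
      hg.map_one (fun x y => hg.map_mul_down rfl y.unop x.unop)) (fun x y => fg x y.unop)
  have hφ : ∀ (S T : A ≃ₐ[k] A) (w : A ⊗[k] A),
      pair (f ∘ₗ S.toLinearMap) (g ∘ₗ T.toLinearMap) w = φ (toTensorOp S T w) := by
    intro S T w
    have : pair (f ∘ₗ S.toLinearMap) (g ∘ₗ T.toLinearMap) = φ.toLinearMap ∘ₗ
        TensorProduct.map S.toLinearMap
          ((MulOpposite.opLinearEquiv k : A ≃ₗ[k] Aᵐᵒᵖ).toLinearMap ∘ₗ T.toLinearMap) := by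
      ext x y
      rfl
    exact LinearMap.congr_fun this w
  have hφ' : pair f g ∘ₗ (unopTensor k A).toLinearMap = φ.toLinearMap := by
    ext x y
    rfl
  rw [hφ, hφ, ← map_mul]
  exact (LinearMap.congr_fun hφ' _).symm

theorem pair_mul_pair_down_up {S T S' T' : A ≃ₐ[k] A} (hf : IsStrand .down f)
    (hg : IsStrand .up g) (fg : ∀ x y, f x * g y = g y * f x) (v w : A ⊗[k] A) :
    pair (f ∘ₗ S.toLinearMap) (g ∘ₗ T.toLinearMap) v *
      pair (f ∘ₗ S'.toLinearMap) (g ∘ₗ T'.toLinearMap) w =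
    pair f g (unopTensor k A (toTensorOp S' T' w * toTensorOp S T v)) := by
  have := pair_mul_pair_up_down (S := S') (T := T') (S' := S) (T' := T) hf.op_down hg.op_up
    (op_comm fg) w v
  simp only [LinearMap.comp_assoc] at this
  rw [pair_op (f := f ∘ₗ _) (g := g ∘ₗ _) fun x y => fg _ _,
    pair_op (f := f ∘ₗ _) (g := g ∘ₗ _) fun x y => fg _ _, pair_op fg] at this
  exact opMap_injective (k := k) this

theorem pair_one (hf : IsStrand s f) (hg : IsStrand t g) : pair f g 1 = 1 := by
  rw [Algebra.TensorProduct.one_def, pair_tmul, hf.map_one, hg.map_one, mul_one]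

/-- On strings of opposite signs, multiplication in `A ⊗ Aᵒᵖ` corresponds to stacking. -/
theorem pair_mul_pair_opposite {S T S' T' : A ≃ₐ[k] A} (st : s ≠ t) (hf : IsStrand s f)
    (hg : IsStrand t g) (fg : ∀ x y, f x * g y = g y * f x) {v w : A ⊗[k] A}
    (hvw : toTensorOp S T v * toTensorOp S' T' w = 1)
    (hwv : toTensorOp S' T' w * toTensorOp S T v = 1) :
    pair (f ∘ₗ S.toLinearMap) (g ∘ₗ T.toLinearMap) v *
      pair (f ∘ₗ S'.toLinearMap) (g ∘ₗ T'.toLinearMap) w = 1 := by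
  match s, t, st with
  | .up, .down, _ =>
    rw [pair_mul_pair_up_down hf hg fg, hvw, unopTensor_one, pair_one hf hg]
  | .down, .up, _ =>
    rw [pair_mul_pair_down_up hf hg fg, hwv, unopTensor_one, pair_one hf hg]

end

end

/-! ## The Yang-Baxter elements of the crossings -/

section

variable {k A B : Type*} [CommRing k] [Ring A] [Algebra k A] [Ring B] [Algebra k B]
  {ρ : (A ⊗[k] A)ˣ} {U D : A ≃ₐ[k] A} {s t u : Dir}

theorem crossingLabel_same_true (ρ : (A ⊗[k] A)ˣ) (U D : A ≃ₐ[k] A) (s : Dir) :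
    crossingLabel ρ U D s s true = ρ.1 := by
  cases s <;> rfl

theorem crossingLabel_same_false (ρ : (A ⊗[k] A)ˣ) (U D : A ≃ₐ[k] A) (s : Dir) :
    crossingLabel ρ U D s s false = TensorProduct.comm k A A ρ⁻¹.1 := by
  cases s <;> rfl

theorem crossingLabel_opposite_true (ρ : (A ⊗[k] A)ˣ) (U D : A ≃ₐ[k] A) (h : s ≠ t) :
    crossingLabel ρ U D s t true =
      TensorProduct.map (turn U D s).toLinearMap LinearMap.id ρ⁻¹.1 :=
  match s, t, h with
  | .up, .down, _ => rfl
  | .down, .up, _ => rfl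

theorem crossingLabel_opposite_false (ρ : (A ⊗[k] A)ˣ) (U D : A ≃ₐ[k] A) (h : s ≠ t) :
    crossingLabel ρ U D s t false =
      TensorProduct.map (turn U D s).toLinearMap LinearMap.id (TensorProduct.comm k A A ρ.1) :=
  match s, t, h with
  | .up, .down, _ => rfl
  | .down, .up, _ => rfl

/-- `T ⊗ T` is multiplicative, so with a unit it fixes the inverse of that unit. -/
theorem FixedBy.inv {T : A ≃ₐ[k] A} (h : FixedBy T ρ.1) : FixedBy T ρ⁻¹.1 := by
  let φ : A ⊗[k] A →* A ⊗[k] A := (Algebra.TensorProduct.map T.toAlgHom T.toAlgHom : _ →ₐ[k] _)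
  have e : Units.map φ ρ = ρ := Units.ext h
  exact congrArg Units.val ((map_inv (Units.map φ) ρ).trans (congrArg Inv.inv e))

theorem FixedBy.map_eq {T : A ≃ₐ[k] A} {w : A ⊗[k] A} (h : FixedBy T w) :
    TensorProduct.map T.toLinearMap T.toLinearMap w = w := h

theorem FixedBy.pair_eq {T : A ≃ₐ[k] A} {w : A ⊗[k] A} (h : FixedBy T w) (f g : A →ₗ[k] B) :
    pair (f ∘ₗ T.toLinearMap) (g ∘ₗ T.toLinearMap) w = pair f g w := by
  rw [← pair_map, h.map_eq]

theorem FixedBy.comm {T : A ≃ₐ[k] A} {w : A ⊗[k] A} (h : FixedBy T w) :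
    FixedBy T (TensorProduct.comm k A A w) := by
  have : TensorProduct.map T.toLinearMap T.toLinearMap ∘ₗ (TensorProduct.comm k A A).toLinearMap =
      (TensorProduct.comm k A A).toLinearMap ∘ₗ
        TensorProduct.map T.toLinearMap T.toLinearMap := by
    ext x y
    rfl
  exact (LinearMap.congr_fun this w).trans (congrArg (TensorProduct.comm k A A) h)

theorem comm_comm_eq (w : A ⊗[k] A) :
    TensorProduct.comm k A A (TensorProduct.comm k A A w) = w :=
  (TensorProduct.comm k A A).apply_symm_apply w

theorem map_comm_map_comm (S T : A ≃ₐ[k] A) (w : A ⊗[k] A) :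
    TensorProduct.map S.toLinearMap LinearMap.id (TensorProduct.comm k A A
      (TensorProduct.map T.toLinearMap LinearMap.id (TensorProduct.comm k A A w))) =
    TensorProduct.map S.toLinearMap T.toLinearMap w := by
  have : TensorProduct.map S.toLinearMap LinearMap.id ∘ₗ (TensorProduct.comm k A A).toLinearMap ∘ₗ
      TensorProduct.map T.toLinearMap LinearMap.id ∘ₗ (TensorProduct.comm k A A).toLinearMap =
      TensorProduct.map S.toLinearMap T.toLinearMap := by
    ext x y
    rfl
  exact LinearMap.congr_fun this w

theorem fixedBy_turn (hU : FixedBy U ρ.1) (hD : FixedBy D ρ.1) (s : Dir) :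
    FixedBy (turn U D s) ρ.1 := by
  cases s
  · exact hU
  · exact hD

/-- The Yang-Baxter elements of two crossings that are related by a switchback move. -/
theorem crossingLabel_switchback (hU : FixedBy U ρ.1) (hD : FixedBy D ρ.1) (h : s ≠ t) (u : Dir)
    (o : Bool) :
    crossingLabel ρ U D s u o = TensorProduct.map (turn U D s).toLinearMap LinearMap.id
      (TensorProduct.comm k A A (crossingLabel ρ U D u t (!o))) := by
  have hs := fixedBy_turn hU hD s
  have hu : s = u ∨ u = t := by cases s <;> cases t <;> cases u <;> simp_all
  -- If the passing string agrees in sign with the left leg, both tensor factors acquire the turn,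
  -- and invariance of `ρ` is needed. If it agrees with the right leg, the labels match by
  -- definition.
  rcases hu with rfl | rfl
  · cases o
    · rw [Bool.not_false, crossingLabel_same_false, crossingLabel_opposite_true ρ U D h]
      have e := map_comm_map_comm (turn U D s) (turn U D s) (TensorProduct.comm k A A ρ⁻¹.1)
      rw [comm_comm_eq, hs.inv.comm.map_eq] at e
      exact e.symm
    · rw [Bool.not_true, crossingLabel_same_true, crossingLabel_opposite_false ρ U D h,
        map_comm_map_comm, hs.map_eq]
  · cases o
    · rw [Bool.not_false, crossingLabel_same_true, crossingLabel_opposite_false ρ U D h]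
    · rw [Bool.not_true, crossingLabel_same_false, crossingLabel_opposite_true ρ U D h,
        comm_comm_eq]

variable {f g : A →ₗ[k] B}

/-- The axiom, transported to two strings of opposite signs. `D` and `U` keep their places for
either choice of signs; they are the turns of the two strings only when the first one falls. -/
theorem pair_turn_inverse_down (hρ : InverseInTensorOp ρ D U) (st : s ≠ t)
    (hf : IsStrand s f) (hg : IsStrand t g) (fg : ∀ x y, f x * g y = g y * f x) :
    pair (f ∘ₗ D.toLinearMap) g ρ⁻¹.1 * pair f (g ∘ₗ U.toLinearMap) ρ.1 = 1 ∧
      pair f (g ∘ₗ U.toLinearMap) ρ.1 * pair (f ∘ₗ D.toLinearMap) g ρ⁻¹.1 = 1 := by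
  have e₁ := pair_mul_pair_opposite st hf hg fg hρ.2 hρ.1
  have e₂ := pair_mul_pair_opposite st hf hg fg hρ.1 hρ.2
  have e (f : A →ₗ[k] B) : f ∘ₗ (AlgEquiv.refl : A ≃ₐ[k] A).toLinearMap = f :=
    LinearMap.ext fun _ => rfl
  rw [e, e] at e₁ e₂
  exact ⟨e₁, e₂⟩

/-- The two Yang-Baxter elements of antiparallel strings are inverse to each other. -/
theorem pair_turn_inverse (hcomm : ∀ x : A, D (U x) = U (D x)) (hU : FixedBy U ρ.1)
    (hD : FixedBy D ρ.1) (hρ : InverseInTensorOp ρ D U) (st : s ≠ t)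
    (hf : IsStrand s f) (hg : IsStrand t g) (fg : ∀ x y, f x * g y = g y * f x) :
    pair (f ∘ₗ (turn U D s).toLinearMap) g ρ⁻¹.1 * pair f (g ∘ₗ (turn U D t).toLinearMap) ρ.1 = 1 ∧
      pair f (g ∘ₗ (turn U D t).toLinearMap) ρ.1 *
        pair (f ∘ₗ (turn U D s).toLinearMap) g ρ⁻¹.1 = 1 := by
  match s, t, st with
  | .down, .up, st => exact pair_turn_inverse_down hρ st hf hg fg
  | .up, .down, st =>
    -- For a rising first string, `f` is replaced by `f ∘ U ∘ D⁻¹`. This produces `U` in the inverse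
    -- factor, while invariance of `ρ` under `D` and `U`, together with `D U = U D`, reduces the
    -- other factor to `1 ⊗ D`.
    have := pair_turn_inverse_down hρ st ((hf.comp_algEquiv U).comp_algEquiv D.symm) hg
      (fun x y => fg _ _)
    have e₁ : ((f ∘ₗ U.toLinearMap) ∘ₗ D.symm.toLinearMap) ∘ₗ D.toLinearMap =
        f ∘ₗ U.toLinearMap := by
      ext x
      simp
    have e₂ : pair ((f ∘ₗ U.toLinearMap) ∘ₗ D.symm.toLinearMap) (g ∘ₗ U.toLinearMap) ρ.1 =
        pair f (g ∘ₗ D.toLinearMap) ρ.1 := by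
      have e : (g ∘ₗ U.toLinearMap) ∘ₗ D.toLinearMap = (g ∘ₗ D.toLinearMap) ∘ₗ U.toLinearMap := by
        ext x
        simp [hcomm]
      rw [← hD.pair_eq, e₁, e, hU.pair_eq]
    rw [e₁, e₂] at this
    exact this

/-- The second Reidemeister moves for the Yang-Baxter elements. -/
theorem pair_crossingLabel_inverse (hcomm : ∀ x : A, D (U x) = U (D x)) (hU : FixedBy U ρ.1)
    (hD : FixedBy D ρ.1) (hρ : InverseInTensorOp ρ D U) (hf : IsStrand s f) (hg : IsStrand t g)
    (fg : ∀ x y, f x * g y = g y * f x) :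
    pair f g (crossingLabel ρ U D s t true) * pair g f (crossingLabel ρ U D t s false) = 1 ∧
      pair g f (crossingLabel ρ U D t s false) * pair f g (crossingLabel ρ U D s t true) = 1 := by
  by_cases st : s = t
  · subst st
    rw [crossingLabel_same_true, crossingLabel_same_false, pair_comm fun x y => (fg y x).symm]
    exact ⟨pair_mul_pair_same hf hg fg ρ.mul_inv ρ.inv_mul,
      pair_mul_pair_same hf hg fg ρ.inv_mul ρ.mul_inv⟩
  · rw [crossingLabel_opposite_true ρ U D st, crossingLabel_opposite_false ρ U D (Ne.symm st),
      pair_map, pair_map, LinearMap.comp_id, LinearMap.comp_id,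
      pair_comm fun x y => (fg y (turn U D t x)).symm]
    exact pair_turn_inverse hcomm hU hD hρ st hf hg fg

/-- The Yang-Baxter equation for three strings of arbitrary orientation. -/
theorem pair_crossingLabel_yangBaxter (h : IsOrientedQuantumAlgebra ρ D U) {f₁ f₂ f₃ : A →ₗ[k] B}
    (h₁ : IsStrand s f₁) (h₂ : IsStrand t f₂) (h₃ : IsStrand u f₃)
    (h₁₂ : ∀ x y, f₁ x * f₂ y = f₂ y * f₁ x) (h₁₃ : ∀ x y, f₁ x * f₃ y = f₃ y * f₁ x)
    (h₂₃ : ∀ x y, f₂ x * f₃ y = f₃ y * f₂ x) :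
    pair f₁ f₂ (crossingLabel ρ U D s t true) * pair f₁ f₃ (crossingLabel ρ U D s u true) *
        pair f₂ f₃ (crossingLabel ρ U D t u true) =
      pair f₂ f₃ (crossingLabel ρ U D t u true) * pair f₁ f₃ (crossingLabel ρ U D s u true) *
        pair f₁ f₂ (crossingLabel ρ U D s t true) := by
  have hs := fixedBy_turn h.fixedByU h.fixedByD s
  by_cases st : s = t
  · subst st
    by_cases su : s = u
    · subst su
      simp only [crossingLabel_same_true]
      exact pair_triple_same h₁ h₂ h₃ h₁₂ h₁₃ h₂₃ h.yangBaxter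
    -- The turn of the first two strings can be inserted in both slots of `ρ`, so it is absorbed
    -- into `f₁` and `f₂`.
    · rw [crossingLabel_same_true, crossingLabel_opposite_true ρ U D su, pair_map, pair_map,
        LinearMap.comp_id, ← hs.pair_eq]
      exact pair_triple_last su (h₁.comp_algEquiv _) (h₂.comp_algEquiv _) h₃
        (fun x y => h₁₂ _ _) (fun x y => h₁₃ _ _) (fun x y => h₂₃ _ _) h.yangBaxter
  · by_cases su : s = u
    · subst su
      -- The antiparallel middle string. The rearranged equation reads `W Z Y = Y Z W`, where `Y` is
      -- the inverse of `X` by the axiom for antiparallel strings; multiplying by `X` on both sides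
      -- gives `X W Z = Z W X`.
      obtain ⟨e₁, e₂⟩ := pair_turn_inverse h.commute h.fixedByU h.fixedByD h.inverse st h₁ h₂ h₁₂
      have e := pair_triple_middle st h₁ (h₂.comp_algEquiv (turn U D t)) h₃
        (fun x y => h₁₂ _ _) (fun x y => h₁₃ _ _) (fun x y => h₂₃ _ _) h.yangBaxter
      rw [crossingLabel_same_true, crossingLabel_opposite_true ρ U D st,
        crossingLabel_opposite_true ρ U D (Ne.symm st), pair_map, pair_map, LinearMap.comp_id,
        LinearMap.comp_id]
      generalize pair (f₁ ∘ₗ (turn U D s).toLinearMap) f₂ ρ⁻¹.1 = X at *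
      generalize pair f₁ (f₂ ∘ₗ (turn U D t).toLinearMap) ρ.1 = Y at *
      generalize pair f₁ f₃ ρ.1 = W at *
      generalize pair (f₂ ∘ₗ (turn U D t).toLinearMap) f₃ ρ⁻¹.1 = Z at *
      calc X * W * Z = X * (W * Z * Y) * X := by simp only [mul_assoc, e₂, mul_one]
        _ = Z * W * X := by rw [e]; simp only [← mul_assoc, e₁, one_mul]
    · obtain rfl : t = u := by cases s <;> cases t <;> cases u <;> simp_all
      simp only [crossingLabel_same_true, crossingLabel_opposite_true ρ U D st, pair_map,
        LinearMap.comp_id]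
      exact pair_triple_first (Ne.symm st) (h₁.comp_algEquiv _) h₂ h₃ (fun x y => h₁₂ _ _)
        (fun x y => h₁₃ _ _) h₂₃ h.yangBaxter

/-- The Yang-Baxter element of a crossing of two strings, as a unit. -/
noncomputable def crossingUnit (h : IsOrientedQuantumAlgebra ρ D U) {f g : A →ₗ[k] B}
    (hf : IsStrand s f) (hg : IsStrand t g) (fg : ∀ x y, f x * g y = g y * f x) : Bˣ where
  val := pair f g (crossingLabel ρ U D s t true)
  inv := pair g f (crossingLabel ρ U D t s false)
  val_inv := (pair_crossingLabel_inverse h.commute h.fixedByU h.fixedByD h.inverse hf hg fg).1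
  inv_val := (pair_crossingLabel_inverse h.commute h.fixedByU h.fixedByD h.inverse hf hg fg).2

/-- The third Reidemeister moves for the Yang-Baxter elements. -/
theorem pair_crossingLabel_three (h : IsOrientedQuantumAlgebra ρ D U) {f₁ f₂ f₃ : A →ₗ[k] B}
    (h₁ : IsStrand s f₁) (h₂ : IsStrand t f₂) (h₃ : IsStrand u f₃)
    (h₁₂ : ∀ x y, f₁ x * f₂ y = f₂ y * f₁ x) (h₁₃ : ∀ x y, f₁ x * f₃ y = f₃ y * f₁ x)
    (h₂₃ : ∀ x y, f₂ x * f₃ y = f₃ y * f₂ x) {o₁₂ o₁₃ o₂₃ : Bool} (ho : o₁₂ = o₂₃ → o₁₃ = o₁₂) :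
    pair f₁ f₂ (crossingLabel ρ U D s t o₁₂) * pair f₁ f₃ (crossingLabel ρ U D s u o₁₃) *
        pair f₂ f₃ (crossingLabel ρ U D t u o₂₃) =
      pair f₂ f₃ (crossingLabel ρ U D t u o₂₃) * pair f₁ f₃ (crossingLabel ρ U D s u o₁₃) *
        pair f₁ f₂ (crossingLabel ρ U D s t o₁₂) := by
  have h₂₁ := fun x y => (h₁₂ y x).symm
  have h₃₁ := fun x y => (h₁₃ y x).symm
  have h₃₂ := fun x y => (h₂₃ y x).symm
  let u₁₂ := crossingUnit h h₁ h₂ h₁₂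
  let u₁₃ := crossingUnit h h₁ h₃ h₁₃
  let u₂₃ := crossingUnit h h₂ h₃ h₂₃
  let u₂₁ := crossingUnit h h₂ h₁ h₂₁
  let u₃₁ := crossingUnit h h₃ h₁ h₃₁
  let u₃₂ := crossingUnit h h₃ h₂ h₃₂
  -- The admissible patterns are the six orderings of the strings by height. In each case the
  -- Yang-Baxter identity is taken for the strings listed from top to bottom; where string `i`
  -- passes under string `j`, the factor is the inverse of the unit for `j` over `i`.
  match o₁₂, o₁₃, o₂₃, ho with
  | true, true, true, _ => exact pair_crossingLabel_yangBaxter h h₁ h₂ h₃ h₁₂ h₁₃ h₂₃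
  | false, false, false, _ =>
    exact (yangBaxter_inv (x := u₃₂) (y := u₃₁) (z := u₂₁)
      (pair_crossingLabel_yangBaxter h h₃ h₂ h₁ h₃₂ h₃₁ h₂₁)).2.2.2.2
  | true, true, false, _ =>
    exact (yangBaxter_inv (x := u₁₃) (y := u₁₂) (z := u₃₂)
      (pair_crossingLabel_yangBaxter h h₁ h₃ h₂ h₁₃ h₁₂ h₃₂)).2.2.1
  | false, true, true, _ =>
    exact (yangBaxter_inv (x := u₂₁) (y := u₂₃) (z := u₁₃)
      (pair_crossingLabel_yangBaxter h h₂ h₁ h₃ h₂₁ h₂₃ h₁₃)).2.2.2.1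
  | true, false, false, _ =>
    exact (yangBaxter_inv (x := u₃₁) (y := u₃₂) (z := u₁₂)
      (pair_crossingLabel_yangBaxter h h₃ h₁ h₂ h₃₁ h₃₂ h₁₂)).2.1.symm
  | false, false, true, _ =>
    exact (yangBaxter_inv (x := u₂₃) (y := u₂₁) (z := u₃₁)
      (pair_crossingLabel_yangBaxter h h₂ h₃ h₁ h₂₃ h₂₁ h₃₁)).1.symm

end

/-! ## Invariance of the decoration -/

section

variable {k A : Type*} [CommRing k] [Ring A] [Algebra k A] {ρ : (A ⊗[k] A)ˣ} {U D : A ≃ₐ[k] A}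

open BeadHom StrandState

theorem decorate_cast {a a' b b' : List Dir} (ha : a = a') (hb : b = b') {T : TangleDiagram a b}
    {f : BeadDiagram k A a b} (h : decorate ρ U D T = Quot.mk _ f) :
    decorate ρ U D (T.cast ha hb) = Quot.mk _ (f.cast ha hb) := by
  subst ha hb
  exact h

theorem decorate_eq_of_reidemeisterTwo (hcomm : ∀ x : A, D (U x) = U (D x))
    (hU : FixedBy U ρ.1) (hD : FixedBy D ρ.1) (hρ : InverseInTensorOp ρ D U) {a b : List Dir}
    {S T : TangleDiagram a b} (hST : TangleDiagram.ReidemeisterTwo S T) :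
    decorate ρ U D S = decorate ρ U D T := by
  obtain ⟨s, t, o⟩ := hST
  rw [decorate_two]
  cases o
  · exact (pair_crossingLabel_inverse hcomm hU hD hρ
      (isStrand_rightBead s t) (isStrand_leftBead s t)
      fun x y => (commute_left_right s t y x).symm).2
  · exact (pair_crossingLabel_inverse hcomm hU hD hρ
      (isStrand_leftBead s t) (isStrand_rightBead s t) (commute_left_right s t)).1

theorem decorate_eq_of_reidemeisterThree (h : IsOrientedQuantumAlgebra ρ D U) {a b : List Dir}
    {S T : TangleDiagram a b} (hST : TangleDiagram.ReidemeisterThree S T) :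
    decorate ρ U D S = decorate ρ U D T := by
  obtain ⟨s, t, u, o₁₂, o₁₃, o₂₃, ho⟩ := hST
  rw [decorate_three_left, decorate_three_right, cross_three,
    pair_crossingLabel_three h (isStrand_bead₁ s t u) (isStrand_bead₂ s t u)
      (isStrand_bead₃ s t u) (commute₁₂ s t u) (commute₁₃ s t u) (commute₂₃ s t u) ho]

theorem decorate_eq_of_switchback (hU : FixedBy U ρ.1) (hD : FixedBy D ρ.1) {a b : List Dir}
    {S T : TangleDiagram a b} (hST : TangleDiagram.Switchback S T) :
    decorate ρ U D S = decorate ρ U D T := by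
  cases hST with
  | @cap s t h u o =>
    rw [decorate_switchback_cap_left, decorate_switchback_cap_right,
      crossingLabel_switchback hU hD h]
  | @cup s t h u o =>
    rw [decorate_switchback_cup_left, decorate_switchback_cup_right,
      -- A minimum obeys the same identity with its two legs exchanged.
      crossingLabel_switchback hU hD h.symm u (!o), Bool.not_not]

theorem decorate_eq_of_zigzag {a b : List Dir} {S T : TangleDiagram a b}
    (hST : TangleDiagram.Zigzag S T) : decorate ρ U D S = decorate ρ U D T := by
  cases hST with
  | left h => exact Quot.sound (.flat (.zigzag_left h))
  | right h => exact Quot.sound (.flat (.zigzag_right h))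

/-- Over an oriented quantum algebra the decoration is invariant under regular isotopy. -/
theorem decorate_eq_of_regularIsotopy (h : IsOrientedQuantumAlgebra ρ D U) {a b : List Dir}
    {S T : TangleDiagram a b} (hST : TangleDiagram.RegularIsotopy S T) :
    decorate ρ U D S = decorate ρ U D T := by
  induction hST with
  | refl S => rfl
  | symm _ ih => exact ih.symm
  | trans _ _ ih ih' => exact ih.trans ih'
  | comp_congr _ _ ih ih' => simp only [decorate, ih, ih']
  | tensor_congr _ _ ih ih' => simp only [decorate, ih, ih']
  | id_comp S => exact ident_comp _
  | comp_id S => exact comp_ident _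
  | assoc S T R => exact comp_assoc _ _ _
  | tensor_id a b => exact ident_tensor_ident a b
  | nil_tensor S =>
    obtain ⟨f, hf⟩ := Quot.exists_rep (decorate ρ U D S)
    simp only [decorate, ← hf]
    exact Quot.sound (.nil_tensor f)
  | tensor_nil S =>
    -- The casts are defined on diagrams, so the law is verified on a representative.
    obtain ⟨f, hf⟩ := Quot.exists_rep (decorate ρ U D S)
    rw [decorate_cast _ _ (T := S.tensor (.id [])) (f := f.tensor (.id []))
      (by simp only [decorate, ← hf]; rfl), ← hf]
    exact Quot.sound (.tensor_nil f)
  | tensor_assoc S T R =>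
    obtain ⟨f, hf⟩ := Quot.exists_rep (decorate ρ U D S)
    obtain ⟨g, hg⟩ := Quot.exists_rep (decorate ρ U D T)
    obtain ⟨e, he⟩ := Quot.exists_rep (decorate ρ U D R)
    rw [decorate_cast _ _ (T := (S.tensor T).tensor R) (f := (f.tensor g).tensor e)
      (by simp only [decorate, ← hf, ← hg, ← he]; rfl)]
    simp only [decorate, ← hf, ← hg, ← he]
    exact Quot.sound (.tensor_assoc f g e)
  | interchange S T S' T' => exact tensor_comp _ _ _ _
  | zigzag h' => exact decorate_eq_of_zigzag h'
  | two h' =>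
    exact decorate_eq_of_reidemeisterTwo h.commute h.fixedByU h.fixedByD h.inverse h'
  | three h' => exact decorate_eq_of_reidemeisterThree h h'
  | switchback h' => exact decorate_eq_of_switchback h.fixedByU h.fixedByD h'

/-! ## Necessity of the axioms -/

/-- An explicit representative, on which the model can be evaluated step by step. -/
theorem pair_bead_comp_capPast {s t : Dir} (h : s ≠ t) (u : Dir) (x y : A) :
    (pair (bead₁ U D s u t) (bead₂ U D s u t) (x ⊗ₜ[k] y)).comp (capPast U D h u) =
      Quot.mk _ (BeadDiagram.comp (a := [s, u, t]) (b := [u, s, t]) (c := [u])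
        (.tensor (.comp (.tensor (.bead s x) (.bead u y)) (.crossing s u)) (.id [t]))
        (.tensor (.id [u]) (.cap h))) := by
  change (comp (bead₁ U D s u t x) (bead₂ U D s u t y)).comp _ = _
  change (comp (a := [s, u, t]) (b := [s, u, t]) (c := [s, u, t])
    ((leftBead U D s u x).tensor (ident [t])) ((rightBead U D s u y).tensor (ident [t]))).comp _ = _
  rw [← comp_tensor_ident]
  have := leftBead_mul_rightBead (k := k) (U := U) (D := D) s u x y
  rw [mul_eq_comp] at this
  rw [this]
  unfold capPast cross₁₂
  rw [← comp_assoc]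
  exact congrArg (fun f => comp f ((ident [u]).tensor (cap h)))
    (comp_tensor_ident (a := [s, u]) (b := [s, u]) (c := [u, s]) _ _ [t]).symm

/-- The cap leads the first string into string `2`, whose head is the extra end. Its bead is met
before the turn and is read as `U⁻¹ x`; applying `U` to the second factor corrects this, and the
crossing accounts for the flip. -/
theorem pair_bead_comp_capPast_up_injective (h : Dir.up ≠ Dir.down) : Function.Injective fun w =>
    (pair (bead₁ U D .up .up .down) (bead₂ U D .up .up .down) w).comp (capPast U D h .up) := by
  have hst : Admissible ([.up, .up, .down] ++ [.up])
      [(Dir.up, 0), (Dir.up, 1), (Dir.down, 2), (Dir.up, 2)] :=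
    ⟨rfl, by simp, by simp⟩
  have key : TensorProduct.map LinearMap.id U.toLinearMap ∘ₗ eval [.up] (_, fun _ => 1) hst ∘ₗ
      (compₗ U D _ _ _).flip (capPast U D h .up) ∘ₗ
      pair (bead₁ U D .up .up .down) (bead₂ U D .up .up .down) =
      (TensorProduct.comm k A A).toLinearMap := by
    ext x y
    change TensorProduct.map LinearMap.id U.toLinearMap (eval [.up] (_, fun _ => 1) hst
      ((pair (bead₁ U D .up .up .down) (bead₂ U D .up .up .down) (x ⊗ₜ[k] y)).comp
        (capPast U D h .up))) = y ⊗ₜ x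
    rw [pair_bead_comp_capPast, eval_mk]
    simp [act, pull, stepBead, stepCross, stepCap, joinName, joinLabel, readout, ups, beadAct, capTurn]
  intro v w hvw
  have := congrArg (fun f => TensorProduct.map LinearMap.id U.toLinearMap
    (eval [.up] (_, fun _ => 1) hst f)) hvw
  exact (TensorProduct.comm k A A).injective
    ((LinearMap.congr_fun key v).symm.trans (this.trans (LinearMap.congr_fun key w)))

/-- Two extra ends are the heads of the two falling strings. The turn now precedes the bead and is
applied to `1`, so no correction appears. -/
theorem pair_bead_comp_capPast_down_injective (h : Dir.down ≠ Dir.up) :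
    Function.Injective fun w =>
      (pair (bead₁ U D .down .down .up) (bead₂ U D .down .down .up) w).comp
        (capPast U D h .down) := by
  have hst : Admissible ([.down, .down, .up] ++ [.up, .up])
      [(Dir.down, 0), (Dir.down, 1), (Dir.up, 2), (Dir.up, 0), (Dir.up, 1)] :=
    ⟨rfl, by simp, by simp⟩
  have key : eval [.up, .up] (_, fun _ => 1) hst ∘ₗ
      (compₗ U D _ _ _).flip (capPast U D h .down) ∘ₗ
      pair (bead₁ U D .down .down .up) (bead₂ U D .down .down .up) = LinearMap.id := by
    ext x y
    change eval [.up, .up] (_, fun _ => 1) hst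
      ((pair (bead₁ U D .down .down .up) (bead₂ U D .down .down .up) (x ⊗ₜ[k] y)).comp
        (capPast U D h .down)) = x ⊗ₜ y
    rw [pair_bead_comp_capPast, eval_mk]
    simp [act, pull, stepBead, stepCross, stepCap, joinName, joinLabel, readout, ups, beadAct,
      capTurn]
  intro v w hvw
  have := congrArg (eval [.up, .up] (_, fun _ => 1) hst) hvw
  exact (LinearMap.congr_fun key v).symm.trans (this.trans (LinearMap.congr_fun key w))

/-- The move at a maximum whose left leg has the sign of the passing string is the informative one:
one side carries `ρ`, the other `ρ` with the turn applied to both factors. -/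
theorem fixedBy_turn_of_switchback {s t : Dir} (h : s ≠ t)
    (hinj : ∀ v w : A ⊗[k] A,
      (pair (bead₁ U D s s t) (bead₂ U D s s t) v).comp (capPast U D h s) =
        (pair (bead₁ U D s s t) (bead₂ U D s s t) w).comp (capPast U D h s) → v = w)
    (H : ∀ (a b : List Dir) (S T : TangleDiagram a b), TangleDiagram.Switchback S T →
      decorate ρ U D S = decorate ρ U D T) : FixedBy (turn U D s) ρ.1 := by
  have e := H _ _ _ _ (.cap h s true)
  rw [decorate_switchback_cap_left, decorate_switchback_cap_right] at e
  have e' := hinj _ _ e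
  clear e
  rw [crossingLabel_same_true, Bool.not_true, crossingLabel_opposite_false ρ U D h,
    map_comm_map_comm] at e'
  exact e'.symm

/-- Invariance under the switchback moves forces `ρ` to be fixed by `U` and `D`. -/
theorem fixedBy_of_switchback
    (H : ∀ (a b : List Dir) (S T : TangleDiagram a b), TangleDiagram.Switchback S T →
      decorate ρ U D S = decorate ρ U D T) : FixedBy U ρ.1 ∧ FixedBy D ρ.1 := by
  exact ⟨fixedBy_turn_of_switchback (s := .up) (t := .down) nofun
      (fun _ _ e => pair_bead_comp_capPast_up_injective _ e) H,
    fixedBy_turn_of_switchback (s := .down) (t := .up) nofun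
      (fun _ _ e => pair_bead_comp_capPast_down_injective _ e) H⟩

/-- With the falling string on the left and on top, the move sees one of the two products in `A ⊗
Aᵒᵖ`. The order is reversed because the first tensor factor belongs to the falling string. -/
theorem decorate_two_down_up :
    decorate ρ U D (.comp (.crossing .down .up true) (.crossing .up .down false)) =
      beads U D .down .up (unopTensor k A (toTensorOp AlgEquiv.refl U ρ.1 *
        toTensorOp D AlgEquiv.refl ρ⁻¹.1)) := by
  rw [decorate_two, crossingLabel_opposite_true ρ U D (s := .down) (t := .up) nofun,
    crossingLabel_opposite_false ρ U D (s := .up) (t := .down) nofun, pair_map, pair_map, LinearMap.comp_id, LinearMap.comp_id,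
    pair_comm fun x y => (commute_left_right _ _ y (turn U D .up x)).symm, beads_eq_pair,
    ← pair_mul_pair_down_up (isStrand_leftBead .down .up) (isStrand_rightBead .down .up)
      (commute_left_right _ _)]
  rfl

/-- The mirror move sees the other product, so the two moves together express a two-sided inverse.
-/
theorem decorate_two_up_down :
    decorate ρ U D (.comp (.crossing .up .down false) (.crossing .down .up true)) =
      beads U D .up .down (TensorProduct.comm k A A (unopTensor k A
        (toTensorOp D AlgEquiv.refl ρ⁻¹.1 * toTensorOp AlgEquiv.refl U ρ.1))) := by
  rw [decorate_two, crossingLabel_opposite_true ρ U D (s := .down) (t := .up) nofun,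
    crossingLabel_opposite_false ρ U D (s := .up) (t := .down) nofun, pair_map, pair_map, LinearMap.comp_id, LinearMap.comp_id,
    pair_comm fun x y => commute_left_right _ _ (turn U D .up x) y, beads_eq_pair,
    pair_comm (commute_left_right _ _),
    ← pair_mul_pair_down_up (isStrand_rightBead .up .down) (isStrand_leftBead .up .down)
      fun x y => (commute_left_right _ _ y x).symm]
  rfl

theorem beads_one (s t : Dir) : beads (k := k) U D s t 1 = 1 := by
  rw [beads_eq_pair, pair_one (isStrand_leftBead s t) (isStrand_rightBead s t)]

/-- The reverse second Reidemeister moves with a descending overcrossing string. -/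
theorem reverseTwo_down_iff :
    (∀ (a b : List Dir) (S T : TangleDiagram a b), TangleDiagram.ReverseTwo .down S T →
      decorate ρ U D S = decorate ρ U D T) ↔ InverseInTensorOp ρ D U := by
  constructor
  · intro H
    have h₁ := H _ _ _ _ (.left (t := .up) nofun)
    have h₂ := H _ _ _ _ (.right (t := .up) nofun)
    rw [decorate_two_down_up] at h₁
    rw [decorate_two_up_down] at h₂
    have e₁ := beads_down_up_injective (h₁.trans (beads_one .down .up).symm)
    have e₂ := beads_up_down_injective (h₂.trans (beads_one .up .down).symm)
    have e₃ := (TensorProduct.comm k A A).injective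
      (e₂.trans (TensorProduct.comm_tmul k A A 1 1).symm)
    exact ⟨(unopTensor k A).injective (e₁.trans unopTensor_one.symm),
      (unopTensor k A).injective (e₃.trans unopTensor_one.symm)⟩
  · rintro hρ a b S T (@⟨t, h⟩ | @⟨t, h⟩)
    · cases t with
      | up => rw [decorate_two_down_up, hρ.1, unopTensor_one, beads_one]; rfl
      | down => exact absurd rfl h
    · cases t with
      | up =>
        rw [decorate_two_up_down, hρ.2, unopTensor_one]
        exact beads_one .up .down
      | down => exact absurd rfl h

theorem TangleDiagram.ReverseTwo.reidemeisterTwo {r : Dir} {a b : List Dir}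
    {S T : TangleDiagram a b} (h : TangleDiagram.ReverseTwo r S T) :
    TangleDiagram.ReidemeisterTwo S T := by
  cases h with
  | left h => exact .mk _ _ true
  | right h => exact .mk _ _ false

/-! ## The functor -/

/-- The functor given by the decoration of diagrams. -/
noncomputable def decorationFunctor (h : IsOrientedQuantumAlgebra ρ D U) : Tang ⥤ BeadCat U D where
  obj a := a
  map f := Quot.lift (decorate ρ U D) (fun _ _ => decorate_eq_of_regularIsotopy h) f
  map_id _ := rfl
  map_comp := by rintro _ _ _ ⟨S⟩ ⟨T⟩; rfl

theorem existsUnique_decorationFunctor (h : IsOrientedQuantumAlgebra ρ D U) :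
    ∃! F : Tang ⥤ BeadCat U D, IsDecorationFunctor ρ U D F := by
  have hF : ∀ (a b : List Dir) (T : TangleDiagram a b), (decorationFunctor h).map (Tang.mk T) =
      decorateHom ρ U D T := fun _ _ _ => rfl
  refine ⟨decorationFunctor h, ⟨fun _ => rfl, fun a b T => ?_⟩, ?_⟩
  · exact (hF a b T).trans
      ((Category.id_comp (X := BeadCat.of U D a) (decorateHom ρ U D T ≫ 𝟙 _)).trans
        (Category.comp_id _)).symm
  -- Every morphism is represented by a diagram, so the prescribed values determine the functor.
  · rintro G ⟨hobj, hmap⟩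
    refine CategoryTheory.Functor.ext hobj ?_
    rintro a b ⟨T⟩
    exact hmap a b T

/-- The comparison isomorphisms on objects depend only on the ends and cancel, so isotopic diagrams
have equal decorations. -/
theorem IsDecorationFunctor.decorate_eq {F : Tang ⥤ BeadCat U D} (hF : IsDecorationFunctor ρ U D F)
    {a b : List Dir} {S T : TangleDiagram a b} (h : TangleDiagram.RegularIsotopy S T) :
    decorate ρ U D S = decorate ρ U D T := by
  obtain ⟨hobj, hmap⟩ := hF
  have e : Tang.mk S = Tang.mk T := Quot.sound h
  have := (hmap a b S).symm.trans ((congrArg F.map e).trans (hmap a b T))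
  rw [cancel_epi, cancel_mono] at this
  exact this

end

/-! ### The theorem -/

theorem mainTheorem1 {k A : Type*} [CommRing k] [Ring A] [Algebra k A]
    (ρ : (A ⊗[k] A)ˣ) (D U : A ≃ₐ[k] A)
    (hYB : YangBaxter (ρ : A ⊗[k] A)) (hcomm : ∀ x : A, D (U x) = U (D x)) :
    (IsOrientedQuantumAlgebra ρ D U →
      ∃! F : Tang ⥤ BeadCat U D, IsDecorationFunctor ρ U D F) ∧
    ((∃ F : Tang ⥤ BeadCat U D, IsDecorationFunctor ρ U D F) →
      IsOrientedQuantumAlgebra ρ D U) ∧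
    ((∀ (a b : List Dir) (S T : TangleDiagram a b), TangleDiagram.Switchback S T →
        decorate ρ U D S = decorate ρ U D T) ↔
      FixedBy U (ρ : A ⊗[k] A) ∧ FixedBy D (ρ : A ⊗[k] A)) ∧
    ((∀ (a b : List Dir) (S T : TangleDiagram a b), TangleDiagram.ReverseTwo .down S T →
        decorate ρ U D S = decorate ρ U D T) ↔
      InverseInTensorOp ρ D U) ∧
    (FixedBy U (ρ : A ⊗[k] A) → FixedBy D (ρ : A ⊗[k] A) →
      ((∀ (r : Dir) (a b : List Dir) (S T : TangleDiagram a b), TangleDiagram.ReverseTwo r S T →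
          decorate ρ U D S = decorate ρ U D T) ↔
        InverseInTensorOp ρ D U)) := by
  refine ⟨existsUnique_decorationFunctor, ?_, ⟨fixedBy_of_switchback, ?_⟩, reverseTwo_down_iff, ?_⟩
  -- Of all moves, only the switchbacks and the reverse moves II with a falling overstring are used.
  · rintro ⟨F, hF⟩
    obtain ⟨hU, hD⟩ := fixedBy_of_switchback (ρ := ρ) (U := U) (D := D)
      fun _ _ _ _ h => hF.decorate_eq (.switchback h)
    exact ⟨hYB, hcomm, hU, hD, reverseTwo_down_iff.1
      fun _ _ _ _ h => hF.decorate_eq (.two h.reidemeisterTwo)⟩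
  · rintro ⟨hU, hD⟩ a b S T h
    exact decorate_eq_of_switchback hU hD h
  · refine fun hU hD => ⟨fun H => reverseTwo_down_iff.1 (H .down), ?_⟩
    intro hρ r a b S T h
    exact decorate_eq_of_reidemeisterTwo hcomm hU hD hρ h.reidemeisterTwo
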